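/- Let $\Bbbk$ be an algebraically closed field of characteristic $0$. **Tube algebra.** Let $\mathcal C$ be a fusion category over $\Bbbk$ (a $\Bbbk$-linear abelian rigid monoidal category with bilinear tensor product, finite-dimensional morphism spaces and simple unit object, in which every object is a finite direct sum of simple objects and there are finitely many simple objects up to isomorphism), and let $\mathrm{Irr}(\mathcal C)$ be a set of representatives of its simple objects. The tube algebra is the vector space $$\mathrm{Tube}_{\mathcal C}=\bigoplus_{x,y,w\in\mathrm{Irr}(\mathcal C)}\mathcal C(x\otimes w,\,w\otimes y)$$ in which the product of $h\colon x'\otimes w'\to w'\otimes y'$ and $g\colon x\otimes w\to w\otimes y$ is $0$ if $x\neq y'$, and otherwise has as its component in $\mathcal C(x'\otimes t,t\otimes y)$ the sum $\sum_\alpha (P_t^\alpha\otimes 1)(1\otimes g)(h\otimes 1)(1\otimes I_t^\alpha)$, where $I_t^\alpha\colon t\to w'\otimes w$ and $P_t^\alpha\colon w'\otimes w\to t$ are the inclusions and projections of a decomposition of $w'\otimes w$ into simple objects. Its unit is $\sum_x \mathrm{id}_x$ with $\mathrm{id}_x\in\mathcal C(x\otimes \mathbb 1,\mathbb 1\otimes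 x)$. Write $x^L$ for the dual of $x$ with evaluation $x^L\otimes x\to\mathbb 1$ and $x^R$ for the dual with evaluation $x\otimes x^R\to\mathbb 1$. A pivotal structure on $\mathcal C$ is a monoidal natural isomorphism $\mathfrak a\colon\mathrm{Id}\to(-)^{RR}$. Given one, there is a functor $J\colon\mathcal Z(\mathcal C)\to\mathrm{Rep}(\mathrm{Tube}_{\mathcal C})$ from the Drinfeld center to the finite-dimensional left modules, $J(z,\gamma_{-,z})=\bigoplus_{x\in\mathrm{Irr}(\mathcal C)}\mathcal C(x,z)$, given on morphisms by composition; here $g\colon x\otimes w\to w\otimes y$ sends $s\colon y\to z$ to the composite $$x\to x\otimes w\otimes w^L\xrightarrow{g\otimes1}w\otimes y\otimes w^L\xrightarrow{1\otimes s\otimes1}w\otimes z\otimes w^L\xrightarrow{\gamma_{w,z}\otimes1}z\otimes w\otimes w^L\xrightarrow{1\otimes 1\otimes\mathfrak a_{w^L}}z\otimes w\otimes w^R\to z,$$ and it sends $s\colon y_0\to z$ with $y_0\in\mathrm{Irr}(\mathcal C)$, $y_0\ne y$, to $0$. This functor $J$ is the well-known equivalence $\mathcal Z(\mathcal C)\simeq\mathrm{Rep}(\mathrm{Tube}_{\mathcal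 C})$. **Weak bialgebras.** A weak bialgebra over $\Bbbk$ is an algebra $A$ with a coalgebra structure $(\Delta,\epsilon)$ such that $\Delta(xy)=\Delta(x)\Delta(y)$, $\epsilon(xy_{(1)})\epsilon(y_{(2)}z)=\epsilon(xyz)=\epsilon(xy_{(2)})\epsilon(y_{(1)}z)$ and $1_{(1)}\otimes1_{(2)}1_{(1')}\otimes1_{(2')}=1_{(1)}\otimes1_{(2)}\otimes1_{(3)}=1_{(1)}\otimes1_{(1')}1_{(2)}\otimes1_{(2')}$. For left $A$-modules $V,W$ let $V\boxtimes W$ be the image of the idempotent $v\otimes w\mapsto1_{(1)}v\otimes1_{(2)}w$ of $V\otimes W$, with $A$ acting by $x\cdot(v\otimes w)=x_{(1)}v\otimes x_{(2)}w$. If $A$ is finite-dimensional, the category of finite-dimensional left $A$-modules is monoidal with tensor product $\boxtimes$ and the canonical associator; its unit object is the space $A^l=\{\epsilon(1_{(1)}x)1_{(2)}: x\in A\}$ with action $a\cdot y=\epsilon(1_{(1)}ay)1_{(2)}$, and its unitors are $y\otimes v\mapsto yv$ and $v\otimes y\mapsto 1_{(1)}\epsilon(1_{(2)}y)v$. **Fibonacci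 categories.** Let $\varphi\in\Bbbk$ with $\varphi^2=\varphi+1$. A Fibonacci category of dimension parameter $\varphi$ is a fusion category over $\Bbbk$ with a pivotal structure which has, up to isomorphism, exactly two simple objects $\mathbb 1\not\cong\nu$, with $\nu\otimes\nu\cong\mathbb 1\oplus\nu$, and in which the composite $\mathbb 1\to\nu\otimes\nu^L\xrightarrow{1\otimes\mathfrak a_{\nu^L}}\nu\otimes\nu^R\to\mathbb 1$ is $\varphi$ times the identity. (For $\Bbbk=\mathbb C$ and $\varphi=\frac{1+\sqrt5}2$ this is the usual Fibonacci category.) **Proposition (the tube algebra is in general not a weak Hopf algebra).** Let $\varphi\in\Bbbk$ with $\varphi^2=\varphi+1$. 1. For every weak bialgebra $A$ over $\Bbbk$ and all finite-dimensional left $A$-modules $V,W$, $\dim(V\boxtimes W)\le\dim V\cdot\dim W$. 2. There is a Fibonacci category $\mathcal C$ of dimension parameter $\varphi$, with a braiding $c$, such that for every choice of $\mathrm{Irr}(\mathcal C)$ the following hold. For the object $z=(\nu,c_{-,\nu})$ of $\mathcal Z(\mathcal C)$ one has $\dim J(z)=1$ and $\dim J(z\otimes z)=2$. Moreover, for every weak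 bialgebra structure on the algebra $\mathrm{Tube}_{\mathcal C}$, the functor $J$ admits no structure of a monoidal functor from $\mathcal Z(\mathcal C)$ to $\mathrm{Rep}(\mathrm{Tube}_{\mathcal C})$ with the induced monoidal structure; in particular no weak bialgebra structure on $\mathrm{Tube}_{\mathcal C}$ makes the equivalence $J$ monoidal. -/

import Mathlib

namespace TubeAlg

section Rigid
open CategoryTheory MonoidalCategory

universe v u
variable {C : Type u} [Category.{v} C] [MonoidalCategory C]

/-- The transpose `X' ⟶ X` of `f : Y ⟶ Y'`, where `X` and `X'` are left duals (in Mathlib's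
sense) of `Y` and `Y'`. -/
def mate {X Y X' Y' : C} (p : ExactPairing X Y) (p' : ExactPairing X' Y') (f : Y ⟶ Y') :
    X' ⟶ X :=
  @leftAdjointMate C _ _ Y Y' (@HasLeftDual.mk C _ _ Y X p) (@HasLeftDual.mk C _ _ Y' X' p') f

theorem mate_ev {X Y X' Y' : C} (p : ExactPairing X Y) (p' : ExactPairing X' Y') (f : Y ⟶ Y') :
    Y ◁ mate p p' f ≫ ε_ X Y = f ▷ X' ≫ ε_ X' Y' :=
  @leftAdjointMate_comp_evaluation C _ _ Y Y' (@HasLeftDual.mk C _ _ Y X p)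
    (@HasLeftDual.mk C _ _ Y' X' p') f

theorem hom_ext_ev {X Y Z : C} [ExactPairing X Y] {f g : Z ⟶ X}
    (h : Y ◁ f ≫ ε_ X Y = Y ◁ g ≫ ε_ X Y) : f = g := by
  have key : ∀ f : Z ⟶ X, f = (λ_ Z).inv ≫ η_ X Y ▷ Z ≫ (α_ _ _ _).hom ≫
      X ◁ (Y ◁ f ≫ ε_ X Y) ≫ (ρ_ X).hom := by
    intro f
    symm
    calc
      _ = 𝟙 _ ⊗≫ (η_ X Y ▷ Z ≫ (X ⊗ Y) ◁ f) ⊗≫ X ◁ ε_ X Y ⊗≫ 𝟙 _ := by monoidal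
      _ = f ⊗≫ (η_ X Y ▷ X ⊗≫ X ◁ ε_ X Y) ⊗≫ 𝟙 _ := by
        rw [← whisker_exchange]; monoidal
      _ = f := by rw [ExactPairing.evaluation_coevaluation'']; monoidal
  rw [key f, key g, h]

variable [RigidCategory C]

/-- The dual `Xᴿ` with `coev : 𝟙 ⟶ Xᴿ ⊗ X` and `ev : X ⊗ Xᴿ ⟶ 𝟙`; this is what Mathlib calls the
left dual. -/
def rDual (X : C) : C := @HasLeftDual.leftDual C _ _ X (LeftRigidCategory.leftDual X)

instance rPairing (X : C) : ExactPairing (rDual X) X :=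
  @HasLeftDual.exact C _ _ X (LeftRigidCategory.leftDual X)

/-- The dual `Xᴸ` with `coev : 𝟙 ⟶ X ⊗ Xᴸ` and `ev : Xᴸ ⊗ X ⟶ 𝟙`; this is what Mathlib calls the
right dual. -/
def lDual (X : C) : C := @HasRightDual.rightDual C _ _ X (RightRigidCategory.rightDual X)

instance lPairing (X : C) : ExactPairing X (lDual X) :=
  @HasRightDual.exact C _ _ X (RightRigidCategory.rightDual X)

/-- The action of the double dual functor `X ↦ Xᴿᴿ` on morphisms. -/
def rrMap {X Y : C} (f : X ⟶ Y) : rDual (rDual X) ⟶ rDual (rDual Y) :=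
  mate (rPairing _) (rPairing _) (mate (rPairing _) (rPairing _) f)

/-- The tensor structure `Xᴿᴿ ⊗ Yᴿᴿ ⟶ (X ⊗ Y)ᴿᴿ` of the double dual functor: the transpose of the
canonical morphism `(X ⊗ Y)ᴿ ⟶ Yᴿ ⊗ Xᴿ`. -/
def rrTensor (X Y : C) : rDual (rDual X) ⊗ rDual (rDual Y) ⟶ rDual (rDual (X ⊗ Y)) :=
  mate (rPairing _) (ExactPairing.tensor (X₁ := rDual (rDual X)) (X₂ := rDual (rDual Y)))
    (mate (ExactPairing.tensor (X₁ := rDual Y) (X₂ := rDual X)) (rPairing (X ⊗ Y)) (𝟙 (X ⊗ Y)))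

/-- The unit structure `𝟙 ⟶ 𝟙ᴿᴿ` of the double dual functor: the transpose of the canonical
morphism `𝟙ᴿ ⟶ 𝟙`. -/
def rrUnit : 𝟙_ C ⟶ rDual (rDual (𝟙_ C)) :=
  mate (rPairing _) exactPairingUnit (mate exactPairingUnit (rPairing (𝟙_ C)) (𝟙 (𝟙_ C)))

variable (C) in
/-- A pivotal structure: a monoidal natural isomorphism from the identity functor to the double
dual functor `X ↦ Xᴿᴿ`. -/
structure PivotalStructure where
  iso : ∀ X : C, X ≅ rDual (rDual X)
  naturality : ∀ {X Y : C} (f : X ⟶ Y), f ≫ (iso Y).hom = (iso X).hom ≫ rrMap f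
  tensor : ∀ X Y : C, (iso (X ⊗ Y)).hom = ((iso X).hom ⊗ₘ (iso Y).hom) ≫ rrTensor X Y
  unit : (iso (𝟙_ C)).hom = rrUnit

namespace PivotalStructure
variable (a : PivotalStructure C)

/-- The pivotal evaluation `w ⊗ y ⟶ 𝟙` for `y` a dual `wᴸ`: it is the composite
`w ⊗ wᴸ ⟶ w ⊗ wᴸᴿᴿ = w ⊗ wᴿ ⟶ 𝟙`, where `w` is identified with `wᴸᴿ`. -/
def cap {w y : C} (p : ExactPairing w y) : w ⊗ y ⟶ 𝟙_ C :=
  w ◁ (a.iso y).hom ≫ mate (rPairing y) p (𝟙 y) ▷ _ ≫ ε_ (rDual (rDual y)) (rDual y)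

theorem cap_dinat {w w' y y' : C} (p : ExactPairing w y) (p' : ExactPairing w' y')
    (f : w ⟶ w') (g : y' ⟶ y) (h : g ▷ w ≫ ε_ w y = y' ◁ f ≫ ε_ w' y') :
    w ◁ g ≫ a.cap p = f ▷ y' ≫ a.cap p' := by
  have h1 : f ≫ mate (rPairing y') p' (𝟙 y') =
      mate (rPairing y) p (𝟙 y) ≫ mate (rPairing y') (rPairing y) g := by
    apply hom_ext_ev (Y := y')
    rw [whiskerLeft_comp, whiskerLeft_comp, Category.assoc, Category.assoc, mate_ev, mate_ev,
      id_whiskerRight, Category.id_comp, ← h]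
    slice_rhs 1 2 => rw [whisker_exchange]
    rw [Category.assoc, mate_ev, id_whiskerRight, Category.id_comp]
  unfold cap
  rw [← whiskerLeft_comp_assoc, a.naturality, whiskerLeft_comp_assoc, whisker_exchange_assoc,
    rrMap, mate_ev, ← whisker_exchange_assoc, ← comp_whiskerRight_assoc, ← comp_whiskerRight_assoc,
    h1, comp_whiskerRight_assoc]

theorem cap_tensor {w w' y y' : C} (p : ExactPairing w y) (p' : ExactPairing w' y') :
    a.cap (ExactPairing.tensor (X₁ := w) (X₂ := w') (Y₁ := y) (Y₂ := y')) =
      𝟙 _ ⊗≫ w ◁ (a.cap p' ▷ y) ⊗≫ a.cap p := by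
  have h1 : mate (rPairing (y' ⊗ y))
        (ExactPairing.tensor (X₁ := w) (X₂ := w') (Y₁ := y) (Y₂ := y')) (𝟙 (y' ⊗ y)) ≫
      mate (ExactPairing.tensor (X₁ := rDual y) (X₂ := rDual y')) (rPairing (y' ⊗ y)) (𝟙 (y' ⊗ y)) =
      mate (rPairing y) p (𝟙 y) ⊗ₘ mate (rPairing y') p' (𝟙 y') := by
    apply hom_ext_ev (Y := y' ⊗ y)
    rw [whiskerLeft_comp, Category.assoc, mate_ev, id_whiskerRight, Category.id_comp, mate_ev,
      id_whiskerRight, Category.id_comp, ExactPairing.tensor_evaluation,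
      ExactPairing.tensor_evaluation, MonoidalCategory.tensorHom_def]
    symm
    calc
      _ = 𝟙 _ ⊗≫ y' ◁ (y ◁ mate (rPairing y) p (𝟙 y)) ▷ w' ⊗≫
          y' ◁ ((y ⊗ rDual y) ◁ mate (rPairing y') p' (𝟙 y') ≫ ε_ (rDual y) y ▷ rDual y') ⊗≫
          ε_ (rDual y') y' := by monoidal
      _ = 𝟙 _ ⊗≫ y' ◁ ((y ◁ mate (rPairing y) p (𝟙 y)) ≫ ε_ (rDual y) y) ▷ w' ⊗≫
          (y' ◁ mate (rPairing y') p' (𝟙 y') ≫ ε_ (rDual y') y') := by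
        rw [whisker_exchange]; monoidal
      _ = _ := by rw [mate_ev, mate_ev]; simp
  unfold cap
  rw [a.tensor, rrTensor, whiskerLeft_comp, Category.assoc, whisker_exchange_assoc, mate_ev,
    ← comp_whiskerRight_assoc, h1, ExactPairing.tensor_evaluation, MonoidalCategory.tensorHom_def', MonoidalCategory.tensorHom_def']
  calc
    _ = 𝟙 _ ⊗≫ w ◁ (w' ◁ (y' ◁ (a.iso y).hom ≫ (a.iso y').hom ▷ _)) ⊗≫
          w ◁ mate (rPairing y') p' (𝟙 y') ▷ (rDual (rDual y') ⊗ rDual (rDual y)) ⊗≫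
          (mate (rPairing y) p (𝟙 y) ▷ ((rDual y' ⊗ rDual (rDual y')) ⊗ rDual (rDual y)) ≫
          rDual y ◁ (ε_ (rDual (rDual y')) (rDual y') ▷ rDual (rDual y))) ⊗≫
          ε_ (rDual (rDual y)) (rDual y) := by monoidal
    _ = 𝟙 _ ⊗≫ w ◁ (w' ◁ (a.iso y').hom ▷ y) ⊗≫ w ◁
          ((w' ⊗ rDual (rDual y')) ◁ (a.iso y).hom ≫
            (mate (rPairing y') p' (𝟙 y') ▷ rDual (rDual y') ≫
            ε_ (rDual (rDual y')) (rDual y')) ▷ rDual (rDual y)) ⊗≫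
          mate (rPairing y) p (𝟙 y) ▷ rDual (rDual y) ⊗≫
          ε_ (rDual (rDual y)) (rDual y) := by
      rw [whisker_exchange (a.iso y').hom, ← whisker_exchange (mate (rPairing y) p (𝟙 y))]; monoidal
    _ = _ := by rw [whisker_exchange]; monoidal

theorem cap_unit : a.cap (exactPairingUnit (C := C)) = (λ_ (𝟙_ C)).hom := by
  have h1 : mate (rPairing (𝟙_ C)) exactPairingUnit (𝟙 (𝟙_ C)) ≫
      mate exactPairingUnit (rPairing (𝟙_ C)) (𝟙 (𝟙_ C)) = 𝟙 (𝟙_ C) := by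
    apply hom_ext_ev (Y := 𝟙_ C)
    rw [whiskerLeft_comp, Category.assoc, mate_ev, id_whiskerRight, Category.id_comp, mate_ev]
    simp
  unfold cap
  rw [a.unit, rrUnit, whisker_exchange_assoc, mate_ev, ← comp_whiskerRight_assoc, h1]
  simp [ExactPairing.evaluation, ExactPairing.evaluation', unitors_equal]

end PivotalStructure
end Rigid

section Center
open CategoryTheory MonoidalCategory

universe v u
variable {C : Type u} [Category.{v} C] [MonoidalCategory C]

/-- The half-braiding `γ_{w,z} : w ⊗ z ⟶ z ⊗ w` of an object of the Drinfeld center; Mathlib's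
half-braidings go in the opposite direction. -/
def gam (Z : Center C) (w : C) : w ⊗ Z.1 ⟶ Z.1 ⊗ w := (Z.2.β w).inv

theorem gam_nat (Z : Center C) {w w' : C} (f : w ⟶ w') :
    f ▷ Z.1 ≫ gam Z w' = gam Z w ≫ Z.1 ◁ f := by
  unfold gam
  rw [Iso.comp_inv_eq, Category.assoc, HalfBraiding.naturality, Iso.inv_hom_id_assoc]

theorem gam_tensor (Z : Center C) (w w' : C) :
    gam Z (w ⊗ w') = (α_ w w' Z.1).hom ≫ w ◁ gam Z w' ≫ (α_ w Z.1 w').inv ≫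
      gam Z w ▷ w' ≫ (α_ Z.1 w w').hom := by
  unfold gam
  rw [← cancel_epi (Z.2.β (w ⊗ w')).hom, Iso.hom_inv_id, HalfBraiding.monoidal]
  simp

theorem gam_unit (Z : Center C) : gam Z (𝟙_ C) = (λ_ _).hom ≫ (ρ_ _).inv := by
  obtain ⟨c, hc⟩ : ∃ c, c = (ρ_ _).inv ≫ (Z.2.β (𝟙_ C)).hom ≫ (λ_ _).hom := ⟨_, rfl⟩
  have hb : (Z.2.β (𝟙_ C)).hom = (ρ_ _).hom ≫ c ≫ (λ_ _).inv := by simp [hc]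
  have hi : IsIso c := by rw [hc]; infer_instance
  have h2 := Z.2.naturality (λ_ (𝟙_ C)).hom
  rw [HalfBraiding.monoidal, hb] at h2
  have h3 : c ≫ c = c := by
    have e2 : ((α_ Z.1 (𝟙_ C) (𝟙_ C)).inv ≫ ((ρ_ Z.1).hom ≫ c ≫ (λ_ Z.1).inv) ▷ 𝟙_ C ≫
      (α_ (𝟙_ C) Z.1 (𝟙_ C)).hom ≫ (𝟙_ C) ◁ ((ρ_ Z.1).hom ≫ c ≫ (λ_ Z.1).inv) ≫
      (α_ (𝟙_ C) (𝟙_ C) Z.1).inv) ≫ (λ_ (𝟙_ C)).hom ▷ Z.1 =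
      Z.1 ◁ (λ_ (𝟙_ C)).hom ≫ (ρ_ Z.1).hom ≫ (c ≫ c) ≫ (λ_ Z.1).inv := by
      monoidal
    rw [e2, cancel_epi, cancel_epi, cancel_mono] at h2
    exact h2.symm
  have h4 : c = 𝟙 _ := by rwa [← cancel_epi c, Category.comp_id]
  rw [h4] at hb
  unfold gam
  rw [← cancel_epi (Z.2.β (𝟙_ C)).hom, Iso.hom_inv_id, hb]
  simp

theorem gam_hom_comm {Z Z' : Center C} (f : Z ⟶ Z') (w : C) :
    w ◁ f.f ≫ gam Z' w = gam Z w ≫ f.f ▷ w := by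
  unfold gam
  rw [Iso.comp_inv_eq, Category.assoc, f.comm, Iso.inv_hom_id_assoc]

/-- The product `x ⊗ (w' ⊗ w) ⟶ w' ⊗ y ⊗ w ⟶ (w' ⊗ w) ⊗ z` of two tubes before it is decomposed. -/
def stack {x y z a b c d : C} (h : x ⊗ a ⟶ b ⊗ y) (g : y ⊗ c ⟶ d ⊗ z) :
    x ⊗ (a ⊗ c) ⟶ (b ⊗ d) ⊗ z :=
  (α_ x a c).inv ≫ h ▷ c ≫ (α_ b y c).hom ≫ b ◁ g ≫ (α_ b d z).inv

variable [RigidCategory C]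

namespace PivotalStructure
variable (a : PivotalStructure C)

/-- The action of a tube `g : x ⊗ w ⟶ w ⊗ y` on `s : y ⟶ z`, for `z` in the Drinfeld center; here
`v` is a dual `wᴸ` of `w`. -/
def act {w v x y : C} (p : ExactPairing w v) (Z : Center C) (g : x ⊗ w ⟶ w ⊗ y) (s : y ⟶ Z.1) :
    x ⟶ Z.1 :=
  (ρ_ x).inv ≫ x ◁ η_ w v ≫ (α_ x w v).inv ≫ g ▷ v ≫ (w ◁ s) ▷ v ≫ gam Z w ▷ v ≫
    (α_ Z.1 w v).hom ≫ Z.1 ◁ a.cap p ≫ (ρ_ Z.1).hom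

theorem act_dinat {w v w' v' x y : C} (p : ExactPairing w v) (p' : ExactPairing w' v')
    (Z : Center C) (g : x ⊗ w ⟶ w' ⊗ y) (f : w' ⟶ w) (s : y ⟶ Z.1) :
    a.act p Z (g ≫ f ▷ y) s = a.act p' Z (x ◁ f ≫ g) s := by
  obtain ⟨m, hm1, hm2⟩ : ∃ m : v ⟶ v', η_ w' v' ≫ f ▷ v' = η_ w v ≫ w ◁ m ∧
      m ▷ w' ≫ ε_ w' v' = v ◁ f ≫ ε_ w v :=
    ⟨@rightAdjointMate C _ _ w' w (@HasRightDual.mk C _ _ w' v' p') (@HasRightDual.mk C _ _ w v p) f,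
      (@coevaluation_comp_rightAdjointMate C _ _ w' w (@HasRightDual.mk C _ _ w' v' p')
        (@HasRightDual.mk C _ _ w v p) f).symm,
      @rightAdjointMate_comp_evaluation C _ _ w' w (@HasRightDual.mk C _ _ w' v' p')
        (@HasRightDual.mk C _ _ w v p) f⟩
  have hc := a.cap_dinat p' p f m hm2
  unfold act
  calc
    _ = (ρ_ x).inv ≫ x ◁ η_ w v ≫ (α_ x w v).inv ≫ g ▷ v ≫ (w' ◁ s) ▷ v ≫
        (f ▷ Z.1 ≫ gam Z w) ▷ v ≫ (α_ Z.1 w v).hom ≫ Z.1 ◁ a.cap p ≫ (ρ_ Z.1).hom := by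
      simp only [comp_whiskerRight, Category.assoc]
      rw [← comp_whiskerRight_assoc (f ▷ y), ← whisker_exchange, comp_whiskerRight_assoc]
    _ = 𝟙 _ ⊗≫ x ◁ η_ w v ⊗≫ g ▷ v ⊗≫ (w' ◁ s) ▷ v ≫ gam Z w' ▷ v ⊗≫
        Z.1 ◁ (f ▷ v ≫ a.cap p) ⊗≫ 𝟙 _ := by
      rw [gam_nat]; monoidal
    _ = 𝟙 _ ⊗≫ x ◁ η_ w v ⊗≫ ((g ≫ w' ◁ s ≫ gam Z w') ▷ v ≫ (Z.1 ⊗ w') ◁ m) ⊗≫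
        Z.1 ◁ a.cap p' ⊗≫ 𝟙 _ := by
      rw [← hc]; monoidal
    _ = 𝟙 _ ⊗≫ x ◁ (η_ w v ≫ w ◁ m) ⊗≫ (g ≫ w' ◁ s ≫ gam Z w') ▷ v' ⊗≫
        Z.1 ◁ a.cap p' ⊗≫ 𝟙 _ := by
      rw [← whisker_exchange]; monoidal
    _ = _ := by
      rw [← hm1]; monoidal

theorem act_stack {w v w' v' x y t : C} (p' : ExactPairing w' v') (p : ExactPairing w v)
    (Z : Center C) (h : x ⊗ w' ⟶ w' ⊗ y) (g : y ⊗ w ⟶ w ⊗ t) (s : t ⟶ Z.1) :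
    a.act (ExactPairing.tensor (X₁ := w') (X₂ := w) (Y₁ := v') (Y₂ := v)) Z (stack h g) s =
      a.act p' Z h (a.act p Z g s) := by
  unfold act stack
  rw [cap_tensor, gam_tensor, ExactPairing.tensor_coevaluation]
  symm
  calc
    _ = 𝟙 _ ⊗≫ x ◁ η_ w' v' ⊗≫ h ▷ v' ⊗≫ w' ◁ y ◁ η_ w v ▷ v' ⊗≫ w' ◁ g ▷ v ▷ v' ⊗≫
      w' ◁ w ◁ s ▷ v ▷ v' ⊗≫ w' ◁ gam Z w ▷ v ▷ v' ⊗≫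
      ((w' ⊗ Z.1) ◁ a.cap p ≫ gam Z w' ▷ 𝟙_ C) ▷ v' ⊗≫ Z.1 ◁ a.cap p' ⊗≫ 𝟙 _ := by monoidal
    _ = 𝟙 _ ⊗≫ x ◁ η_ w' v' ⊗≫ (h ▷ 𝟙_ C ≫ (w' ⊗ y) ◁ η_ w v) ▷ v' ⊗≫ w' ◁ g ▷ v ▷ v' ⊗≫
      w' ◁ w ◁ s ▷ v ▷ v' ⊗≫ w' ◁ gam Z w ▷ v ▷ v' ⊗≫ gam Z w' ▷ (w ⊗ v) ▷ v' ⊗≫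
      Z.1 ◁ w' ◁ a.cap p ▷ v' ⊗≫ Z.1 ◁ a.cap p' ⊗≫ 𝟙 _ := by
      rw [whisker_exchange]; monoidal
    _ = _ := by
      rw [← whisker_exchange]; monoidal

theorem act_unit (x : C) (Z : Center C) (s : x ⟶ Z.1) :
    a.act exactPairingUnit Z ((ρ_ x).hom ≫ (λ_ x).inv) s = s := by
  unfold act
  rw [cap_unit, gam_unit]
  simp [ExactPairing.coevaluation, ExactPairing.coevaluation']
end PivotalStructure
end Center

section Fusion
open CategoryTheory MonoidalCategory Limits

universe v u

attribute [local instance] Abelian.hasFiniteBiproducts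

/-- The conditions, on a `k`-linear abelian rigid monoidal category with bilinear tensor product,
of being a fusion category: the spaces of morphisms are finite-dimensional, the unit object is
simple, every object is a finite direct sum of simple objects, and there are finitely many simple
objects up to isomorphism. -/
class IsFusionCategory (k : Type v) (C : Type u) [Field k] [Category.{v} C] [Abelian C]
    [Linear k C] [MonoidalCategory C] [MonoidalPreadditive C] [MonoidalLinear k C]
    [RigidCategory C] : Prop where
  finite_hom : ∀ X Y : C, FiniteDimensional k (X ⟶ Y)
  simple_unit : Simple (𝟙_ C)
  semisimple : ∀ X : C, ∃ (n : ℕ) (S : Fin n → C), (∀ i, Simple (S i)) ∧ Nonempty (X ≅ ⨁ S)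
  finite_simple : ∃ (n : ℕ) (S : Fin n → C), ∀ X : C, Simple X → ∃ i, Nonempty (X ≅ S i)

/-- A choice of the set `Irr(C)`: a finite family of simple objects that contains exactly one
representative of each isomorphism class of simple objects. -/
structure Irr (C : Type u) [Category.{v} C] [HasZeroMorphisms C] where
  ι : Type
  [fintype : Fintype ι]
  obj : ι → C
  simple : ∀ i, Simple (obj i)
  eq_of_iso : ∀ i j, Nonempty (obj i ≅ obj j) → i = j
  exists_iso : ∀ X : C, Simple X → ∃ i, Nonempty (X ≅ obj i)

attribute [instance] Irr.fintype Irr.simple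

/-- A direct sum decomposition `A ≅ ⨁ₜ t ^ nₜ` with its inclusions and projections. -/
structure Decomp {C : Type u} [Category.{v} C] [Preadditive C] (I : Irr C) (A : C) where
  n : I.ι → ℕ
  incl : ∀ t, Fin (n t) → (I.obj t ⟶ A)
  proj : ∀ t, Fin (n t) → (A ⟶ I.obj t)
  incl_proj_self : ∀ t i, incl t i ≫ proj t i = 𝟙 (I.obj t)
  incl_proj_of_ne : ∀ t i j, i ≠ j → incl t i ≫ proj t j = 0
  sum_proj_incl : ∑ t, ∑ i, proj t i ≫ incl t i = 𝟙 A

section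
variable {C : Type u} [Category.{v} C] [Preadditive C] [MonoidalCategory C]

/-- The component in `C(x ⊗ t, t ⊗ y)` of a morphism `x ⊗ A ⟶ A ⊗ y`. -/
def Decomp.cut {I : Irr C} {A : C} (D : Decomp I A) {x y : C} (φ : x ⊗ A ⟶ A ⊗ y) (t : I.ι) :
    x ⊗ I.obj t ⟶ I.obj t ⊗ y :=
  ∑ i, x ◁ D.incl t i ≫ φ ≫ D.proj t i ▷ y

end

/-- A fusion category has a set of representatives of its simple objects. -/
theorem nonempty_irr (k : Type v) (C : Type u) [Field k] [Category.{v} C] [Abelian C]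
    [Linear k C] [MonoidalCategory C] [MonoidalPreadditive C] [MonoidalLinear k C]
    [RigidCategory C] [IsFusionCategory k C] : Nonempty (Irr C) := by
  obtain ⟨n, S, hS⟩ := IsFusionCategory.finite_simple (k := k) (C := C)
  classical
  let r : Setoid {i // Simple (S i)} :=
    { r := fun i j => Nonempty (S i ≅ S j)
      iseqv := ⟨fun i => ⟨Iso.refl _⟩, fun ⟨e⟩ => ⟨e.symm⟩, fun ⟨e⟩ ⟨f⟩ => ⟨e ≪≫ f⟩⟩ }
  refine ⟨⟨Quotient r, fun q => S q.out, fun q => q.out.2, fun p q h => ?_, fun X hX => ?_⟩⟩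
  · rw [← Quotient.out_eq p, ← Quotient.out_eq q]
    exact Quotient.sound h
  · obtain ⟨i, ⟨e⟩⟩ := hS X hX
    have hi : Simple (S i) := Simple.of_iso e.symm
    obtain ⟨f⟩ : Nonempty (S (Quotient.mk r ⟨i, hi⟩).out ≅ S i) :=
      Quotient.mk_out (s := r) ⟨i, hi⟩
    exact ⟨Quotient.mk r ⟨i, hi⟩, ⟨e ≪≫ f.symm⟩⟩

theorem nonempty_decomp (k : Type v) {C : Type u} [Field k] [Category.{v} C] [Abelian C]
    [Linear k C] [MonoidalCategory C] [MonoidalPreadditive C] [MonoidalLinear k C]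
    [RigidCategory C] [IsFusionCategory k C]
    (I : Irr C) (A : C) : Nonempty (Decomp I A) := by
  obtain ⟨n, S, hS, ⟨e⟩⟩ := IsFusionCategory.semisimple (k := k) A
  choose f hf using fun i => I.exists_iso (S i) (hS i)
  classical
  let g : ∀ i, S i ≅ I.obj (f i) := fun i => (hf i).some
  let m : ∀ t, {i // f i = t} ≃ Fin (Fintype.card {i // f i = t}) := fun t => Fintype.equivFin _
  let J : ∀ t, {i // f i = t} → (I.obj t ⟶ A) := fun t i =>
    eqToHom (by rw [i.2]) ≫ (g i).inv ≫ biproduct.ι S i ≫ e.inv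
  let P : ∀ t, {i // f i = t} → (A ⟶ I.obj t) := fun t i =>
    e.hom ≫ biproduct.π S i ≫ (g i).hom ≫ eqToHom (by rw [i.2])
  refine ⟨⟨fun t => Fintype.card {i // f i = t}, fun t j => J t ((m t).symm j),
    fun t j => P t ((m t).symm j), ?_, ?_, ?_⟩⟩
  · intro t i
    simp [J, P]
  · intro t i j hij
    have : ((m t).symm i).1 ≠ ((m t).symm j).1 := fun h =>
      hij ((m t).symm.injective (Subtype.ext h))
    simp [J, P, biproduct.ι_π_ne_assoc _ this]
  · have h1 : ∀ t, ∑ i, P t ((m t).symm i) ≫ J t ((m t).symm i) =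
        ∑ i : {i // f i = t}, e.hom ≫ (biproduct.π S i ≫ biproduct.ι S i) ≫ e.inv := by
      intro t
      rw [Equiv.sum_comp (m t).symm (fun i => P t i ≫ J t i)]
      exact Finset.sum_congr rfl fun i _ => by simp [J, P]
    rw [Finset.sum_congr rfl fun t _ => h1 t]
    rw [Fintype.sum_fiberwise f fun i => e.hom ≫ (biproduct.π S i ≫ biproduct.ι S i) ≫ e.inv,
      ← Preadditive.comp_sum, ← Preadditive.sum_comp, biproduct.total]
    simp

/-- A chosen decomposition; the constructions below do not depend on the choice. -/
noncomputable def decomp (k : Type v) {C : Type u} [Field k] [Category.{v} C] [Abelian C]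
    [Linear k C] [MonoidalCategory C] [MonoidalPreadditive C] [MonoidalLinear k C]
    [RigidCategory C] [IsFusionCategory k C]
    (I : Irr C) (A : C) : Decomp I A := (nonempty_decomp k I A).some

theorem Decomp.cut_comm (k : Type v) {C : Type u} [Field k] [Category.{v} C] [Abelian C]
    [Linear k C] [MonoidalCategory C] [MonoidalPreadditive C] [MonoidalLinear k C]
    [RigidCategory C] [IsFusionCategory k C] [IsAlgClosed k]
    {I : Irr C} {A B : C} (D : Decomp I A) (E : Decomp I B) {x y : C}
    (φ : x ⊗ A ⟶ B ⊗ y) (f : B ⟶ A) (t : I.ι) :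
    D.cut (φ ≫ f ▷ y) t = E.cut (x ◁ f ≫ φ) t := by
  classical
  have hne : ∀ s, s ≠ t → ∀ f : I.obj s ⟶ I.obj t, f = 0 := by
    intro s hs f
    by_contra hf
    have := isIso_of_hom_simple hf
    exact hs (I.eq_of_iso _ _ ⟨asIso f⟩)
  have hne' : ∀ s, s ≠ t → ∀ f : I.obj t ⟶ I.obj s, f = 0 := by
    intro s hs f
    by_contra hf
    have := isIso_of_hom_simple hf
    exact hs (I.eq_of_iso _ _ ⟨asIso f⟩).symm
  have hsc : ∀ f : I.obj t ⟶ I.obj t, ∃ c : k, c • 𝟙 _ = f := by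
    intro f
    have := IsFusionCategory.finite_hom (k := k) (I.obj t) (I.obj t)
    exact endomorphism_simple_eq_smul_id k f
  choose c hc using fun (i : Fin (D.n t)) (j : Fin (E.n t)) =>
    hsc (E.incl t j ≫ f ≫ D.proj t i)
  have h1 : ∀ i, f ≫ D.proj t i = ∑ j, c i j • E.proj t j := by
    intro i
    calc
      f ≫ D.proj t i = 𝟙 B ≫ f ≫ D.proj t i := by simp
      _ = ∑ s, ∑ j, E.proj s j ≫ E.incl s j ≫ f ≫ D.proj t i := by
        rw [← E.sum_proj_incl]; simp [Preadditive.sum_comp]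
      _ = ∑ j, E.proj t j ≫ E.incl t j ≫ f ≫ D.proj t i := by
        refine Finset.sum_eq_single t (fun s _ hs => ?_) (by simp)
        exact Finset.sum_eq_zero fun j _ => by
          rw [hne s hs (E.incl s j ≫ f ≫ D.proj t i), comp_zero]
      _ = _ := Finset.sum_congr rfl fun j _ => by rw [← hc]; simp
  have h2 : ∀ j, E.incl t j ≫ f = ∑ i, c i j • D.incl t i := by
    intro j
    calc
      E.incl t j ≫ f = (E.incl t j ≫ f) ≫ 𝟙 A := by simp
      _ = ∑ s, ∑ i, (E.incl t j ≫ f ≫ D.proj s i) ≫ D.incl s i := by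
        rw [← D.sum_proj_incl]; simp [Preadditive.comp_sum]
      _ = ∑ i, (E.incl t j ≫ f ≫ D.proj t i) ≫ D.incl t i := by
        refine Finset.sum_eq_single t (fun s _ hs => ?_) (by simp)
        exact Finset.sum_eq_zero fun i _ => by
          rw [hne' s hs (E.incl t j ≫ f ≫ D.proj s i), zero_comp]
      _ = _ := Finset.sum_congr rfl fun i _ => by rw [← hc]; simp
  unfold Decomp.cut
  calc
    _ = ∑ i, ∑ j, c i j • (x ◁ D.incl t i ≫ φ ≫ E.proj t j ▷ y) := by
      refine Finset.sum_congr rfl fun i _ => ?_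
      rw [Category.assoc, ← comp_whiskerRight, h1, sum_whiskerRight, Preadditive.comp_sum,
        Preadditive.comp_sum]
      simp
    _ = ∑ j, ∑ i, c i j • (x ◁ D.incl t i ≫ φ ≫ E.proj t j ▷ y) := Finset.sum_comm
    _ = _ := by
      refine Finset.sum_congr rfl fun j _ => ?_
      rw [Category.assoc, ← whiskerLeft_comp_assoc, h2, whiskerLeft_sum, Preadditive.sum_comp]
      simp

end Fusion

section Tube
set_option linter.unusedSectionVars false
open CategoryTheory MonoidalCategory Limits

universe v u

/-- The underlying vector space `⨁_{x,y,w} C(x ⊗ w, w ⊗ y)` of the tube algebra; the component of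
`g` in `C(x ⊗ w, w ⊗ y)` is `g x y w`. -/
@[nolint unusedArguments]
def Tube (_k : Type v) {C : Type u} [Category.{v} C] [HasZeroMorphisms C] [MonoidalCategory C]
    (I : Irr C) : Type v :=
  ∀ x y w : I.ι, I.obj x ⊗ I.obj w ⟶ I.obj w ⊗ I.obj y

variable (k : Type v) {C : Type u} [Field k] [Category.{v} C] [Abelian C]
    [Linear k C] [MonoidalCategory C] [MonoidalPreadditive C] [MonoidalLinear k C]
    [RigidCategory C] [IsFusionCategory k C] (I : Irr C)

namespace Tube

instance : AddCommGroup (Tube k I) :=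
  inferInstanceAs (AddCommGroup (∀ x y w : I.ι, I.obj x ⊗ I.obj w ⟶ I.obj w ⊗ I.obj y))

instance : Module k (Tube k I) :=
  inferInstanceAs (Module k (∀ x y w : I.ι, I.obj x ⊗ I.obj w ⟶ I.obj w ⊗ I.obj y))

instance : FiniteDimensional k (Tube k I) := by
  have := IsFusionCategory.finite_hom (k := k) (C := C)
  exact inferInstanceAs (FiniteDimensional k
    (∀ x y w : I.ι, I.obj x ⊗ I.obj w ⟶ I.obj w ⊗ I.obj y))

/-- The multiplication: the `(x', z, t)` component of `h * g` is the sum, over the simple objects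
`w', w, y` and over the copies of `t` in `w' ⊗ w`, of the composites
`x' ⊗ t ⟶ x' ⊗ w' ⊗ w ⟶ w' ⊗ y ⊗ w ⟶ w' ⊗ w ⊗ z ⟶ t ⊗ z`. -/
noncomputable instance : Mul (Tube k I) where
  mul h g := fun x z t => ∑ y, ∑ w', ∑ w,
    (decomp k I (I.obj w' ⊗ I.obj w)).cut (stack (h x y w') (g y z w)) t

/-- The chosen representative of the unit object. -/
noncomputable def unitIdx : I.ι :=
  (I.exists_iso (𝟙_ C) (IsFusionCategory.simple_unit (k := k))).choose

/-- An isomorphism from the unit object to its representative. -/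
noncomputable def unitIso : 𝟙_ C ≅ I.obj (unitIdx k I) :=
  (I.exists_iso (𝟙_ C) (IsFusionCategory.simple_unit (k := k))).choose_spec.some

open Classical in
/-- The element of the tube algebra with the only component `g` in `C(x ⊗ w, w ⊗ y)`. -/
noncomputable def single (x y w : I.ι) (g : I.obj x ⊗ I.obj w ⟶ I.obj w ⊗ I.obj y) : Tube k I :=
  Pi.single x (Pi.single y (Pi.single w g))

/-- The unit: the sum over `x` of the identities of `x`, as morphisms `x ⊗ 𝟙 ⟶ 𝟙 ⊗ x`. -/
noncomputable instance : One (Tube k I) where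
  one := ∑ x, single k I x x (unitIdx k I) (I.obj x ◁ (unitIso k I).inv ≫
    ((ρ_ (I.obj x)).hom ≫ (λ_ (I.obj x)).inv) ≫ (unitIso k I).hom ▷ I.obj x)

theorem one_def : (1 : Tube k I) =
    ∑ x, single k I x x (unitIdx k I) (I.obj x ◁ (unitIso k I).inv ≫
      ((ρ_ (I.obj x)).hom ≫ (λ_ (I.obj x)).inv) ≫ (unitIso k I).hom ▷ I.obj x) := rfl

theorem mul_def (h g : Tube k I) (x z t : I.ι) : (h * g) x z t = ∑ y, ∑ w', ∑ w,
    (decomp k I (I.obj w' ⊗ I.obj w)).cut (stack (h x y w') (g y z w)) t := rfl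

variable {k I}
@[ext] theorem ext {g h : Tube k I} (H : ∀ x y w, g x y w = h x y w) : g = h :=
  funext fun x => funext fun y => funext fun w => H x y w

theorem add_apply (g h : Tube k I) (x y w) : (g + h) x y w = g x y w + h x y w := rfl
theorem zero_apply (x y w) : (0 : Tube k I) x y w = 0 := rfl
theorem smul_apply (c : k) (g : Tube k I) (x y w) : (c • g) x y w = c • g x y w := rfl
theorem sum_apply {α : Type*} (s : Finset α) (g : α → Tube k I) (x y w) :
    (∑ i ∈ s, g i) x y w = ∑ i ∈ s, g i x y w := by
  induction s using Finset.cons_induction with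
  | empty => rfl
  | cons a s ha ih => simp [Finset.sum_cons, add_apply, ih]

theorem single_apply_self (x y w : I.ι) (g) : single k I x y w g x y w = g := by
  simp [single]
theorem single_apply_ne {x y w x' y' w' : I.ι} (g) (h : ¬ (x = x' ∧ y = y' ∧ w = w')) :
    single k I x y w g x' y' w' = 0 := by
  classical
  unfold single
  by_cases hx : x' = x
  · subst hx
    by_cases hy : y' = y
    · subst hy
      have hw : w' ≠ w := fun e => h ⟨rfl, rfl, e.symm⟩
      simp [hw]
    · simp [hy]
  · simp [hx]

theorem one_apply_self (x : I.ι) : (1 : Tube k I) x x (unitIdx k I) =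
    I.obj x ◁ (unitIso k I).inv ≫ ((ρ_ (I.obj x)).hom ≫
        (λ_ (I.obj x)).inv) ≫ (unitIso k I).hom ▷ I.obj x := by
  rw [one_def, sum_apply, Finset.sum_eq_single x, single_apply_self]
  · exact fun y _ hy => single_apply_ne _ fun h => hy h.1
  · simp

theorem one_apply_ne {x y w : I.ι} (h : ¬ (x = y ∧ w = unitIdx k I)) :
    (1 : Tube k I) x y w = 0 := by
  rw [one_def, sum_apply]
  exact Finset.sum_eq_zero fun y _ =>
    single_apply_ne _ fun e => h ⟨e.1.symm.trans e.2.1, e.2.2.symm⟩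
end Tube

section linearity
variable {k}
variable {x y z a b c d : C}

theorem stack_add_left (h h' : x ⊗ a ⟶ b ⊗ y) (g : y ⊗ c ⟶ d ⊗ z) :
    stack (h + h') g = stack h g + stack h' g := by simp [stack]
theorem stack_add_right (h : x ⊗ a ⟶ b ⊗ y) (g g' : y ⊗ c ⟶ d ⊗ z) :
    stack h (g + g') = stack h g + stack h g' := by simp [stack]
theorem stack_zero_left (g : y ⊗ c ⟶ d ⊗ z) :
    stack (0 : x ⊗ a ⟶ b ⊗ y) g = 0 := by simp [stack]
theorem stack_zero_right (h : x ⊗ a ⟶ b ⊗ y) :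
    stack h (0 : y ⊗ c ⟶ d ⊗ z) = 0 := by simp [stack]
theorem stack_smul_left (r : k) (h : x ⊗ a ⟶ b ⊗ y) (g : y ⊗ c ⟶ d ⊗ z) :
    stack (r • h) g = r • stack h g := by simp [stack]
theorem stack_smul_right (r : k) (h : x ⊗ a ⟶ b ⊗ y) (g : y ⊗ c ⟶ d ⊗ z) :
    stack h (r • g) = r • stack h g := by simp [stack]
theorem stack_sum_left {α : Type*} (s : Finset α) (h : α → (x ⊗ a ⟶ b ⊗ y))
    (g : y ⊗ c ⟶ d ⊗ z) : stack (∑ i ∈ s, h i) g = ∑ i ∈ s, stack (h i) g := by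
  simp [stack, sum_whiskerRight, Preadditive.comp_sum, Preadditive.sum_comp]
theorem stack_sum_right {α : Type*} (s : Finset α) (h : x ⊗ a ⟶ b ⊗ y)
    (g : α → (y ⊗ c ⟶ d ⊗ z)) : stack h (∑ i ∈ s, g i) = ∑ i ∈ s, stack h (g i) := by
  simp [stack, whiskerLeft_sum, Preadditive.comp_sum, Preadditive.sum_comp]
variable {I}
theorem cut_add (D : Decomp I a) (φ ψ : x ⊗ a ⟶ a ⊗ y) (t) :
    D.cut (φ + ψ) t = D.cut φ t + D.cut ψ t := by
  simp [Decomp.cut, Finset.sum_add_distrib]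
theorem cut_zero (D : Decomp I a) (t) :
    D.cut (0 : x ⊗ a ⟶ a ⊗ y) t = 0 := by
  simp [Decomp.cut]
theorem cut_smul (D : Decomp I a) (r : k) (φ : x ⊗ a ⟶ a ⊗ y) (t) :
    D.cut (r • φ) t = r • D.cut φ t := by
  simp [Decomp.cut, Finset.smul_sum]
theorem cut_sum {α : Type*} (s : Finset α) (D : Decomp I a) (φ : α → (x ⊗ a ⟶ a ⊗ y)) (t) :
    D.cut (∑ i ∈ s, φ i) t = ∑ i ∈ s, D.cut (φ i) t := by
  simp [Decomp.cut, Preadditive.comp_sum, Preadditive.sum_comp]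
  rw [Finset.sum_comm]
end linearity

theorem stack_comp_left {C : Type u} [Category.{v} C] [MonoidalCategory C]
    {x y z a a' b b' c d : C} (f : a' ⟶ a) (h : x ⊗ a ⟶ b ⊗ y) (e : b ⟶ b')
    (g : y ⊗ c ⟶ d ⊗ z) :
    stack (x ◁ f ≫ h ≫ e ▷ y) g = x ◁ (f ▷ c) ≫ stack h g ≫ (e ▷ d) ▷ z := by
  unfold stack
  calc
    _ = 𝟙 _ ⊗≫ x ◁ f ▷ c ⊗≫ h ▷ c ⊗≫ (e ▷ (y ⊗ c) ≫ b' ◁ g) ⊗≫ 𝟙 _ := by monoidal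
    _ = _ := by rw [← whisker_exchange]; monoidal

theorem stack_comp_right {C : Type u} [Category.{v} C] [MonoidalCategory C]
    {x y z a b c c' d d' : C} (f : c' ⟶ c) (h : x ⊗ a ⟶ b ⊗ y) (e : d ⟶ d')
    (g : y ⊗ c ⟶ d ⊗ z) :
    stack h (y ◁ f ≫ g ≫ e ▷ z) = x ◁ (a ◁ f) ≫ stack h g ≫ (b ◁ e) ▷ z := by
  unfold stack
  calc
    _ = 𝟙 _ ⊗≫ (h ▷ c' ≫ (b ⊗ y) ◁ f) ⊗≫ b ◁ g ⊗≫ b ◁ e ▷ z ⊗≫ 𝟙 _ := by monoidal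
    _ = _ := by rw [← whisker_exchange]; monoidal

theorem stack_assoc {C : Type u} [Category.{v} C] [MonoidalCategory C]
    {x y z t a b c a' b' c' : C} (h : x ⊗ a ⟶ a' ⊗ y) (g : y ⊗ b ⟶ b' ⊗ z)
    (f : z ⊗ c ⟶ c' ⊗ t) :
    stack (stack h g) f ≫ (α_ a' b' c').hom ▷ t =
      x ◁ (α_ a b c).hom ≫ stack h (stack g f) := by
  unfold stack
  monoidal


theorem cut_def {I : Irr C} {A x y : C} (D : Decomp I A) (φ : x ⊗ A ⟶ A ⊗ y) (t : I.ι) :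
    D.cut φ t = ∑ i, x ◁ D.incl t i ≫ φ ≫ D.proj t i ▷ y := rfl

theorem cut_conj (k : Type v) {C : Type u} [Field k] [Category.{v} C] [Abelian C]
    [Linear k C] [MonoidalCategory C] [MonoidalPreadditive C] [MonoidalLinear k C]
    [RigidCategory C] [IsFusionCategory k C] [IsAlgClosed k]
    {A B x y : C} {I : Irr C} (D : Decomp I A) (E : Decomp I B) (e : A ≅ B)
    (φ : x ⊗ B ⟶ B ⊗ y) (t : I.ι) :
    D.cut (x ◁ e.hom ≫ φ ≫ e.inv ▷ y) t = E.cut φ t := by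
  rw [← Category.assoc, Decomp.cut_comm k D E]
  simp

theorem sum_cut_stack_left (k : Type v) {C : Type u} [Field k] [Category.{v} C] [Abelian C]
    [Linear k C] [MonoidalCategory C] [MonoidalPreadditive C] [MonoidalLinear k C]
    [RigidCategory C] [IsFusionCategory k C] [IsAlgClosed k]
    {A w x y z : C} {I : Irr C} (D : Decomp I A)
    (E : ∀ s, Decomp I (I.obj s ⊗ w)) (F : Decomp I (A ⊗ w)) (φ : x ⊗ A ⟶ A ⊗ y)
    (g : y ⊗ w ⟶ w ⊗ z) (t : I.ι) :
    ∑ s, (E s).cut (stack (D.cut φ s) g) t = F.cut (stack φ g) t := by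
  have h1 : ∀ s, (E s).cut (stack (D.cut φ s) g) t =
      ∑ i, F.cut (x ◁ ((D.proj s i ≫ D.incl s i) ▷ w) ≫ stack φ g) t := by
    intro s
    rw [cut_def D, stack_sum_left, cut_sum]
    refine Finset.sum_congr rfl fun i _ => ?_
    rw [stack_comp_left, ← Category.assoc, Decomp.cut_comm k _ F]
    simp
  simp_rw [h1, ← cut_sum, ← Preadditive.sum_comp, ← whiskerLeft_sum, ← sum_whiskerRight]
  rw [D.sum_proj_incl]
  simp

theorem sum_cut_stack_right (k : Type v) {C : Type u} [Field k] [Category.{v} C] [Abelian C]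
    [Linear k C] [MonoidalCategory C] [MonoidalPreadditive C] [MonoidalLinear k C]
    [RigidCategory C] [IsFusionCategory k C] [IsAlgClosed k]
    {A w x y z : C} {I : Irr C} (D : Decomp I A)
    (E : ∀ s, Decomp I (w ⊗ I.obj s)) (F : Decomp I (w ⊗ A)) (φ : y ⊗ A ⟶ A ⊗ z)
    (g : x ⊗ w ⟶ w ⊗ y) (t : I.ι) :
    ∑ s, (E s).cut (stack g (D.cut φ s)) t = F.cut (stack g φ) t := by
  have h1 : ∀ s, (E s).cut (stack g (D.cut φ s)) t =
      ∑ i, F.cut (x ◁ (w ◁ (D.proj s i ≫ D.incl s i)) ≫ stack g φ) t := by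
    intro s
    rw [cut_def D, stack_sum_right, cut_sum]
    refine Finset.sum_congr rfl fun i _ => ?_
    rw [stack_comp_right, ← Category.assoc, Decomp.cut_comm k _ F]
    simp
  simp_rw [h1, ← cut_sum, ← Preadditive.sum_comp, ← whiskerLeft_sum]
  rw [D.sum_proj_incl]
  simp

theorem sum_cut_simple (k : Type v) {C : Type u} [Field k] [Category.{v} C] [Abelian C]
    [Linear k C] [MonoidalCategory C] [MonoidalPreadditive C] [MonoidalLinear k C]
    [RigidCategory C] [IsFusionCategory k C] [IsAlgClosed k]
    {I : Irr C} {x y : C} (E : ∀ s, Decomp I (I.obj s))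
    (g : ∀ w, x ⊗ I.obj w ⟶ I.obj w ⊗ y) (t : I.ι) :
    ∑ s, (E s).cut (g s) t = g t := by
  have hne : ∀ s s', s ≠ s' → ∀ f : I.obj s ⟶ I.obj s', f = 0 := by
    intro s s' hs f
    by_contra hf
    have := isIso_of_hom_simple hf
    exact hs (I.eq_of_iso _ _ ⟨asIso f⟩)
  have hsc : ∀ f : I.obj t ⟶ I.obj t, ∃ c : k, c • 𝟙 _ = f := by
    intro f
    have := IsFusionCategory.finite_hom (k := k) (I.obj t) (I.obj t)
    exact endomorphism_simple_eq_smul_id k f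
  rw [Finset.sum_eq_single t]
  · have h1 : ∑ i, (E t).proj t i ≫ (E t).incl t i = 𝟙 (I.obj t) := by
      rw [← (E t).sum_proj_incl, Finset.sum_eq_single t]
      · exact fun s _ hs => Finset.sum_eq_zero fun i _ => by rw [hne s t hs ((E t).incl s i)]; simp
      · simp
    have h2 : ∀ i, x ◁ (E t).incl t i ≫ g t ≫ (E t).proj t i ▷ y =
        x ◁ ((E t).proj t i ≫ (E t).incl t i) ≫ g t := by
      intro i
      obtain ⟨c, hc⟩ := hsc ((E t).incl t i)
      obtain ⟨d, hd⟩ := hsc ((E t).proj t i)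
      rw [← hc, ← hd]
      simp [smul_smul, mul_comm]
    rw [Decomp.cut, Finset.sum_congr rfl fun i _ => h2 i, ← Preadditive.sum_comp,
      ← whiskerLeft_sum, h1]
    simp
  · intro s _ hs
    rw [Decomp.cut]
    exact Finset.sum_eq_zero fun i _ => by rw [hne t s hs.symm ((E s).incl t i)]; simp
  · simp

namespace Tube
variable [IsAlgClosed k] {k I}

theorem tube_mul_assoc (f h g : Tube k I) : f * h * g = f * (h * g) := by
  ext x z t
  have h1 : (f * h * g) x z t = ∑ y, ∑ w, ∑ u, ∑ w'', ∑ w',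
      (decomp k I ((I.obj w'' ⊗ I.obj w') ⊗ I.obj w)).cut
        (stack (stack (f x u w'') (h u y w')) (g y z w)) t := by
    rw [mul_def]
    refine Finset.sum_congr rfl fun y _ => ?_
    rw [Finset.sum_comm]
    refine Finset.sum_congr rfl fun w _ => ?_
    simp_rw [mul_def, stack_sum_left, cut_sum]
    rw [Finset.sum_comm]
    refine Finset.sum_congr rfl fun u _ => ?_
    rw [Finset.sum_comm]
    refine Finset.sum_congr rfl fun w'' _ => ?_
    rw [Finset.sum_comm]
    refine Finset.sum_congr rfl fun w' _ => ?_
    exact sum_cut_stack_left k _ _ _ _ _ _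
  have h2 : (f * (h * g)) x z t = ∑ u, ∑ w'', ∑ y, ∑ w', ∑ w,
      (decomp k I (I.obj w'' ⊗ (I.obj w' ⊗ I.obj w))).cut
        (stack (f x u w'') (stack (h u y w') (g y z w))) t := by
    rw [mul_def]
    refine Finset.sum_congr rfl fun u _ => ?_
    refine Finset.sum_congr rfl fun w'' _ => ?_
    simp_rw [mul_def, stack_sum_right, cut_sum]
    rw [Finset.sum_comm]
    refine Finset.sum_congr rfl fun y _ => ?_
    rw [Finset.sum_comm]
    refine Finset.sum_congr rfl fun w' _ => ?_
    rw [Finset.sum_comm]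
    refine Finset.sum_congr rfl fun w _ => ?_
    exact sum_cut_stack_right k _ _ _ _ _ _
  have h3 : ∀ u w'' y w' w, (decomp k I ((I.obj w'' ⊗ I.obj w') ⊗ I.obj w)).cut
        (stack (stack (f x u w'') (h u y w')) (g y z w)) t =
      (decomp k I (I.obj w'' ⊗ (I.obj w' ⊗ I.obj w))).cut
        (stack (f x u w'') (stack (h u y w') (g y z w))) t := by
    intro u w'' y w' w
    rw [← cut_conj k (decomp k I ((I.obj w'' ⊗ I.obj w') ⊗ I.obj w)) _ (α_ _ _ _),
      ← Category.assoc, ← stack_assoc]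
    simp
  rw [h1, h2]
  simp_rw [h3]
  calc
    _ = ∑ y, ∑ u, ∑ w, ∑ w'', ∑ w', (decomp k I (I.obj w'' ⊗ (I.obj w' ⊗ I.obj w))).cut
        (stack (f x u w'') (stack (h u y w') (g y z w))) t :=
      Finset.sum_congr rfl fun y _ => Finset.sum_comm
    _ = ∑ u, ∑ y, ∑ w, ∑ w'', ∑ w', (decomp k I (I.obj w'' ⊗ (I.obj w' ⊗ I.obj w))).cut
        (stack (f x u w'') (stack (h u y w') (g y z w))) t := Finset.sum_comm
    _ = ∑ u, ∑ y, ∑ w'', ∑ w, ∑ w', (decomp k I (I.obj w'' ⊗ (I.obj w' ⊗ I.obj w))).cut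
        (stack (f x u w'') (stack (h u y w') (g y z w))) t :=
      Finset.sum_congr rfl fun u _ => Finset.sum_congr rfl fun y _ => Finset.sum_comm
    _ = ∑ u, ∑ w'', ∑ y, ∑ w, ∑ w', (decomp k I (I.obj w'' ⊗ (I.obj w' ⊗ I.obj w))).cut
        (stack (f x u w'') (stack (h u y w') (g y z w))) t :=
      Finset.sum_congr rfl fun u _ => Finset.sum_comm
    _ = _ := Finset.sum_congr rfl fun u _ => Finset.sum_congr rfl fun w'' _ =>
      Finset.sum_congr rfl fun y _ => Finset.sum_comm

theorem tube_one_mul (g : Tube k I) : 1 * g = g := by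
  ext x z t
  rw [mul_def, Finset.sum_eq_single x, Finset.sum_eq_single (unitIdx k I)]
  · rw [one_apply_self]
    refine (Finset.sum_congr rfl fun w _ => ?_).trans
      (sum_cut_simple k (fun s => decomp k I (I.obj s)) (fun w => g x z w) t)
    rw [stack_comp_left, ← Category.assoc,
      Decomp.cut_comm k _ (decomp k I (𝟙_ C ⊗ I.obj w)),
      ← cut_conj k (decomp k I (𝟙_ C ⊗ I.obj w)) _ (λ_ _)]
    congr 1
    simp [stack]
  · intro w' _ hw'
    exact Finset.sum_eq_zero fun w _ => by
      rw [one_apply_ne fun h => hw' h.2, stack_zero_left, cut_zero]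
  · simp
  · intro y _ hy
    exact Finset.sum_eq_zero fun w' _ => Finset.sum_eq_zero fun w _ => by
      rw [one_apply_ne fun h => hy h.1.symm, stack_zero_left, cut_zero]
  · simp

theorem tube_mul_one (g : Tube k I) : g * 1 = g := by
  ext x z t
  rw [mul_def, Finset.sum_eq_single z]
  · refine (Finset.sum_congr rfl fun w _ => ?_).trans
      (sum_cut_simple k (fun s => decomp k I (I.obj s)) (fun w => g x z w) t)
    rw [Finset.sum_eq_single (unitIdx k I)]
    · rw [one_apply_self, stack_comp_right, ← Category.assoc,
        Decomp.cut_comm k _ (decomp k I (I.obj w ⊗ 𝟙_ C)),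
        ← cut_conj k (decomp k I (I.obj w ⊗ 𝟙_ C)) _ (ρ_ _)]
      congr 1
      simp [stack]
    · intro w' _ hw'
      rw [one_apply_ne fun h => hw' h.2, stack_zero_right, cut_zero]
    · simp
  · intro y _ hy
    exact Finset.sum_eq_zero fun w' _ => Finset.sum_eq_zero fun w _ => by
      rw [one_apply_ne fun h => hy h.1, stack_zero_right, cut_zero]
  · simp

noncomputable instance : Ring (Tube k I) :=
  { (inferInstance : AddCommGroup (Tube k I)), (inferInstance : Mul (Tube k I)),
    (inferInstance : One (Tube k I)) with
    mul_assoc := tube_mul_assoc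
    one_mul := tube_one_mul
    mul_one := tube_mul_one
    left_distrib := fun f g h => by
      ext x z t
      simp only [mul_def, add_apply, stack_add_right, cut_add, Finset.sum_add_distrib]
    right_distrib := fun f g h => by
      ext x z t
      simp only [mul_def, add_apply, stack_add_left, cut_add, Finset.sum_add_distrib]
    zero_mul := fun f => by
      ext x z t
      simp [mul_def, zero_apply, stack_zero_left, cut_zero]
    mul_zero := fun f => by
      ext x z t
      simp [mul_def, zero_apply, stack_zero_right, cut_zero] }

noncomputable instance : Algebra k (Tube k I) :=
  Algebra.ofModule
    (fun r f g => by
      ext x z t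
      simp only [mul_def, smul_apply, stack_smul_left, cut_smul, Finset.smul_sum])
    (fun r f g => by
      ext x z t
      simp only [mul_def, smul_apply, stack_smul_right, cut_smul, Finset.smul_sum])

end Tube
end Tube

section TubeModule
set_option linter.unusedSectionVars false
open CategoryTheory MonoidalCategory Limits

universe v u

section
variable {k : Type v} {C : Type u} [Field k] [Category.{v} C] [Abelian C]
    [Linear k C] [MonoidalCategory C] [MonoidalPreadditive C] [MonoidalLinear k C]
    [RigidCategory C] (a : PivotalStructure C) {w v x y : C} (p : ExactPairing w v) (Z : Center C)

namespace PivotalStructure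
theorem act_add_left (g g' : x ⊗ w ⟶ w ⊗ y) (s : y ⟶ Z.1) :
    a.act p Z (g + g') s = a.act p Z g s + a.act p Z g' s := by simp [act]
theorem act_add_right (g : x ⊗ w ⟶ w ⊗ y) (s s' : y ⟶ Z.1) :
    a.act p Z g (s + s') = a.act p Z g s + a.act p Z g s' := by simp [act]
theorem act_zero_left (s : y ⟶ Z.1) : a.act p Z (0 : x ⊗ w ⟶ w ⊗ y) s = 0 := by simp [act]
theorem act_zero_right (g : x ⊗ w ⟶ w ⊗ y) : a.act p Z g (0 : y ⟶ Z.1) = 0 := by simp [act]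
theorem act_smul_left (r : k) (g : x ⊗ w ⟶ w ⊗ y) (s : y ⟶ Z.1) :
    a.act p Z (r • g) s = r • a.act p Z g s := by simp [act]
theorem act_smul_right (r : k) (g : x ⊗ w ⟶ w ⊗ y) (s : y ⟶ Z.1) :
    a.act p Z g (r • s) = r • a.act p Z g s := by simp [act]
theorem act_sum_left {α : Type*} (σ : Finset α) (g : α → (x ⊗ w ⟶ w ⊗ y)) (s : y ⟶ Z.1) :
    a.act p Z (∑ i ∈ σ, g i) s = ∑ i ∈ σ, a.act p Z (g i) s := by
  simp [act, sum_whiskerRight, Preadditive.comp_sum, Preadditive.sum_comp]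
theorem act_sum_right {α : Type*} (σ : Finset α) (g : x ⊗ w ⟶ w ⊗ y) (s : α → (y ⟶ Z.1)) :
    a.act p Z g (∑ i ∈ σ, s i) = ∑ i ∈ σ, a.act p Z g (s i) := by
  simp [act, sum_whiskerRight, whiskerLeft_sum, Preadditive.comp_sum, Preadditive.sum_comp]

theorem act_comp {Z' : Center C} (g : x ⊗ w ⟶ w ⊗ y) (s : y ⟶ Z.1) (f : Z ⟶ Z') :
    a.act p Z' g (s ≫ f.f) = a.act p Z g s ≫ f.f := by
  unfold act
  symm
  calc
    _ = 𝟙 _ ⊗≫ x ◁ η_ w v ⊗≫ g ▷ v ⊗≫ (w ◁ s) ▷ v ≫ gam Z w ▷ v ⊗≫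
        (Z.1 ◁ a.cap p ≫ f.f ▷ 𝟙_ C) ⊗≫ 𝟙 _ := by monoidal
    _ = 𝟙 _ ⊗≫ x ◁ η_ w v ⊗≫ g ▷ v ⊗≫ (w ◁ s) ▷ v ≫ (gam Z w ≫ f.f ▷ w) ▷ v ⊗≫
        Z'.1 ◁ a.cap p ⊗≫ 𝟙 _ := by rw [whisker_exchange]; monoidal
    _ = _ := by rw [← gam_hom_comm]; monoidal

theorem sum_act_cut {I : Irr C} (D : Decomp I w) (φ : x ⊗ w ⟶ w ⊗ y) (s : y ⟶ Z.1) :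
    ∑ t, a.act (lPairing (I.obj t)) Z (D.cut φ t) s = a.act p Z φ s := by
  have h1 : ∀ t, a.act (lPairing (I.obj t)) Z (D.cut φ t) s =
      ∑ i, a.act p Z (x ◁ (D.proj t i ≫ D.incl t i) ≫ φ) s := by
    intro t
    rw [cut_def, act_sum_left]
    refine Finset.sum_congr rfl fun i _ => ?_
    rw [← Category.assoc, a.act_dinat _ p]
    simp
  simp_rw [h1, ← act_sum_left, ← Preadditive.sum_comp, ← whiskerLeft_sum]
  rw [D.sum_proj_incl]
  simp
end PivotalStructure
end

/-- The vector space `⨁ₓ C(x, z)` underlying the representation of the tube algebra associated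
with an object `(z, γ)` of the Drinfeld center. -/
@[nolint unusedArguments]
def JObj (_k : Type v) {C : Type u} [Category.{v} C] [HasZeroMorphisms C] [MonoidalCategory C]
    [RigidCategory C] (_a : PivotalStructure C) (I : Irr C) (Z : Center C) : Type v :=
  ∀ x : I.ι, I.obj x ⟶ Z.1

variable (k : Type v) {C : Type u} [Field k] [Category.{v} C] [Abelian C]
    [Linear k C] [MonoidalCategory C] [MonoidalPreadditive C] [MonoidalLinear k C]
    [RigidCategory C] [IsFusionCategory k C] (a : PivotalStructure C) (I : Irr C) (Z : Center C)

namespace JObj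

instance : AddCommGroup (JObj k a I Z) :=
  inferInstanceAs (AddCommGroup (∀ x : I.ι, I.obj x ⟶ Z.1))

instance : Module k (JObj k a I Z) :=
  inferInstanceAs (Module k (∀ x : I.ι, I.obj x ⟶ Z.1))

instance : FiniteDimensional k (JObj k a I Z) := by
  have := IsFusionCategory.finite_hom (k := k) (C := C)
  exact inferInstanceAs (FiniteDimensional k (∀ x : I.ι, I.obj x ⟶ Z.1))

/-- The action of the tube algebra: a component `g x y w` sends `s : y ⟶ z` to
`x ⟶ x ⊗ w ⊗ wᴸ ⟶ w ⊗ y ⊗ wᴸ ⟶ w ⊗ z ⊗ wᴸ ⟶ z ⊗ w ⊗ wᴸ ⟶ z`. -/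
instance : SMul (Tube k I) (JObj k a I Z) where
  smul g s := fun x => ∑ y, ∑ w, a.act (lPairing (I.obj w)) Z (g x y w) (s y)

variable {k a I Z}

theorem smul_def (g : Tube k I) (s : JObj k a I Z) (x : I.ι) :
    (g • s) x = ∑ y, ∑ w, a.act (lPairing (I.obj w)) Z (g x y w) (s y) := rfl

theorem add_apply (s t : JObj k a I Z) (x : I.ι) : (s + t) x = s x + t x := rfl
theorem zero_apply (x : I.ι) : (0 : JObj k a I Z) x = 0 := rfl
theorem ksmul_apply (c : k) (s : JObj k a I Z) (x : I.ι) : (c • s) x = c • s x := rfl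

variable [IsAlgClosed k]

theorem tube_mul_smul (h g : Tube k I) (s : JObj k a I Z) : (h * g) • s = h • g • s := by
  funext x
  have h1 : ((h * g) • s) x = ∑ z, ∑ y, ∑ w', ∑ w,
      a.act (lPairing (I.obj w')) Z (h x y w') (a.act (lPairing (I.obj w)) Z (g y z w) (s z)) := by
    rw [smul_def]
    refine Finset.sum_congr rfl fun z _ => ?_
    simp_rw [Tube.mul_def, PivotalStructure.act_sum_left]
    rw [Finset.sum_comm]
    refine Finset.sum_congr rfl fun y _ => ?_
    rw [Finset.sum_comm]
    refine Finset.sum_congr rfl fun w' _ => ?_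
    rw [Finset.sum_comm]
    refine Finset.sum_congr rfl fun w _ => ?_
    rw [a.sum_act_cut, a.act_stack (lPairing _) (lPairing _)]
  rw [h1, smul_def, Finset.sum_comm]
  refine Finset.sum_congr rfl fun y _ => ?_
  simp_rw [smul_def, PivotalStructure.act_sum_right]
  rw [Finset.sum_comm]

theorem tube_one_smul (s : JObj k a I Z) : (1 : Tube k I) • s = s := by
  funext x
  rw [smul_def, Finset.sum_eq_single x, Finset.sum_eq_single (Tube.unitIdx k I)]
  · rw [Tube.one_apply_self, ← Category.assoc, a.act_dinat _ exactPairingUnit]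
    simpa using a.act_unit (I.obj x) Z (s x)
  · intro w _ hw
    rw [Tube.one_apply_ne fun h => hw h.2, PivotalStructure.act_zero_left]
  · simp
  · intro y _ hy
    exact Finset.sum_eq_zero fun w _ => by
      rw [Tube.one_apply_ne fun h => hy h.1.symm, PivotalStructure.act_zero_left]
  · simp

variable (k a I Z)

instance : Module (Tube k I) (JObj k a I Z) where
  one_smul := tube_one_smul
  mul_smul := tube_mul_smul
  smul_zero g := by
    funext x
    simp [smul_def, zero_apply, PivotalStructure.act_zero_right]
  zero_smul s := by
    funext x
    simp [smul_def, Tube.zero_apply, zero_apply, PivotalStructure.act_zero_left]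
  smul_add g s t := by
    funext x
    simp [smul_def, add_apply, PivotalStructure.act_add_right, Finset.sum_add_distrib]
  add_smul g h s := by
    funext x
    simp [smul_def, Tube.add_apply, add_apply, PivotalStructure.act_add_left,
      Finset.sum_add_distrib]

instance : IsScalarTower k (Tube k I) (JObj k a I Z) where
  smul_assoc c g s := by
    funext x
    simp [smul_def, Tube.smul_apply, ksmul_apply, PivotalStructure.act_smul_left,
      Finset.smul_sum]

/-- The map `J(Z) ⟶ J(Z')` induced by a morphism of the Drinfeld center. -/
def map {Z Z' : Center C} (f : Z ⟶ Z') : JObj k a I Z →ₗ[Tube k I] JObj k a I Z' where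
  toFun s := fun x => s x ≫ f.f
  map_add' s t := by
    funext x
    exact Preadditive.add_comp _ _ _ (s x) (t x) f.f
  map_smul' g s := by
    funext x
    simp only [smul_def, RingHom.id_apply, Preadditive.sum_comp, ← PivotalStructure.act_comp]
    rfl

end JObj
end TubeModule

section WeakBialgebra
set_option linter.unusedSectionVars false
open TensorProduct Coalgebra

universe u

/-- A weak bialgebra: an algebra with a coalgebra structure such that the comultiplication is
multiplicative, the counit satisfies
`ε(x y₁) ε(y₂ z) = ε(x y z) = ε(x y₂) ε(y₁ z)`, and the unit satisfies
`1₁ ⊗ 1₂ 1'₁ ⊗ 1'₂ = 1₁ ⊗ 1₂ ⊗ 1₃ = 1₁ ⊗ 1'₁ 1₂ ⊗ 1'₂`. -/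
class WeakBialgebra (k A : Type u) [Field k] [Ring A] [Algebra k A] extends Coalgebra k A where
  comul_mul : ∀ x y : A, comul (x * y) = comul x * comul y
  counit_mul_mul : ∀ x y z : A,
    LinearMap.mul' k k (TensorProduct.map (counit ∘ₗ LinearMap.mulLeft k x)
      (counit ∘ₗ LinearMap.mulRight k z) (comul y)) = counit (x * y * z)
  counit_mul_mul' : ∀ x y z : A,
    LinearMap.mul' k k (TensorProduct.map (counit ∘ₗ LinearMap.mulRight k z)
      (counit ∘ₗ LinearMap.mulLeft k x) (comul y)) = counit (x * y * z)
  comul_one : TensorProduct.assoc k A A A (comul 1 ⊗ₜ[k] (1 : A)) * ((1 : A) ⊗ₜ[k] comul 1) =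
    comul.lTensor A (comul 1)
  comul_one' : ((1 : A) ⊗ₜ[k] comul 1) * TensorProduct.assoc k A A A (comul 1 ⊗ₜ[k] (1 : A)) =
    comul.lTensor A (comul 1)

namespace WeakBialgebra

variable (k : Type u) {A : Type u} [Field k] [Ring A] [Algebra k A] [WeakBialgebra k A]

/-- The map `x ⊗ y ↦ ε(x z) y`. -/
def contL (z : A) : A ⊗[k] A →ₗ[k] A :=
  (TensorProduct.lid k A).toLinearMap ∘ₗ
    (counit ∘ₗ LinearMap.mulRight k z).rTensor A

/-- The map `x ⊗ y ↦ ε(y z) x`. -/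
def contR (z : A) : A ⊗[k] A →ₗ[k] A :=
  (TensorProduct.rid k A).toLinearMap ∘ₗ
    (counit ∘ₗ LinearMap.mulRight k z).lTensor A

@[simp] theorem contL_tmul (x y z : A) :
    contL k z (x ⊗ₜ[k] y) = counit (R := k) (x * z) • y := by simp [contL]
@[simp] theorem contR_tmul (x y z : A) :
    contR k z (x ⊗ₜ[k] y) = counit (R := k) (y * z) • x := by simp [contR]

/-- The idempotent map `x ↦ ε(1₁ x) 1₂`. -/
def epsL : A →ₗ[k] A where
  toFun x := contL k x (comul (R := k) (1 : A))
  map_add' x y := by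
    induction comul (R := k) (1 : A) using TensorProduct.induction_on with
    | zero => simp
    | tmul a b => simp [mul_add, add_smul]
    | add a b ha hb => rw [map_add, map_add, map_add, ha, hb]; abel
  map_smul' c x := by
    induction comul (R := k) (1 : A) using TensorProduct.induction_on with
    | zero => simp
    | tmul a b => simp [smul_smul]
    | add a b ha hb => simp only [map_add, ha, hb, smul_add]

/-- The idempotent map `x ↦ 1₁ ε(1₂ x)`. -/
def epsR : A →ₗ[k] A where
  toFun x := contR k x (comul (R := k) (1 : A))
  map_add' x y := by
    induction comul (R := k) (1 : A) using TensorProduct.induction_on with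
    | zero => simp
    | tmul a b => simp [mul_add, add_smul]
    | add a b ha hb => rw [map_add, map_add, map_add, ha, hb]; abel
  map_smul' c x := by
    induction comul (R := k) (1 : A) using TensorProduct.induction_on with
    | zero => simp
    | tmul a b => simp [smul_smul]
    | add a b ha hb => simp only [map_add, ha, hb, smul_add]

theorem epsL_def (x : A) : epsL k x = contL k x (comul (R := k) (1 : A)) := rfl
theorem epsR_def (x : A) : epsR k x = contR k x (comul (R := k) (1 : A)) := rfl

theorem counit_mul_epsL (b y : A) : counit (R := k) (b * epsL k y) = counit (R := k) (b * y) := by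
  have h := counit_mul_mul' (k := k) b 1 y
  rw [mul_one] at h
  rw [← h, epsL_def]
  induction comul (R := k) (1 : A) using TensorProduct.induction_on with
  | zero => simp
  | tmul a b => simp
  | add a b ha hb => simp only [map_add, ha, hb, mul_add]

theorem counit_mul_epsR (b y : A) : counit (R := k) (b * epsR k y) = counit (R := k) (b * y) := by
  have h := counit_mul_mul (k := k) b 1 y
  rw [mul_one] at h
  rw [← h, epsR_def]
  induction comul (R := k) (1 : A) using TensorProduct.induction_on with
  | zero => simp
  | tmul a b => simp [mul_comm]
  | add a b ha hb => simp only [map_add, ha, hb, mul_add]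

theorem contL_congr {y z : A} (h : ∀ b : A, counit (R := k) (b * y) = counit (R := k) (b * z)) :
    contL k y = contL k z := by
  ext a b
  simp [h]

theorem contR_congr {y z : A} (h : ∀ b : A, counit (R := k) (b * y) = counit (R := k) (b * z)) :
    contR k y = contR k z := by
  ext a b
  simp [h]

theorem epsL_mul_epsL (a y : A) : epsL k (a * epsL k y) = epsL k (a * y) := by
  rw [epsL_def, epsL_def k (a * y), contL_congr k (z := a * y)
    fun b => by rw [← mul_assoc, counit_mul_epsL, mul_assoc]]

theorem epsL_mul_epsR (a y : A) : epsL k (a * epsR k y) = epsL k (a * y) := by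
  rw [epsL_def, epsL_def k (a * y), contL_congr k (z := a * y)
    fun b => by rw [← mul_assoc, counit_mul_epsR, mul_assoc]]

theorem epsL_epsL (y : A) : epsL k (epsL k y) = epsL k y := by
  simpa using epsL_mul_epsL k 1 y

theorem epsR_epsL (y : A) : epsR k (epsL k y) = epsR k y := by
  rw [epsR_def, epsR_def k y, contR_congr k fun b => counit_mul_epsL k b y]

theorem contL_one_comul (a : A) : contL k 1 (comul (R := k) a) = a := by
  have h := rTensor_counit_comul (R := k) a
  have h2 : contL k (1 : A) =
      (TensorProduct.lid k A).toLinearMap ∘ₗ (counit (R := k) (A := A)).rTensor A := by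
    ext a b; simp
  rw [h2, LinearMap.comp_apply, h]; simp

theorem contR_one_comul (a : A) : contR k 1 (comul (R := k) a) = a := by
  have h := lTensor_counit_comul (R := k) a
  have h2 : contR k (1 : A) =
      (TensorProduct.rid k A).toLinearMap ∘ₗ (counit (R := k) (A := A)).lTensor A := by
    ext a b; simp
  rw [h2, LinearMap.comp_apply, h]; simp

theorem epsL_one : epsL k (1 : A) = 1 := contL_one_comul k 1
theorem epsR_one : epsR k (1 : A) = 1 := contR_one_comul k 1

/-- `ε(a₁ y) a₂ = a ε(1₁ y) 1₂`. -/
theorem contL_comul (a y : A) : contL k y (comul (R := k) a) = a * epsL k y := by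
  set P : A ⊗[k] (A ⊗[k] A) →ₗ[k] A ⊗[k] A := (TensorProduct.lid k (A ⊗[k] A)).toLinearMap ∘ₗ
    (counit ∘ₗ LinearMap.mulRight k y).rTensor (A ⊗[k] A) with hP
  have h1 : ∀ t : A ⊗[k] A, comul (R := k) (contL k y t) =
      P ((comul (R := k) (A := A)).lTensor A t) := by
    intro t
    induction t using TensorProduct.induction_on with
    | zero => simp
    | tmul a b => simp [hP]
    | add a b ha hb => simp only [map_add, ← ha, ← hb]
  have h2 : ∀ (e f c d : A) (t : A ⊗[k] A), contL k 1 ((e ⊗ₜ[k] f) *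
      P (((1 : A) ⊗ₜ[k] (c ⊗ₜ[k] d)) * TensorProduct.assoc k A A A (t ⊗ₜ[k] (1 : A)))) =
      LinearMap.mul' k k (TensorProduct.map (counit ∘ₗ LinearMap.mulRight k y)
        (counit ∘ₗ LinearMap.mulLeft k (e * c)) t) • (f * d) := by
    intro e f c d t
    induction t using TensorProduct.induction_on with
    | zero => simp
    | tmul a b => simp [hP, smul_smul]
    | add a b ha hb => simp only [map_add, add_tmul, mul_add, ha, hb, add_smul]
  have h3 : ∀ s t : A ⊗[k] A, contL k 1 (s * P (((1 : A) ⊗ₜ[k] t) *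
      TensorProduct.assoc k A A A (comul (R := k) 1 ⊗ₜ[k] (1 : A)))) = contL k y (s * t) := by
    intro s t
    induction t using TensorProduct.induction_on with
    | zero => simp
    | add a b ha hb => simp only [map_add, tmul_add, mul_add, add_mul, ha, hb]
    | tmul c d =>
      induction s using TensorProduct.induction_on with
      | zero => simp
      | add a b ha hb => simp only [map_add, add_mul, ha, hb]
      | tmul e f => rw [h2, counit_mul_mul']; simp
  rw [← contL_one_comul k (a * epsL k y), comul_mul, epsL_def, h1, ← comul_one', h3, ← comul_mul,
    mul_one]

/-- `a₁ ε(a₂ y) = a 1₁ ε(1₂ y)`. -/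
theorem contR_comul (a y : A) : contR k y (comul (R := k) a) = a * epsR k y := by
  have h1 : ∀ t : A ⊗[k] A, comul (R := k) (contR k y t) =
      (contR k y).lTensor A (TensorProduct.assoc k A A A
        ((comul (R := k) (A := A)).rTensor A t)) := by
    intro t
    have h0 : ∀ (s : A ⊗[k] A) (b : A),
        counit (R := k) (b * y) • s = (contR k y).lTensor A
          (TensorProduct.assoc k A A A (s ⊗ₜ[k] b)) := by
      intro s b
      induction s using TensorProduct.induction_on with
      | zero => simp
      | tmul c d => simp
      | add c d hc hd => simp only [map_add, add_tmul, smul_add, hc, hd]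
    induction t using TensorProduct.induction_on with
    | zero => simp
    | tmul a b => simp [h0]
    | add a b ha hb => simp only [map_add, ← ha, ← hb]
  have h2 : ∀ (e f c d : A) (t : A ⊗[k] A), contR k 1 ((e ⊗ₜ[k] f) * (contR k y).lTensor A
      (TensorProduct.assoc k A A A ((c ⊗ₜ[k] d) ⊗ₜ[k] (1 : A)) * ((1 : A) ⊗ₜ[k] t))) =
      LinearMap.mul' k k (TensorProduct.map (counit ∘ₗ LinearMap.mulLeft k (f * d))
        (counit ∘ₗ LinearMap.mulRight k y) t) • (e * c) := by
    intro e f c d t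
    induction t using TensorProduct.induction_on with
    | zero => simp
    | tmul a b => simp [smul_smul, mul_comm]
    | add a b ha hb => simp only [map_add, tmul_add, mul_add, ha, hb, add_smul]
  have h3 : ∀ s t : A ⊗[k] A, contR k 1 (s * (contR k y).lTensor A
      (TensorProduct.assoc k A A A (t ⊗ₜ[k] (1 : A)) * ((1 : A) ⊗ₜ[k] comul (R := k) 1))) =
      contR k y (s * t) := by
    intro s t
    induction t using TensorProduct.induction_on with
    | zero => simp
    | add a b ha hb => simp only [map_add, add_tmul, mul_add, add_mul, ha, hb]
    | tmul c d =>
      induction s using TensorProduct.induction_on with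
      | zero => simp
      | add a b ha hb => simp only [map_add, add_mul, ha, hb]
      | tmul e f => rw [h2, counit_mul_mul]; simp
  rw [← contR_one_comul k (a * epsR k y), comul_mul, epsR_def, h1, coassoc_apply, ← comul_one, h3,
    ← comul_mul, mul_one]

theorem comul_mul_epsL (a y : A) : comul (R := k) a * ((1 : A) ⊗ₜ[k] epsL k y) =
    comul (R := k) a * (epsR k y ⊗ₜ[k] (1 : A)) := by
  have h1 : ∀ t : A ⊗[k] A, t * ((1 : A) ⊗ₜ[k] epsL k y) =
      (contL k y).lTensor A ((comul (R := k) (A := A)).lTensor A t) := by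
    intro t
    induction t using TensorProduct.induction_on with
    | zero => simp
    | tmul a b => simp [contL_comul]
    | add a b ha hb => simp only [map_add, ← ha, ← hb, add_mul]
  have h2 : ∀ t : A ⊗[k] A, t * (epsR k y ⊗ₜ[k] (1 : A)) =
      (contR k y).rTensor A ((comul (R := k) (A := A)).rTensor A t) := by
    intro t
    induction t using TensorProduct.induction_on with
    | zero => simp
    | tmul a b => simp [contR_comul]
    | add a b ha hb => simp only [map_add, ← ha, ← hb, add_mul]
  have h3 : (contL k y).lTensor A ∘ₗ (TensorProduct.assoc k A A A).toLinearMap =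
      (contR k y).rTensor A := by
    ext a b c
    simp [TensorProduct.smul_tmul']
  rw [h1, h2, ← h3, LinearMap.comp_apply]
  congr 1
  exact (coassoc_apply (R := k) a).symm

/-- `ε(1₁ a x) 1₂ b = contL (Δ(1) (a ⊗ b))`. -/
theorem epsL_mul_mul (x a b : A) :
    epsL k (a * x) * b = contL k x (comul (R := k) (1 : A) * (a ⊗ₜ[k] b)) := by
  rw [epsL_def]
  induction comul (R := k) (1 : A) using TensorProduct.induction_on with
  | zero => simp
  | tmul c d => simp [mul_assoc]
  | add c d hc hd => simp only [map_add, add_mul, hc, hd]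

theorem epsR_mul_mul (x a b : A) :
    epsR k (b * x) * a = contR k x (comul (R := k) (1 : A) * (a ⊗ₜ[k] b)) := by
  rw [epsR_def]
  induction comul (R := k) (1 : A) using TensorProduct.induction_on with
  | zero => simp
  | tmul c d => simp [mul_assoc]
  | add c d hc hd => simp only [map_add, add_mul, hc, hd]

theorem comul_one_mul (a : A) : comul (R := k) (1 : A) * comul (R := k) a = comul a := by
  rw [← comul_mul, one_mul]

theorem comul_mul_one (a : A) : comul (R := k) a * comul (R := k) (1 : A) = comul a := by
  rw [← comul_mul, mul_one]

end WeakBialgebra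
end WeakBialgebra

section RepTensor
set_option linter.unusedSectionVars false
open TensorProduct Coalgebra WeakBialgebra

universe u

variable (k A : Type u) [Field k] [Ring A] [Algebra k A]
  (V W U V' W' : Type u)
  [AddCommGroup V] [Module k V] [Module A V] [IsScalarTower k A V]
  [AddCommGroup W] [Module k W] [Module A W] [IsScalarTower k A W]
  [AddCommGroup U] [Module k U] [Module A U] [IsScalarTower k A U]
  [AddCommGroup V'] [Module k V'] [Module A V'] [IsScalarTower k A V']
  [AddCommGroup W'] [Module k W'] [Module A W'] [IsScalarTower k A W']

/-- The action of `A ⊗ A` on `V ⊗ W`. -/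
noncomputable def rho : A ⊗[k] A →ₐ[k] Module.End k (V ⊗[k] W) :=
  (Module.endTensorEndAlgHom (R := k) (S := k) (A := k) (M := V) (N := W)).comp
    (Algebra.TensorProduct.map (Algebra.lsmul k k V) (Algebra.lsmul k k W))

@[simp] theorem rho_tmul_tmul (a b : A) (v : V) (w : W) :
    rho k A V W (a ⊗ₜ[k] b) (v ⊗ₜ[k] w) = (a • v) ⊗ₜ[k] (b • w) := by
  simp [rho, Module.endTensorEndAlgHom_apply]

variable {k A V W V' W'}
theorem rho_map (f : V →ₗ[A] V') (g : W →ₗ[A] W') (t : A ⊗[k] A) (x : V ⊗[k] W) :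
    rho k A V' W' t (TensorProduct.map (f.restrictScalars k) (g.restrictScalars k) x) =
      TensorProduct.map (f.restrictScalars k) (g.restrictScalars k) (rho k A V W t x) := by
  induction x using TensorProduct.induction_on with
  | zero => simp
  | add x y hx hy => simp only [map_add, hx, hy]
  | tmul v w =>
    induction t using TensorProduct.induction_on with
    | zero => simp
    | add x y hx hy => simp only [map_add, LinearMap.add_apply, hx, hy]
    | tmul a b => simp
variable (k A V W V' W')

variable [WeakBialgebra k A]

/-- The tensor product `V ⊠ W` of two representations of a weak bialgebra: the image of the
idempotent `v ⊗ w ↦ 1₁ v ⊗ 1₂ w` of `V ⊗ W`. -/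
def BTensor : Type u := LinearMap.range (rho k A V W (comul (R := k) (1 : A)))

namespace BTensor

noncomputable instance : AddCommGroup (BTensor k A V W) :=
  inferInstanceAs (AddCommGroup (LinearMap.range (rho k A V W (comul (R := k) (1 : A)))))

noncomputable instance : Module k (BTensor k A V W) :=
  inferInstanceAs (Module k (LinearMap.range (rho k A V W (comul (R := k) (1 : A)))))

instance [FiniteDimensional k V] [FiniteDimensional k W] :
    FiniteDimensional k (BTensor k A V W) :=
  inferInstanceAs (FiniteDimensional k (LinearMap.range (rho k A V W (comul (R := k) (1 : A)))))

/-- The inclusion of `V ⊠ W` in `V ⊗ W`. -/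
noncomputable def incl : BTensor k A V W →ₗ[k] V ⊗[k] W := Submodule.subtype _

/-- The projection of `V ⊗ W` onto `V ⊠ W`. -/
noncomputable def proj : V ⊗[k] W →ₗ[k] BTensor k A V W := LinearMap.rangeRestrict _

theorem incl_proj (x : V ⊗[k] W) :
    incl k A V W (proj k A V W x) = rho k A V W (comul (R := k) (1 : A)) x := rfl

theorem incl_injective : Function.Injective (incl k A V W) := Subtype.val_injective

theorem rho_one_incl (u : BTensor k A V W) :
    rho k A V W (comul (R := k) (1 : A)) (incl k A V W u) = incl k A V W u := by
  obtain ⟨_, x, rfl⟩ := u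
  change rho k A V W _ (rho k A V W _ x) = rho k A V W _ x
  rw [← Module.End.mul_apply, ← map_mul, comul_one_mul]

theorem proj_incl (u : BTensor k A V W) : proj k A V W (incl k A V W u) = u := by
  apply incl_injective
  rw [incl_proj, rho_one_incl]

/-- The action `a • u = a₁ u ⊗ a₂ u` on `V ⊠ W`. -/
noncomputable instance : SMul A (BTensor k A V W) where
  smul a u := proj k A V W (rho k A V W (comul (R := k) a) (incl k A V W u))

theorem smul_def (a : A) (u : BTensor k A V W) :
    a • u = proj k A V W (rho k A V W (comul (R := k) a) (incl k A V W u)) := rfl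

theorem incl_smul (a : A) (u : BTensor k A V W) :
    incl k A V W (a • u) = rho k A V W (comul (R := k) a) (incl k A V W u) := by
  rw [smul_def, incl_proj, ← Module.End.mul_apply, ← map_mul, comul_one_mul]

noncomputable instance : Module A (BTensor k A V W) where
  one_smul u := by rw [smul_def, rho_one_incl, proj_incl]
  mul_smul a b u := by
    apply incl_injective
    rw [incl_smul, incl_smul, incl_smul, comul_mul, map_mul, Module.End.mul_apply]
  smul_zero a := by rw [smul_def]; simp
  zero_smul u := by rw [smul_def]; simp
  smul_add a u v := by simp only [smul_def, map_add]
  add_smul a b u := by simp only [smul_def, map_add, LinearMap.add_apply]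

instance : IsScalarTower k A (BTensor k A V W) where
  smul_assoc c a u := by simp only [smul_def, map_smul, LinearMap.smul_apply]

theorem proj_rho (a : A) (x : V ⊗[k] W) :
    proj k A V W (rho k A V W (comul (R := k) a) x) = a • proj k A V W x := by
  apply incl_injective
  rw [incl_smul, incl_proj, incl_proj, ← Module.End.mul_apply, ← map_mul, comul_one_mul,
    ← Module.End.mul_apply, ← map_mul, comul_mul_one]

variable {V W V' W'}

/-- The tensor product `f ⊠ g` of two morphisms of representations. -/
noncomputable def map (f : V →ₗ[A] V') (g : W →ₗ[A] W') : BTensor k A V W →ₗ[A] BTensor k A V' W' where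
  toFun u := proj k A V' W'
    (TensorProduct.map (f.restrictScalars k) (g.restrictScalars k) (incl k A V W u))
  map_add' u v := by simp only [map_add]
  map_smul' a u := by rw [incl_smul, ← rho_map, proj_rho]; rfl

theorem incl_map (f : V →ₗ[A] V') (g : W →ₗ[A] W') (u : BTensor k A V W) :
    incl k A V' W' (map k A f g u) =
      TensorProduct.map (f.restrictScalars k) (g.restrictScalars k) (incl k A V W u) := by
  change incl k A V' W' (proj k A V' W' _) = _
  rw [incl_proj, rho_map, rho_one_incl]

variable (V W)

/-- The action of `A ⊗ (A ⊗ A)` on `V ⊗ (W ⊗ U)`. -/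
noncomputable def rho3 : A ⊗[k] (A ⊗[k] A) →ₐ[k] Module.End k (V ⊗[k] (W ⊗[k] U)) :=
  (Module.endTensorEndAlgHom (R := k) (S := k) (A := k) (M := V) (N := W ⊗[k] U)).comp
    (Algebra.TensorProduct.map (Algebra.lsmul k k V) (rho k A W U))

theorem rho3_tmul_tmul (a : A) (t : A ⊗[k] A) (v : V) (x : W ⊗[k] U) :
    rho3 k A V W U (a ⊗ₜ[k] t) (v ⊗ₜ[k] x) = (a • v) ⊗ₜ[k] rho k A W U t x := by
  simp [rho3, Module.endTensorEndAlgHom_apply]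

/-- The inclusion of `(V ⊠ W) ⊠ U` in `V ⊗ (W ⊗ U)`. -/
noncomputable def incl3L : BTensor k A (BTensor k A V W) U →ₗ[k] V ⊗[k] (W ⊗[k] U) :=
  (TensorProduct.assoc k V W U).toLinearMap ∘ₗ (incl k A V W).rTensor U ∘ₗ incl k A _ U

/-- The inclusion of `V ⊠ (W ⊠ U)` in `V ⊗ (W ⊗ U)`. -/
noncomputable def incl3R : BTensor k A V (BTensor k A W U) →ₗ[k] V ⊗[k] (W ⊗[k] U) :=
  (incl k A W U).lTensor V ∘ₗ incl k A V _

/-- The projection of `V ⊗ (W ⊗ U)` onto `(V ⊠ W) ⊠ U`. -/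
noncomputable def proj3L : V ⊗[k] (W ⊗[k] U) →ₗ[k] BTensor k A (BTensor k A V W) U :=
  proj k A _ U ∘ₗ (proj k A V W).rTensor U ∘ₗ (TensorProduct.assoc k V W U).symm.toLinearMap

/-- The projection of `V ⊗ (W ⊗ U)` onto `V ⊠ (W ⊠ U)`. -/
noncomputable def proj3R : V ⊗[k] (W ⊗[k] U) →ₗ[k] BTensor k A V (BTensor k A W U) :=
  proj k A V _ ∘ₗ (proj k A W U).lTensor V

theorem incl_comp_proj : proj k A V W ∘ₗ incl k A V W = LinearMap.id :=
  LinearMap.ext (proj_incl k A V W)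

theorem proj3L_incl3L (u) : proj3L k A V W U (incl3L k A V W U u) = u := by
  simp [proj3L, incl3L, ← LinearMap.rTensor_comp_apply, incl_comp_proj, proj_incl]

theorem proj3R_incl3R (u) : proj3R k A V W U (incl3R k A V W U u) = u := by
  simp [proj3R, incl3R, ← LinearMap.lTensor_comp_apply, incl_comp_proj, proj_incl]

theorem incl3L_injective : Function.Injective (incl3L k A V W U) :=
  Function.LeftInverse.injective (proj3L_incl3L k A V W U)

theorem incl3R_injective : Function.Injective (incl3R k A V W U) :=
  Function.LeftInverse.injective (proj3R_incl3R k A V W U)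

theorem rho3_incl (t : A ⊗[k] A) (x : V ⊗[k] BTensor k A W U) :
    (incl k A W U).lTensor V (rho k A V _ t x) =
      rho3 k A V W U (comul.lTensor A t) ((incl k A W U).lTensor V x) := by
  induction x using TensorProduct.induction_on with
  | zero => simp
  | add x y hx hy => simp only [map_add, hx, hy]
  | tmul v w =>
    induction t using TensorProduct.induction_on with
    | zero => simp
    | add x y hx hy => simp only [map_add, LinearMap.add_apply, hx, hy]
    | tmul a b => simp [rho3_tmul_tmul, incl_smul]

theorem rho3_proj (t : A ⊗[k] A) (x : V ⊗[k] (W ⊗[k] U)) :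
    rho k A V _ t ((proj k A W U).lTensor V x) =
      (proj k A W U).lTensor V (rho3 k A V W U (comul.lTensor A t) x) := by
  induction x using TensorProduct.induction_on with
  | zero => simp
  | add x y hx hy => simp only [map_add, hx, hy]
  | tmul v w =>
    induction t using TensorProduct.induction_on with
    | zero => simp
    | add x y hx hy => simp only [map_add, LinearMap.add_apply, hx, hy]
    | tmul a b => simp [rho3_tmul_tmul, proj_rho]

theorem rho3_assoc (t : A ⊗[k] A) (b : A) (x : V ⊗[k] W) (u : U) :
    rho3 k A V W U (TensorProduct.assoc k A A A (t ⊗ₜ[k] b))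
      (TensorProduct.assoc k V W U (x ⊗ₜ[k] u)) =
    TensorProduct.assoc k V W U (rho k A V W t x ⊗ₜ[k] (b • u)) := by
  induction x using TensorProduct.induction_on with
  | zero => simp
  | add x y hx hy => simp only [map_add, add_tmul, hx, hy]
  | tmul v w =>
    induction t using TensorProduct.induction_on with
    | zero => simp
    | add x y hx hy => simp only [map_add, add_tmul, LinearMap.add_apply, hx, hy]
    | tmul a c => simp [rho3_tmul_tmul]

theorem rho3_incl' (t : A ⊗[k] A) (x : BTensor k A V W ⊗[k] U) :
    TensorProduct.assoc k V W U ((incl k A V W).rTensor U (rho k A _ U t x)) =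
      rho3 k A V W U (TensorProduct.assoc k A A A (comul.rTensor A t))
        (TensorProduct.assoc k V W U ((incl k A V W).rTensor U x)) := by
  induction x using TensorProduct.induction_on with
  | zero => simp
  | add x y hx hy => simp only [map_add, hx, hy]
  | tmul v w =>
    induction t using TensorProduct.induction_on with
    | zero => simp
    | add x y hx hy => simp only [map_add, LinearMap.add_apply, hx, hy]
    | tmul a b =>
      simp only [rho_tmul_tmul, LinearMap.rTensor_tmul, incl_smul, rho3_assoc]

theorem rho3_proj' (t : A ⊗[k] A) (x : (V ⊗[k] W) ⊗[k] U) :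
    rho k A _ U t ((proj k A V W).rTensor U x) =
      (proj k A V W).rTensor U ((TensorProduct.assoc k V W U).symm
        (rho3 k A V W U (TensorProduct.assoc k A A A (comul.rTensor A t))
          (TensorProduct.assoc k V W U x))) := by
  induction x using TensorProduct.induction_on with
  | zero => simp
  | add x y hx hy => simp only [map_add, hx, hy]
  | tmul v w =>
    induction t using TensorProduct.induction_on with
    | zero => simp
    | add x y hx hy => simp only [map_add, LinearMap.add_apply, hx, hy]
    | tmul a b =>
      simp only [rho_tmul_tmul, LinearMap.rTensor_tmul, rho3_assoc, LinearEquiv.symm_apply_apply,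
        proj_rho]

theorem incl3R_smul (a : A) (u) : incl3R k A V W U (a • u) =
    rho3 k A V W U (comul.lTensor A (comul (R := k) a)) (incl3R k A V W U u) := by
  simp only [incl3R, LinearMap.comp_apply, incl_smul, rho3_incl]

theorem incl3L_smul (a : A) (u) : incl3L k A V W U (a • u) =
    rho3 k A V W U (comul.lTensor A (comul (R := k) a)) (incl3L k A V W U u) := by
  simp only [incl3L, LinearMap.comp_apply, incl_smul, LinearEquiv.coe_coe, rho3_incl',
    coassoc_apply]

theorem incl3R_proj3R (x) : incl3R k A V W U (proj3R k A V W U x) =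
    rho3 k A V W U (comul.lTensor A (comul (R := k) (1 : A))) x := by
  have h : ∀ t : A ⊗[k] A, rho3 k A V W U (comul.lTensor A t)
      ((incl k A W U).lTensor V ((proj k A W U).lTensor V x)) =
      rho3 k A V W U (comul.lTensor A t) x := by
    intro t
    induction t using TensorProduct.induction_on with
    | zero => simp
    | add x y hx hy => simp only [map_add, LinearMap.add_apply, hx, hy]
    | tmul a b =>
      induction x using TensorProduct.induction_on with
      | zero => simp
      | add x y hx hy => simp only [map_add, hx, hy]
      | tmul v y =>
        simp only [LinearMap.lTensor_tmul, incl_proj, rho3_tmul_tmul]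
        rw [← Module.End.mul_apply, ← map_mul, comul_mul_one]
  simp only [incl3R, proj3R, LinearMap.comp_apply, incl_proj, rho3_incl, h]

theorem incl3L_proj3L (x) : incl3L k A V W U (proj3L k A V W U x) =
    rho3 k A V W U (comul.lTensor A (comul (R := k) (1 : A))) x := by
  have h : ∀ (t : A ⊗[k] A) (x : (V ⊗[k] W) ⊗[k] U),
      rho3 k A V W U (TensorProduct.assoc k A A A (comul.rTensor A t))
      (TensorProduct.assoc k V W U
        ((incl k A V W).rTensor U ((proj k A V W).rTensor U x))) =
      rho3 k A V W U (TensorProduct.assoc k A A A (comul.rTensor A t))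
      (TensorProduct.assoc k V W U x) := by
    intro t x
    induction t using TensorProduct.induction_on with
    | zero => simp
    | add x y hx hy => simp only [map_add, LinearMap.add_apply, hx, hy]
    | tmul a b =>
      induction x using TensorProduct.induction_on with
      | zero => simp
      | add x y hx hy => simp only [map_add, hx, hy]
      | tmul y u =>
        simp only [LinearMap.rTensor_tmul, incl_proj, rho3_assoc]
        rw [← Module.End.mul_apply, ← map_mul, comul_mul_one]
  simp only [incl3L, proj3L, LinearMap.comp_apply, incl_proj, LinearEquiv.coe_coe, rho3_incl', h,
    LinearEquiv.apply_symm_apply]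
  rw [coassoc_apply]

/-- The associator: the canonical isomorphism between the two retracts of `V ⊗ W ⊗ U`. -/
noncomputable def assoc :
    BTensor k A (BTensor k A V W) U ≃ₗ[A] BTensor k A V (BTensor k A W U) where
  toFun u := proj3R k A V W U (incl3L k A V W U u)
  invFun u := proj3L k A V W U (incl3R k A V W U u)
  map_add' u v := by simp only [map_add]
  map_smul' a u := by
    apply incl3R_injective
    simp only [RingHom.id_apply, incl3R_smul, incl3R_proj3R, ← incl3L_smul, one_smul]
  left_inv u := by
    apply incl3L_injective
    simp only [incl3L_proj3L, incl3R_proj3R, ← incl3L_smul, one_smul]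
  right_inv u := by
    apply incl3R_injective
    simp only [incl3L_proj3L, incl3R_proj3R, ← incl3R_smul, one_smul]

theorem incl3R_assoc (u) : incl3R k A V W U (assoc k A V W U u) = incl3L k A V W U u := by
  change incl3R k A V W U (proj3R k A V W U _) = _
  rw [incl3R_proj3R, ← incl3L_smul, one_smul]

theorem incl3L_assoc_symm (u) :
    incl3L k A V W U ((assoc k A V W U).symm u) = incl3R k A V W U u := by
  rw [← incl3R_assoc, LinearEquiv.apply_symm_apply]


variable {V W U}
variable {U' : Type u} [AddCommGroup U'] [Module k U'] [Module A U'] [IsScalarTower k A U']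

theorem map_restrict (f : V →ₗ[A] V') (g : W →ₗ[A] W') :
    incl k A V' W' ∘ₗ (map k A f g).restrictScalars k =
      TensorProduct.map (f.restrictScalars k) (g.restrictScalars k) ∘ₗ incl k A V W :=
  LinearMap.ext (incl_map k A f g)

theorem incl3R_map (f : V →ₗ[A] V') (g : W →ₗ[A] W') (h : U →ₗ[A] U')
    (q : BTensor k A V (BTensor k A W U)) :
    incl3R k A V' W' U' (map k A f (map k A g h) q) =
      TensorProduct.map (f.restrictScalars k)
        (TensorProduct.map (g.restrictScalars k) (h.restrictScalars k))
        (incl3R k A V W U q) := by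
  simp only [incl3R, LinearMap.comp_apply, incl_map, LinearMap.lTensor,
    TensorProduct.map_map, map_restrict, LinearMap.id_comp, LinearMap.comp_id]

theorem incl3L_map (f : V →ₗ[A] V') (g : W →ₗ[A] W') (h : U →ₗ[A] U')
    (q : BTensor k A (BTensor k A V W) U) :
    incl3L k A V' W' U' (map k A (map k A f g) h q) =
      TensorProduct.map (f.restrictScalars k)
        (TensorProduct.map (g.restrictScalars k) (h.restrictScalars k))
        (incl3L k A V W U q) := by
  have e : ∀ y : (V ⊗[k] W) ⊗[k] U, TensorProduct.assoc k V' W' U'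
      (TensorProduct.map (TensorProduct.map (f.restrictScalars k) (g.restrictScalars k))
        (h.restrictScalars k) y) = TensorProduct.map (f.restrictScalars k)
        (TensorProduct.map (g.restrictScalars k) (h.restrictScalars k))
        (TensorProduct.assoc k V W U y) := by
    intro y
    exact congr($(TensorProduct.ext_threefold (g := (TensorProduct.assoc k V' W' U').toLinearMap ∘ₗ
      TensorProduct.map (TensorProduct.map (f.restrictScalars k) (g.restrictScalars k))
        (h.restrictScalars k)) (h := TensorProduct.map (f.restrictScalars k)
        (TensorProduct.map (g.restrictScalars k) (h.restrictScalars k)) ∘ₗ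
        (TensorProduct.assoc k V W U).toLinearMap) (fun _ _ _ => by simp)) y)
  simp only [incl3L, LinearMap.comp_apply, incl_map, LinearEquiv.coe_coe, ← e]
  congr 1
  simp only [LinearMap.rTensor, TensorProduct.map_map, map_restrict, LinearMap.id_comp,
    LinearMap.comp_id]

theorem assoc_naturality (f : V →ₗ[A] V') (g : W →ₗ[A] W') (h : U →ₗ[A] U')
    (q : BTensor k A (BTensor k A V W) U) :
    assoc k A V' W' U' (map k A (map k A f g) h q) =
      map k A f (map k A g h) (assoc k A V W U q) := by
  apply incl3R_injective
  rw [incl3R_assoc, incl3L_map, incl3R_map, incl3R_assoc]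

theorem map_id : map k A (LinearMap.id : V →ₗ[A] V) (LinearMap.id : W →ₗ[A] W) =
    LinearMap.id := by
  ext u
  apply incl_injective
  rw [incl_map]
  exact congr($(TensorProduct.map_id) _)

theorem map_comp {V'' W'' : Type u}
    [AddCommGroup V''] [Module k V''] [Module A V''] [IsScalarTower k A V'']
    [AddCommGroup W''] [Module k W''] [Module A W''] [IsScalarTower k A W'']
    (f : V →ₗ[A] V') (g : W →ₗ[A] W') (f' : V' →ₗ[A] V'') (g' : W' →ₗ[A] W'') :
    map k A (f' ∘ₗ f) (g' ∘ₗ g) = map k A f' g' ∘ₗ map k A f g := by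
  ext u
  apply incl_injective
  simp only [incl_map, LinearMap.comp_apply]
  exact congr($(TensorProduct.map_comp (f'.restrictScalars k) (g'.restrictScalars k)
    (f.restrictScalars k) (g.restrictScalars k)) _)

variable (V W U)
variable (T : Type u) [AddCommGroup T] [Module k T] [Module A T] [IsScalarTower k A T]

/-- The inclusion of `V ⊠ (W ⊠ (U ⊠ T))` in `V ⊗ (W ⊗ (U ⊗ T))`. -/
noncomputable def incl4 : BTensor k A V (BTensor k A W (BTensor k A U T)) →ₗ[k]
    V ⊗[k] (W ⊗[k] (U ⊗[k] T)) :=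
  (incl3R k A W U T).lTensor V ∘ₗ incl k A V _

theorem incl4_injective : Function.Injective (incl4 k A V W U T) := by
  apply Function.LeftInverse.injective (g := proj k A V _ ∘ₗ (proj3R k A W U T).lTensor V)
  intro u
  have : proj3R k A W U T ∘ₗ incl3R k A W U T = LinearMap.id :=
    LinearMap.ext (proj3R_incl3R k A W U T)
  simp [incl4, ← LinearMap.lTensor_comp_apply, this, proj_incl]

theorem pentagon (q : BTensor k A (BTensor k A (BTensor k A V W) U) T) :
    map k A (LinearMap.id : V →ₗ[A] V) (assoc k A W U T).toLinearMap
      (assoc k A V (BTensor k A W U) T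
        (map k A (assoc k A V W U).toLinearMap (LinearMap.id : T →ₗ[A] T) q)) =
    assoc k A V W (BTensor k A U T) (assoc k A (BTensor k A V W) U T q) := by
  apply incl4_injective
  have a1 : incl3R k A W U T ∘ₗ (assoc k A W U T).toLinearMap.restrictScalars k =
      incl3L k A W U T := LinearMap.ext (incl3R_assoc k A W U T)
  have a2 : incl3R k A V W U ∘ₗ (assoc k A V W U).toLinearMap.restrictScalars k =
      incl3L k A V W U := LinearMap.ext (incl3R_assoc k A V W U)
  have b1 : ∀ y : (V ⊗[k] BTensor k A W U) ⊗[k] T,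
      (((incl k A W U).rTensor T).lTensor V) (TensorProduct.assoc k _ _ _ y) =
      TensorProduct.assoc k _ _ _ ((((incl k A W U).lTensor V).rTensor T) y) := by
    intro y
    exact congr($(TensorProduct.ext_threefold
      (g := (((incl k A W U).rTensor T).lTensor V) ∘ₗ (TensorProduct.assoc k _ _ _).toLinearMap)
      (h := (TensorProduct.assoc k _ _ _).toLinearMap ∘ₗ (((incl k A W U).lTensor V).rTensor T))
      (fun _ _ _ => by simp)) y)
  have b2 : ∀ y : (V ⊗[k] W) ⊗[k] BTensor k A U T,
      (((incl k A U T).lTensor W).lTensor V) (TensorProduct.assoc k _ _ _ y) =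
      TensorProduct.assoc k _ _ _ (((incl k A U T).lTensor (V ⊗[k] W)) y) := by
    intro y
    exact congr($(TensorProduct.ext_threefold
      (g := (((incl k A U T).lTensor W).lTensor V) ∘ₗ (TensorProduct.assoc k _ _ _).toLinearMap)
      (h := (TensorProduct.assoc k _ _ _).toLinearMap ∘ₗ ((incl k A U T).lTensor (V ⊗[k] W)))
      (fun _ _ _ => by simp)) y)
  have b3 : ∀ y : (BTensor k A V W ⊗[k] U) ⊗[k] T,
      ((incl k A V W).rTensor (U ⊗[k] T)) (TensorProduct.assoc k _ _ _ y) =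
      TensorProduct.assoc k _ _ _ ((((incl k A V W).rTensor U).rTensor T) y) := by
    intro y
    exact congr($(TensorProduct.ext_threefold
      (g := ((incl k A V W).rTensor (U ⊗[k] T)) ∘ₗ (TensorProduct.assoc k _ _ _).toLinearMap)
      (h := (TensorProduct.assoc k _ _ _).toLinearMap ∘ₗ (((incl k A V W).rTensor U).rTensor T))
      (fun _ _ _ => by simp)) y)
  have p : ∀ y : ((V ⊗[k] W) ⊗[k] U) ⊗[k] T,
      (TensorProduct.assoc k W U T).toLinearMap.lTensor V (TensorProduct.assoc k _ _ _
        ((TensorProduct.assoc k V W U).toLinearMap.rTensor T y)) =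
      TensorProduct.assoc k _ _ _ (TensorProduct.assoc k _ _ _ y) := by
    intro y
    exact congr($(TensorProduct.ext_fourfold
      (g := (TensorProduct.assoc k W U T).toLinearMap.lTensor V ∘ₗ
        (TensorProduct.assoc k _ _ _).toLinearMap ∘ₗ
        ((TensorProduct.assoc k V W U).toLinearMap.rTensor T))
      (h := (TensorProduct.assoc k _ _ _).toLinearMap ∘ₗ
        (TensorProduct.assoc k _ _ _).toLinearMap)
      (fun _ _ _ _ => by simp)) y)
  trans TensorProduct.assoc k _ _ _ (TensorProduct.assoc k _ _ _
    (((incl k A V W).rTensor U).rTensor T ((incl k A (BTensor k A V W) U).rTensor T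
      (incl k A _ T q))))
  · have e1 : incl4 k A V W U T (map k A (LinearMap.id : V →ₗ[A] V) (assoc k A W U T).toLinearMap
        (assoc k A V (BTensor k A W U) T
          (map k A (assoc k A V W U).toLinearMap (LinearMap.id : T →ₗ[A] T) q))) =
        (TensorProduct.assoc k W U T).toLinearMap.lTensor V
          ((((incl k A W U).rTensor T).lTensor V) (incl3R k A V (BTensor k A W U) T
            (assoc k A V (BTensor k A W U) T
              (map k A (assoc k A V W U).toLinearMap (LinearMap.id : T →ₗ[A] T) q)))) := by
      simp only [incl4, incl3R, LinearMap.comp_apply, incl_map]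
      simp only [LinearMap.lTensor, TensorProduct.map_map]
      congr 2
    rw [e1, incl3R_assoc, incl3L, LinearMap.comp_apply, LinearMap.comp_apply, LinearEquiv.coe_coe,
      b1, ← p]
    congr 2
    simp only [incl_map, LinearMap.rTensor, LinearMap.lTensor, TensorProduct.map_map]
    congr 2
  · have e1 : incl4 k A V W U T (assoc k A V W (BTensor k A U T) (assoc k A (BTensor k A V W) U T q)) =
        (((incl k A U T).lTensor W).lTensor V) (incl3R k A V W (BTensor k A U T)
          (assoc k A V W (BTensor k A U T) (assoc k A (BTensor k A V W) U T q))) := by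
      simp only [incl4, incl3R, LinearMap.comp_apply, LinearMap.lTensor, TensorProduct.map_map,
        LinearMap.id_comp]
    rw [e1, incl3R_assoc, incl3L, LinearMap.comp_apply, LinearMap.comp_apply, LinearEquiv.coe_coe,
      b2]
    congr 1
    rw [← b3]
    have e2 := incl3R_assoc k A (BTensor k A V W) U T q
    simp only [incl3R, incl3L, LinearMap.comp_apply, LinearEquiv.coe_coe] at e2
    rw [← e2]
    simp only [LinearMap.rTensor, LinearMap.lTensor, TensorProduct.map_map, LinearMap.id_comp,
      LinearMap.comp_id]

end BTensor

/-- The unit object of the category of representations: the image of `epsL`. -/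
def BUnit : Type u := LinearMap.range (epsL k (A := A))

namespace BUnit

noncomputable instance : AddCommGroup (BUnit k A) :=
  inferInstanceAs (AddCommGroup (LinearMap.range (epsL k (A := A))))

noncomputable instance : Module k (BUnit k A) :=
  inferInstanceAs (Module k (LinearMap.range (epsL k (A := A))))

instance [FiniteDimensional k A] : FiniteDimensional k (BUnit k A) :=
  inferInstanceAs (FiniteDimensional k (LinearMap.range (epsL k (A := A))))

/-- The inclusion of the image of `epsL`. -/
noncomputable def incl : BUnit k A →ₗ[k] A := Submodule.subtype _

/-- The projection onto the image of `epsL`. -/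
noncomputable def proj : A →ₗ[k] BUnit k A := LinearMap.rangeRestrict _

theorem incl_proj (x : A) : incl k A (proj k A x) = epsL k x := rfl

theorem incl_injective : Function.Injective (incl k A) := Subtype.val_injective

theorem epsL_incl (y : BUnit k A) : epsL k (incl k A y) = incl k A y := by
  obtain ⟨_, x, rfl⟩ := y
  exact epsL_epsL k x

theorem proj_incl (y : BUnit k A) : proj k A (incl k A y) = y :=
  incl_injective k A (epsL_incl k A y)

/-- The action `a • y = ε(1₁ a y) 1₂`. -/
noncomputable instance : SMul A (BUnit k A) where
  smul a y := proj k A (a * incl k A y)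

theorem smul_def (a : A) (y : BUnit k A) : a • y = proj k A (a * incl k A y) := rfl

theorem incl_smul (a : A) (y : BUnit k A) : incl k A (a • y) = epsL k (a * incl k A y) := rfl

theorem proj_mul (a x : A) : proj k A (a * x) = a • proj k A x := by
  apply incl_injective
  rw [incl_smul, incl_proj, incl_proj, epsL_mul_epsL]

noncomputable instance : Module A (BUnit k A) where
  one_smul y := by rw [smul_def, one_mul, proj_incl]
  mul_smul a b y := by
    apply incl_injective
    rw [incl_smul, incl_smul, incl_smul, epsL_mul_epsL, mul_assoc]
  smul_zero a := by rw [smul_def]; simp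
  zero_smul y := by rw [smul_def]; simp
  smul_add a y z := by simp only [smul_def, map_add, mul_add]
  add_smul a b y := by simp only [smul_def, map_add, add_mul]

instance : IsScalarTower k A (BUnit k A) where
  smul_assoc c a y := by simp only [smul_def, map_smul, smul_mul_assoc]

end BUnit

namespace BTensor

/-- The map `x ⊗ v ↦ x v` on the tensor product with the unit object. -/
noncomputable def actL : BUnit k A ⊗[k] V →ₗ[k] V :=
  TensorProduct.lift ((Algebra.lsmul k k V).toLinearMap ∘ₗ BUnit.incl k A)

/-- The map `v ⊗ y ↦ εR(y) v` on the tensor product with the unit object. -/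
noncomputable def actR : V ⊗[k] BUnit k A →ₗ[k] V :=
  TensorProduct.lift ((Algebra.lsmul k k V).toLinearMap ∘ₗ epsR k ∘ₗ BUnit.incl k A).flip

variable {V W U} {V' W'}

theorem actL_tmul (x : BUnit k A) (v : V) : actL k A V (x ⊗ₜ[k] v) = BUnit.incl k A x • v := by
  simp [actL]

theorem actR_tmul (x : BUnit k A) (v : V) :
    actR k A V (v ⊗ₜ[k] x) = epsR k (BUnit.incl k A x) • v := by
  simp [actR]

theorem actL_rho (a : A) (x : BUnit k A ⊗[k] V) :
    actL k A V (rho k A _ V (comul (R := k) a) x) = a • actL k A V x := by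
  induction x using TensorProduct.induction_on with
  | zero => simp
  | add x y hx hy => simp only [map_add, hx, hy, smul_add]
  | tmul x v =>
    have h : ∀ t : A ⊗[k] A, actL k A V (rho k A _ V t (x ⊗ₜ[k] v)) =
        contL k (BUnit.incl k A x) (comul (R := k) (1 : A) * t) • v := by
      intro t
      induction t using TensorProduct.induction_on with
      | zero => simp
      | add a b ha hb => simp only [map_add, LinearMap.add_apply, ha, hb, mul_add, add_smul]
      | tmul a b =>
        rw [rho_tmul_tmul, actL_tmul, BUnit.incl_smul, ← mul_smul, epsL_mul_mul]
    rw [h, comul_one_mul, contL_comul, BUnit.epsL_incl, actL_tmul, mul_smul]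

theorem actR_rho (a : A) (x : V ⊗[k] BUnit k A) :
    actR k A V (rho k A V _ (comul (R := k) a) x) = a • actR k A V x := by
  induction x using TensorProduct.induction_on with
  | zero => simp
  | add x y hx hy => simp only [map_add, hx, hy, smul_add]
  | tmul v x =>
    have h : ∀ t : A ⊗[k] A, actR k A V (rho k A V _ t (v ⊗ₜ[k] x)) =
        contR k (BUnit.incl k A x) (comul (R := k) (1 : A) * t) • v := by
      intro t
      induction t using TensorProduct.induction_on with
      | zero => simp
      | add a b ha hb => simp only [map_add, LinearMap.add_apply, ha, hb, mul_add, add_smul]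
      | tmul a b =>
        rw [rho_tmul_tmul, actR_tmul, BUnit.incl_smul, ← mul_smul, epsR_epsL, epsR_mul_mul]
    rw [h, comul_one_mul, contR_comul, actR_tmul, mul_smul]

theorem rho_one_smul (y : BUnit k A) (v : V) (w : W) :
    rho k A V W (comul (R := k) (1 : A)) (v ⊗ₜ[k] (BUnit.incl k A y • w)) =
      rho k A V W (comul (R := k) (1 : A)) ((epsR k (BUnit.incl k A y) • v) ⊗ₜ[k] w) := by
  have h1 : v ⊗ₜ[k] (BUnit.incl k A y • w) =
      rho k A V W ((1 : A) ⊗ₜ[k] epsL k (BUnit.incl k A y)) (v ⊗ₜ[k] w) := by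
    rw [rho_tmul_tmul, one_smul, BUnit.epsL_incl]
  have h2 : (epsR k (BUnit.incl k A y) • v) ⊗ₜ[k] w =
      rho k A V W (epsR k (BUnit.incl k A y) ⊗ₜ[k] (1 : A)) (v ⊗ₜ[k] w) := by
    rw [rho_tmul_tmul, one_smul]
  rw [h1, h2, ← Module.End.mul_apply, ← Module.End.mul_apply, ← map_mul, ← map_mul,
    comul_mul_epsL]

theorem epsR_smul_one (y : BUnit k A) :
    epsR k (BUnit.incl k A y) • BUnit.proj k A 1 = y := by
  rw [← BUnit.proj_mul, mul_one]
  apply BUnit.incl_injective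
  have := epsL_mul_epsR k 1 (BUnit.incl k A y)
  rw [one_mul, one_mul, BUnit.epsL_incl] at this
  rw [BUnit.incl_proj, this]

theorem smul_one (y : BUnit k A) : BUnit.incl k A y • BUnit.proj k A 1 = y := by
  rw [← BUnit.proj_mul, mul_one, BUnit.proj_incl]

variable (V)

/-- The left unitor `x ⊗ v ↦ x v`. -/
noncomputable def leftUnitor : BTensor k A (BUnit k A) V ≃ₗ[A] V where
  toFun u := actL k A V (incl k A _ V u)
  invFun v := proj k A _ V (BUnit.proj k A 1 ⊗ₜ[k] v)
  map_add' u v := by simp only [map_add]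
  map_smul' a u := by rw [incl_smul, actL_rho]; rfl
  left_inv u := by
    have h : ∀ x : BUnit k A ⊗[k] V,
        proj k A _ V (BUnit.proj k A 1 ⊗ₜ[k] actL k A V x) = proj k A _ V x := by
      intro x
      induction x using TensorProduct.induction_on with
      | zero => simp
      | add x y hx hy => simp only [map_add, tmul_add, hx, hy]
      | tmul y v =>
        apply incl_injective
        rw [incl_proj, incl_proj, actL_tmul, rho_one_smul, epsR_smul_one]
    beta_reduce
    rw [h, proj_incl]
  right_inv v := by
    beta_reduce
    rw [incl_proj, actL_rho, one_smul, actL_tmul, BUnit.incl_proj, epsL_one, one_smul]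

/-- The right unitor `v ⊗ y ↦ εR(y) v`. -/
noncomputable def rightUnitor : BTensor k A V (BUnit k A) ≃ₗ[A] V where
  toFun u := actR k A V (incl k A V _ u)
  invFun v := proj k A V _ (v ⊗ₜ[k] BUnit.proj k A 1)
  map_add' u v := by simp only [map_add]
  map_smul' a u := by rw [incl_smul, actR_rho]; rfl
  left_inv u := by
    have h : ∀ x : V ⊗[k] BUnit k A,
        proj k A V _ (actR k A V x ⊗ₜ[k] BUnit.proj k A 1) = proj k A V _ x := by
      intro x
      induction x using TensorProduct.induction_on with
      | zero => simp
      | add x y hx hy => simp only [map_add, add_tmul, hx, hy]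
      | tmul v y =>
        apply incl_injective
        rw [incl_proj, incl_proj, actR_tmul, ← rho_one_smul, smul_one]
    beta_reduce
    rw [h, proj_incl]
  right_inv v := by
    beta_reduce
    rw [incl_proj, actR_rho, one_smul, actR_tmul, BUnit.incl_proj, epsL_one, epsR_one, one_smul]

variable {V}

theorem leftUnitor_apply (u : BTensor k A (BUnit k A) V) :
    leftUnitor k A V u = actL k A V (incl k A _ V u) := rfl

theorem rightUnitor_apply (u : BTensor k A V (BUnit k A)) :
    rightUnitor k A V u = actR k A V (incl k A V _ u) := rfl

theorem leftUnitor_naturality (f : V →ₗ[A] V') (u : BTensor k A (BUnit k A) V) :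
    leftUnitor k A V' (map k A (LinearMap.id : BUnit k A →ₗ[A] BUnit k A) f u) =
      f (leftUnitor k A V u) := by
  rw [leftUnitor_apply, leftUnitor_apply, incl_map]
  induction incl k A _ V u using TensorProduct.induction_on with
  | zero => simp
  | add x y hx hy => simp only [map_add, hx, hy]
  | tmul y v => simp [actL_tmul]

theorem rightUnitor_naturality (f : V →ₗ[A] V') (u : BTensor k A V (BUnit k A)) :
    rightUnitor k A V' (map k A f (LinearMap.id : BUnit k A →ₗ[A] BUnit k A) u) =
      f (rightUnitor k A V u) := by
  rw [rightUnitor_apply, rightUnitor_apply, incl_map]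
  induction incl k A V _ u using TensorProduct.induction_on with
  | zero => simp
  | add x y hx hy => simp only [map_add, hx, hy]
  | tmul y v => simp [actR_tmul]

variable (V W)

theorem triangle (u : BTensor k A (BTensor k A V (BUnit k A)) W) :
    map k A (LinearMap.id : V →ₗ[A] V) (leftUnitor k A W).toLinearMap (assoc k A V _ W u) =
      map k A (rightUnitor k A V).toLinearMap (LinearMap.id : W →ₗ[A] W) u := by
  apply incl_injective
  rw [← rho_one_incl, ← rho_one_incl k A V W (map k A (rightUnitor k A V).toLinearMap _ u)]
  have e1 : incl k A V W (map k A (LinearMap.id : V →ₗ[A] V) (leftUnitor k A W).toLinearMap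
      (assoc k A V _ W u)) = (actL k A W).lTensor V (incl3R k A V (BUnit k A) W
        (assoc k A V _ W u)) := by
    rw [incl_map, incl3R, LinearMap.comp_apply, ← LinearMap.lTensor_comp_apply]
    rfl
  have e2 : incl k A V W (map k A (rightUnitor k A V).toLinearMap
      (LinearMap.id : W →ₗ[A] W) u) =
      (actR k A V).rTensor W ((incl k A V (BUnit k A)).rTensor W (incl k A _ W u)) := by
    rw [incl_map, ← LinearMap.rTensor_comp_apply]
    rfl
  rw [e1, e2, incl3R_assoc, incl3L, LinearMap.comp_apply, LinearMap.comp_apply,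
    LinearEquiv.coe_coe]
  generalize (incl k A V (BUnit k A)).rTensor W (incl k A _ W u) = y
  induction y using TensorProduct.induction_on with
  | zero => simp
  | add x y hx hy => simp only [map_add, hx, hy]
  | tmul y w =>
    induction y using TensorProduct.induction_on with
    | zero => simp
    | add x y hx hy => simp only [map_add, add_tmul, hx, hy]
    | tmul v y =>
      rw [TensorProduct.assoc_tmul, LinearMap.lTensor_tmul, LinearMap.rTensor_tmul, actL_tmul,
        actR_tmul, rho_one_smul]

end BTensor
end RepTensor

section Category
open CategoryTheory MonoidalCategory TensorProduct

universe u

/-- A finite-dimensional representation (left module) of a `k`-algebra. -/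
structure FDRep (k A : Type u) [Field k] [Ring A] [Algebra k A] where
  carrier : Type u
  [addCommGroup : AddCommGroup carrier]
  [moduleBase : Module k carrier]
  [module : Module A carrier]
  [isScalarTower : IsScalarTower k A carrier]
  [finiteDimensional : FiniteDimensional k carrier]

namespace FDRep

attribute [instance] FDRep.addCommGroup FDRep.moduleBase FDRep.module FDRep.isScalarTower
  FDRep.finiteDimensional

variable {k A : Type u} [Field k] [Ring A] [Algebra k A]

/-- A morphism of representations. -/
@[ext]
structure Hom (V W : FDRep k A) where
  lin : V.carrier →ₗ[A] W.carrier

instance : Category (FDRep k A) where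
  Hom := Hom
  id V := ⟨LinearMap.id⟩
  comp f g := ⟨g.lin ∘ₗ f.lin⟩

@[ext]
theorem hom_ext {V W : FDRep k A} {f g : V ⟶ W} (h : f.lin = g.lin) : f = g := Hom.ext h

@[simp] theorem id_lin (V : FDRep k A) : Hom.lin (𝟙 V) = LinearMap.id := rfl
@[simp] theorem comp_lin {U V W : FDRep k A} (f : U ⟶ V) (g : V ⟶ W) :
    (f ≫ g).lin = g.lin ∘ₗ f.lin := rfl

/-- The isomorphism given by an invertible module map. -/
def isoMk {V W : FDRep k A} (e : V.carrier ≃ₗ[A] W.carrier) : V ≅ W where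
  hom := ⟨e.toLinearMap⟩
  inv := ⟨e.symm.toLinearMap⟩
  hom_inv_id := by ext; simp
  inv_hom_id := by ext; simp

@[simp] theorem isoMk_hom_lin {V W : FDRep k A} (e : V.carrier ≃ₗ[A] W.carrier) :
    (isoMk e).hom.lin = e.toLinearMap := rfl

variable [WeakBialgebra k A] [FiniteDimensional k A]

/-- The tensor product `V ⊠ W`, the unit object `Aˡ`, and the associator and unitors. -/
noncomputable instance : MonoidalCategoryStruct (FDRep k A) where
  tensorObj V W := ⟨BTensor k A V.carrier W.carrier⟩
  tensorHom f g := ⟨BTensor.map k A f.lin g.lin⟩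
  whiskerLeft _ _ _ g := ⟨BTensor.map k A LinearMap.id g.lin⟩
  whiskerRight f _ := ⟨BTensor.map k A f.lin LinearMap.id⟩
  tensorUnit := ⟨BUnit k A⟩
  associator V W U := isoMk (BTensor.assoc k A V.carrier W.carrier U.carrier)
  leftUnitor V := isoMk (BTensor.leftUnitor k A V.carrier)
  rightUnitor V := isoMk (BTensor.rightUnitor k A V.carrier)

/-- The monoidal structure on the category of finite-dimensional representations of a weak
bialgebra. -/
noncomputable instance : MonoidalCategory (FDRep k A) :=
  MonoidalCategory.ofTensorHom
    (id_tensorHom_id := fun _ _ => hom_ext (BTensor.map_id k A))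
    (id_tensorHom := fun _ _ _ _ => rfl)
    (tensorHom_id := fun _ _ => rfl)
    (tensorHom_comp_tensorHom := fun f₁ f₂ g₁ g₂ =>
      hom_ext (BTensor.map_comp k A f₁.lin f₂.lin g₁.lin g₂.lin).symm)
    (associator_naturality := fun f₁ f₂ f₃ =>
      hom_ext (LinearMap.ext fun q => BTensor.assoc_naturality k A f₁.lin f₂.lin f₃.lin q))
    (leftUnitor_naturality := fun f =>
      hom_ext (LinearMap.ext fun q => BTensor.leftUnitor_naturality k A f.lin q))
    (rightUnitor_naturality := fun f =>
      hom_ext (LinearMap.ext fun q => BTensor.rightUnitor_naturality k A f.lin q))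
    (pentagon := fun V W U T => hom_ext (LinearMap.ext fun q =>
      BTensor.pentagon k A V.carrier W.carrier U.carrier T.carrier q))
    (triangle := fun V W => hom_ext (LinearMap.ext fun q =>
      BTensor.triangle k A V.carrier W.carrier q))

end FDRep
end Category

section Main
open CategoryTheory MonoidalCategory Limits

universe v u

attribute [local instance] Abelian.hasBinaryBiproducts

section
variable (k : Type v) {C : Type u} [Field k] [IsAlgClosed k] [Category.{v} C] [Abelian C]
    [Linear k C] [MonoidalCategory C] [MonoidalPreadditive C] [MonoidalLinear k C]
    [RigidCategory C] [IsFusionCategory k C] (a : PivotalStructure C) (I : Irr C)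

/-- The functor `J` from the Drinfeld center to the representations of the tube algebra. -/
noncomputable def J : Center C ⥤ FDRep k (Tube k I) where
  obj Z := ⟨JObj k a I Z⟩
  map f := ⟨JObj.map k a I f⟩
  map_id Z := by
    apply FDRep.hom_ext
    refine LinearMap.ext fun s => funext fun x => ?_
    exact Category.comp_id (s x)
  map_comp f g := by
    apply FDRep.hom_ext
    refine LinearMap.ext fun s => funext fun x => ?_
    exact (Category.assoc (s x) f.f g.f).symm

end

/-- The object `(z, c_{-,z})` of the Drinfeld center of a braided monoidal category with
braiding `c`. -/
def centerObj {C : Type u} [Category.{v} C] [MonoidalCategory C] [BraidedCategory C] (z : C) :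
    Center C where
  fst := z
  snd :=
    { β := fun U => (β_ U z).symm
      monoidal := fun U U' => by simp
      naturality := fun f => by simp }

theorem gam_centerObj {C : Type u} [Category.{v} C] [MonoidalCategory C] [BraidedCategory C]
    (z w : C) : gam (centerObj z) w = (β_ w z).hom := rfl

/-- A pivotal fusion category is a Fibonacci category, with nontrivial simple object `ν` of
dimension `φ`, if up to isomorphism its simple objects are `𝟙` and `ν` and these are not
isomorphic, the fusion rule `ν ⊗ ν ≅ 𝟙 ⊕ ν` holds, and the composite
`𝟙 ⟶ ν ⊗ νᴸ ⟶ 𝟙` of the coevaluation and the pivotal evaluation is `φ`. -/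
structure IsFibonacci (k : Type v) {C : Type u} [Field k] [Category.{v} C] [Abelian C]
    [Linear k C] [MonoidalCategory C] [RigidCategory C] (a : PivotalStructure C)
    (ν : C) (φ : k) : Prop where
  simple : Simple ν
  not_iso : IsEmpty (ν ≅ 𝟙_ C)
  iso_of_simple : ∀ X : C, Simple X → Nonempty (X ≅ 𝟙_ C) ∨ Nonempty (X ≅ ν)
  fusion : Nonempty (ν ⊗ ν ≅ 𝟙_ C ⊞ ν)
  dim : η_ ν (lDual ν) ≫ a.cap (lPairing ν) = φ • 𝟙 (𝟙_ C)

end Main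

end TubeAlg

open CategoryTheory MonoidalCategory TubeAlg

universe u

/-! A monoidal structure on `J` contains an isomorphism J(z) ⊠ J(z) ≅ J(z ⊗ z). Whatever the weak
bialgebra structure is, the left side is a subspace of J(z) ⊗ J(z), so its dimension is at most (dim
J(z))² (`BTensor.finrank_le`). The space J(z) = ⨁ₓ C(x, z) depends only on the underlying object of
z, and its dimension is the number of simple summands of that object: 1 for ν, and 2 for ν ⊗ ν ≅ 𝟙 ⊕
ν. As 1 · 1 < 2, there is no such isomorphism (`J_isEmpty_monoidal`). The obstruction is purely one
of dimensions; the action of the tube algebra and the half-braidings play no role in it.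

The remaining and longer task is to produce, for either root φ, a braided pivotal Fibonacci
category. It is built by hand as `Fib D`: an object is a finite set whose elements are coloured by 𝟙
or ν, and a morphism is a matrix that preserves colours. The tensor product has the underlying set X
× Y × Bool, the Boolean being the colour of the summand. Triples that the fusion rules forbid remain
in the set but are dead: they have colour `none`, and all matrices vanish on them. The price is an
identity matrix that vanishes at dead elements; the gain is that all structure morphisms are indexed
by plain products.

The data are an associator whose only nontrivial block is the 2 × 2 matrix `G`, for three copies of
ν with total colour ν, and a braiding that acts on ν ⊗ ν by r² on 𝟙 and by r on ν. The off-diagonal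
entries of `G` are normalised to 1 and ψ, where a unitary normalisation would need a square root of
ψ = φ⁻¹. Pentagon, triangle and hexagons are then finite checks over colours, which use only ψ² = 1
- ψ and r² = -ψr - 1.

Every object is its own dual, and the transposed morphism is the transposed matrix, so the double
dual functor is the identity on objects and morphisms. Its tensor structure is trivial as well
(`rrTensor_eq`), so identities form a pivotal structure, for which ν has dimension 1 + ψ = φ. That
the category is abelian follows from its equivalence with pairs of finite-dimensional vector spaces
(`toVect`). -/

section FibonacciCategory

/-! ### Coloured finite sets and colour-preserving matrices -/

/-- The scalars from which the associator and the braiding of a Fibonacci category are built: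
`ψ = φ⁻¹ = φ - 1` and the eigenvalue `r` of the braiding on the summand `ν` of `ν ⊗ ν`. -/
structure FibParams (k : Type u) [Field k] where
  ψ : k
  r : k
  ψ_sq : ψ ^ 2 = 1 - ψ
  r_sq : r ^ 2 = -(ψ * r) - 1

variable {k : Type u} [Field k]

/-- An object of the Fibonacci category: a finite set of elements, each of which stands for a copy
of the unit object (`some false`), a copy of `ν` (`some true`) or for nothing (`none`). -/
structure Fib (D : FibParams k) : Type (u + 1) where
  T : Type u
  [fintype : Fintype T]
  [decEq : DecidableEq T]
  c : T → Option Bool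

namespace Fib

attribute [instance] Fib.fintype Fib.decEq

variable {D : FibParams k}

/-- The matrices that vanish outside the pairs of elements of equal colour. -/
def homSub (X Y : Fib D) : Submodule k (X.T → Y.T → k) where
  carrier := {f | ∀ x y, ¬ (X.c x = Y.c y ∧ (X.c x).isSome = true) → f x y = 0}
  add_mem' {f g} hf hg x y h := by simp [hf x y h, hg x y h]
  zero_mem' := fun x y _ => rfl
  smul_mem' a f hf x y h := by simp [hf x y h]

/-- Elements without a colour have to behave like zero objects, so the identity matrix vanishes on
them. The unit laws still hold because every morphism vanishes on them too. -/
instance : Category.{u} (Fib D) where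
  Hom X Y := homSub X Y
  id X := ⟨fun x y => if x = y ∧ (X.c x).isSome = true then 1 else 0, fun x y h =>
    if_neg fun e => h ⟨congrArg X.c e.1, e.2⟩⟩
  comp {X Y Z} f g := ⟨fun x z => ∑ y, f.1 x y * g.1 y z, fun x z h => by
    refine Finset.sum_eq_zero fun y _ => ?_
    by_cases h1 : X.c x = Y.c y ∧ (X.c x).isSome = true
    · rw [g.2 y z (by rwa [← h1.1]), mul_zero]
    · rw [f.2 x y h1, zero_mul]⟩
  id_comp {X Y} f := by
    refine Subtype.ext (funext fun x => funext fun y => ?_)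
    change ∑ z, (if x = z ∧ (X.c x).isSome = true then (1 : k) else 0) * f.1 z y = f.1 x y
    by_cases h : (X.c x).isSome = true
    · simp [h]
    · rw [f.2 x y fun e => h e.2]
      simp [h]
  comp_id {X Y} f := by
    refine Subtype.ext (funext fun x => funext fun y => ?_)
    change ∑ z, f.1 x z * (if z = y ∧ (Y.c z).isSome = true then (1 : k) else 0) = f.1 x y
    by_cases h : (Y.c y).isSome = true
    · rw [Finset.sum_eq_single y] <;> simp_all
    · rw [f.2 x y fun e => h (e.1 ▸ e.2)]
      refine Finset.sum_eq_zero fun z _ => ?_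
      rw [if_neg, mul_zero]
      rintro ⟨rfl, e⟩
      exact h e
  assoc f g h := by
    refine Subtype.ext (funext fun x => funext fun y => ?_)
    simp only [Finset.sum_mul, Finset.mul_sum]
    rw [Finset.sum_comm]
    simp only [mul_assoc]

/-- A morphism from a matrix. -/
def mk' {X Y : Fib D} (f : X.T → Y.T → k)
    (hf : ∀ x y, f x y ≠ 0 → X.c x = Y.c y ∧ (X.c x).isSome = true) : X ⟶ Y :=
  ⟨f, fun x y h => by_contra fun e => h (hf x y e)⟩

/-- The `(x, y)` entry of a morphism. -/
def entry {X Y : Fib D} (f : X ⟶ Y) (x : X.T) (y : Y.T) : k := f.1 x y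

@[simp] theorem entry_mk' {X Y : Fib D} (f : X.T → Y.T → k) (hf) (x : X.T) (y : Y.T) :
    entry (mk' (X := X) (Y := Y) f hf) x y = f x y := rfl

theorem entry_eq_zero {X Y : Fib D} (f : X ⟶ Y) {x : X.T} {y : Y.T}
    (h : ¬ (X.c x = Y.c y ∧ (X.c x).isSome = true)) : entry f x y = 0 := f.2 x y h

@[ext] theorem hom_ext {X Y : Fib D} {f g : X ⟶ Y} (h : ∀ x y, entry f x y = entry g x y) :
    f = g :=
  Subtype.ext (funext fun x => funext fun y => h x y)

theorem entry_id (X : Fib D) (x y : X.T) :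
    entry (𝟙 X) x y = if x = y ∧ (X.c x).isSome = true then 1 else 0 := rfl

theorem entry_comp {X Y Z : Fib D} (f : X ⟶ Y) (g : Y ⟶ Z) (x : X.T) (z : Z.T) :
    entry (f ≫ g) x z = ∑ y, entry f x y * entry g y z := rfl

instance : Preadditive (Fib D) where
  homGroup X Y := inferInstanceAs (AddCommGroup (homSub X Y))
  add_comp X Y Z f f' g := by
    refine hom_ext fun x z => ?_
    change ∑ y, (f.1 x y + f'.1 x y) * g.1 y z = ∑ y, f.1 x y * g.1 y z + ∑ y, f'.1 x y * g.1 y z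
    rw [← Finset.sum_add_distrib]
    exact Finset.sum_congr rfl fun y _ => add_mul _ _ _
  comp_add X Y Z f g g' := by
    refine hom_ext fun x z => ?_
    change ∑ y, f.1 x y * (g.1 y z + g'.1 y z) = ∑ y, f.1 x y * g.1 y z + ∑ y, f.1 x y * g'.1 y z
    rw [← Finset.sum_add_distrib]
    exact Finset.sum_congr rfl fun y _ => mul_add _ _ _

instance : Linear k (Fib D) where
  homModule X Y := inferInstanceAs (Module k (homSub X Y))
  smul_comp X Y Z a f g := by
    refine hom_ext fun x z => ?_
    change ∑ y, (a * f.1 x y) * g.1 y z = a * ∑ y, f.1 x y * g.1 y z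
    simp only [Finset.mul_sum, mul_assoc]
  comp_smul X Y Z f a g := by
    refine hom_ext fun x z => ?_
    change ∑ y, f.1 x y * (a * g.1 y z) = a * ∑ y, f.1 x y * g.1 y z
    simp only [Finset.mul_sum, mul_left_comm]

@[simp] theorem entry_add {X Y : Fib D} (f g : X ⟶ Y) (x : X.T) (y : Y.T) :
    entry (f + g) x y = entry f x y + entry g x y := rfl
@[simp] theorem entry_zero {X Y : Fib D} (x : X.T) (y : Y.T) :
    entry (0 : X ⟶ Y) x y = 0 := rfl
@[simp] theorem entry_smul {X Y : Fib D} (a : k) (f : X ⟶ Y) (x : X.T) (y : Y.T) :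
    entry (a • f) x y = a * entry f x y := rfl

theorem entry_sum {X Y : Fib D} {α : Type*} (s : Finset α) (f : α → (X ⟶ Y)) (x : X.T) (y : Y.T) :
    entry (∑ i ∈ s, f i) x y = ∑ i ∈ s, entry (f i) x y := by
  induction s using Finset.cons_induction with
  | empty => rfl
  | cons a s ha ih => rw [Finset.sum_cons, Finset.sum_cons, entry_add, ih]

instance (X Y : Fib D) : FiniteDimensional k (X ⟶ Y) :=
  inferInstanceAs (FiniteDimensional k (homSub X Y))

/-! ### Morphisms as operators on functions -/

/-- The action of a morphism on functions, by which morphisms are compared below. -/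
def act {X Y : Fib D} (f : X ⟶ Y) (v : Y.T → k) (x : X.T) : k := ∑ y, entry f x y * v y

/-- Indicator functions recover the entries of a matrix. The point of this form is that a structure
morphism acts by a short formula (at most two terms for associators, unitors and swaps), so a
composite can be evaluated by rewriting from the outside in, without expanding sums over
intermediate sets. -/
theorem act_ext {X Y : Fib D} {f g : X ⟶ Y} (h : ∀ v x, act f v x = act g v x) : f = g := by
  refine hom_ext fun x y => ?_
  simpa [act, Pi.single_apply] using h (Pi.single y 1) x

theorem act_comp {X Y Z : Fib D} (f : X ⟶ Y) (g : Y ⟶ Z) (v : Z.T → k) (x : X.T) :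
    act (f ≫ g) v x = act f (act g v) x := by
  simp only [act, entry_comp, Finset.sum_mul, Finset.mul_sum]
  rw [Finset.sum_comm]
  simp only [mul_assoc]

theorem act_id (X : Fib D) (v : X.T → k) (x : X.T) :
    act (𝟙 X) v x = if (X.c x).isSome = true then v x else 0 := by
  by_cases h : (X.c x).isSome = true <;> simp [act, entry_id, h]

theorem act_add {X Y : Fib D} (f g : X ⟶ Y) (v : Y.T → k) (x : X.T) :
    act (f + g) v x = act f v x + act g v x := by
  simp [act, add_mul, Finset.sum_add_distrib]

theorem act_smul {X Y : Fib D} (a : k) (f : X ⟶ Y) (v : Y.T → k) (x : X.T) :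
    act (a • f) v x = a * act f v x := by
  simp [act, Finset.mul_sum, mul_assoc]

theorem act_zero_hom {X Y : Fib D} (v : Y.T → k) (x : X.T) :
    act (0 : X ⟶ Y) v x = 0 := by
  simp [act]

theorem act_add_fun {X Y : Fib D} (f : X ⟶ Y) (v w : Y.T → k) (x : X.T) :
    act f (fun y => v y + w y) x = act f v x + act f w x := by
  simp [act, mul_add, Finset.sum_add_distrib]

theorem act_mul_fun {X Y : Fib D} (f : X ⟶ Y) (a : k) (v : Y.T → k) (x : X.T) :
    act f (fun y => a * v y) x = a * act f v x := by
  simp [act, Finset.mul_sum, mul_left_comm]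

theorem act_zero_fun {X Y : Fib D} (f : X ⟶ Y) (x : X.T) :
    act f (fun _ => 0) x = 0 := by
  simp [act]

theorem act_ite_fun {X Y : Fib D} (f : X ⟶ Y) (p : Prop) [Decidable p] (v : Y.T → k) (x : X.T) :
    act f (fun y => if p then v y else 0) x = if p then act f v x else 0 := by
  split_ifs <;> simp [act]

/-- Functions of the colour may be evaluated before or after a morphism acts. -/
theorem act_colour {X Y : Fib D} (f : X ⟶ Y) (v : Option Bool → Y.T → k) (x : X.T) :
    act f (fun y => v (Y.c y) y) x = act f (v (X.c x)) x := by
  refine Finset.sum_congr rfl fun y _ => ?_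
  by_cases h : X.c x = Y.c y ∧ (X.c x).isSome = true
  · rw [h.1]
  · rw [entry_eq_zero f h, zero_mul, zero_mul]

/-! ### Fusion rules, associator and tensor product -/

/-- The fusion rules: whether `m` occurs in the tensor product of `a` and `b`. -/
def N : Option Bool → Option Bool → Bool → Bool
  | some false, some b, m => m == b
  | some true, some false, m => m
  | some true, some true, _ => true
  | _, _, _ => false

/-- The colour of the element `m` in the tensor product of elements of colours `a` and `b`. -/
def col (a b : Option Bool) (m : Bool) : Option Bool := if N a b m = true then some m else none

/-- The nontrivial block of the associator. -/
def G (ψ : k) : Bool → Bool → k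
  | false, false => ψ
  | false, true => 1
  | true, false => ψ
  | true, true => -ψ

/-- The entries of the associator. -/
def F (ψ : k) (a b c : Option Bool) (l m n : Bool) : k :=
  if N (col a b m) c l = true ∧ N a (col b c n) l = true then
    (if a = some true ∧ b = some true ∧ c = some true ∧ l = true then G ψ m n else 1) else 0

/-- The entries of the inverse of the associator. -/
def Finv (ψ : k) (a b c : Option Bool) (l n m : Bool) : k :=
  if N (col a b m) c l = true ∧ N a (col b c n) l = true then
    (if a = some true ∧ b = some true ∧ c = some true ∧ l = true then G ψ n m else 1) else 0

/-- The tensor product of two objects. -/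
@[reducible] def tens (X Y : Fib D) : Fib D where
  T := X.T × Y.T × Bool
  c p := col (X.c p.1) (Y.c p.2.1) p.2.2

theorem col_eq_some {a b : Option Bool} {m : Bool} (h : N a b m = true) : col a b m = some m :=
  if_pos h

theorem isSome_col {a b : Option Bool} {m : Bool} : (col a b m).isSome = N a b m := by
  unfold col
  split_ifs with h <;> simp [h]

/-- The tensor product of two morphisms. -/
def tensMap {X X' Y Y' : Fib D} (f : X ⟶ X') (g : Y ⟶ Y') : tens X Y ⟶ tens X' Y' :=
  mk' (fun p q => if p.2.2 = q.2.2 ∧ N (X.c p.1) (Y.c p.2.1) p.2.2 = true then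
    entry f p.1 q.1 * entry g p.2.1 q.2.1 else 0) fun ⟨x, y, m⟩ ⟨x', y', m'⟩ h => by
      dsimp only at h
      split_ifs at h with e
      · have h1 := not_imp_comm.1 (entry_eq_zero f) (left_ne_zero_of_mul h)
        have h2 := not_imp_comm.1 (entry_eq_zero g) (right_ne_zero_of_mul h)
        obtain ⟨rfl, e⟩ := e
        refine ⟨?_, ?_⟩
        · simp only [h1.1, h2.1]
        · dsimp only
          rw [isSome_col, e]
      · exact absurd rfl h

/-- The associator. -/
def assocHom (X Y Z : Fib D) : tens (tens X Y) Z ⟶ tens X (tens Y Z) :=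
  mk' (fun p q => if p.1.1 = q.1 ∧ p.1.2.1 = q.2.1.1 ∧ p.2.1 = q.2.1.2.1 ∧ p.2.2 = q.2.2 then
    F D.ψ (X.c p.1.1) (Y.c p.1.2.1) (Z.c p.2.1) p.2.2 p.1.2.2 q.2.1.2.2 else 0)
    fun ⟨⟨x, y, m⟩, z, l⟩ ⟨x', ⟨y', z', n⟩, l'⟩ h => by
      dsimp only at h
      split_ifs at h with e
      · obtain ⟨rfl, rfl, rfl, rfl⟩ := e
        unfold F at h
        split_ifs at h with e <;> try exact absurd rfl h
        all_goals
          dsimp only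
          rw [col_eq_some e.1, col_eq_some e.2]
          exact ⟨rfl, rfl⟩
      · exact absurd rfl h

/-- The inverse of the associator. -/
def assocInv (X Y Z : Fib D) : tens X (tens Y Z) ⟶ tens (tens X Y) Z :=
  mk' (fun q p => if p.1.1 = q.1 ∧ p.1.2.1 = q.2.1.1 ∧ p.2.1 = q.2.1.2.1 ∧ p.2.2 = q.2.2 then
    Finv D.ψ (X.c q.1) (Y.c q.2.1.1) (Z.c q.2.1.2.1) q.2.2 q.2.1.2.2 p.1.2.2 else 0)
    fun ⟨x', ⟨y', z', n⟩, l'⟩ ⟨⟨x, y, m⟩, z, l⟩ h => by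
      dsimp only at h
      split_ifs at h with e
      · obtain ⟨rfl, rfl, rfl, rfl⟩ := e
        unfold Finv at h
        split_ifs at h with e <;> try exact absurd rfl h
        all_goals
          dsimp only
          rw [col_eq_some e.1, col_eq_some e.2]
          exact ⟨rfl, rfl⟩
      · exact absurd rfl h

/-- The unit object. -/
@[reducible] def one : Fib D where
  T := PUnit
  c _ := some false

/-- The left unitor. -/
def leftUnitorHom (X : Fib D) : tens one X ⟶ X :=
  mk' (fun p x => if p.2.1 = x ∧ X.c p.2.1 = some p.2.2 then 1 else 0) fun ⟨_, y, m⟩ x h => by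
    dsimp only at h
    split_ifs at h with e <;> try exact absurd rfl h
    obtain ⟨rfl, e⟩ := e
    simp [e, col, N]

/-- The inverse of the left unitor. -/
def leftUnitorInv (X : Fib D) : X ⟶ tens one X :=
  mk' (fun x p => if p.2.1 = x ∧ X.c p.2.1 = some p.2.2 then 1 else 0) fun x ⟨_, y, m⟩ h => by
    dsimp only at h
    split_ifs at h with e <;> try exact absurd rfl h
    obtain ⟨rfl, e⟩ := e
    simp [e, col, N]

/-- The summand of a ⊗ 𝟙 has the colour of a, so the Boolean in `tens X one` carries no information.
The unitors are partial bijections for this reason. -/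
theorem N_one (a : Option Bool) (m : Bool) : N a (some false) m = true ↔ a = some m := by
  revert a m; decide

theorem N_one' (a : Option Bool) (m : Bool) : N (some false) a m = true ↔ a = some m := by
  revert a m; decide

/-- The right unitor. -/
def rightUnitorHom (X : Fib D) : tens X one ⟶ X :=
  mk' (fun p x => if p.1 = x ∧ X.c p.1 = some p.2.2 then 1 else 0) fun ⟨y, _, m⟩ x h => by
    dsimp only at h
    split_ifs at h with e <;> try exact absurd rfl h
    obtain ⟨rfl, e⟩ := e
    simp [e, col, N_one]

/-- The inverse of the right unitor. -/
def rightUnitorInv (X : Fib D) : X ⟶ tens X one :=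
  mk' (fun x p => if p.1 = x ∧ X.c p.1 = some p.2.2 then 1 else 0) fun x ⟨y, _, m⟩ h => by
    dsimp only at h
    split_ifs at h with e <;> try exact absurd rfl h
    obtain ⟨rfl, e⟩ := e
    simp [e, col, N_one]

/-- The fusion condition is read off at the source only; where the entries of `f` and `g` are
nonzero, the colours at the target are the same. -/
theorem act_tensMap {X X' Y Y' : Fib D} (f : X ⟶ X') (g : Y ⟶ Y') (v : (tens X' Y').T → k)
    (p : (tens X Y).T) :
    act (tensMap f g) v p = if N (X.c p.1) (Y.c p.2.1) p.2.2 = true then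
      act f (fun x' => act g (fun y' => v (x', y', p.2.2)) p.2.1) p.1 else 0 := by
  simp only [act, tensMap, entry_mk']
  change ∑ q : X'.T × Y'.T × Bool, _ = _
  simp only [Fintype.sum_prod_type]
  by_cases h : N (X.c p.1) (Y.c p.2.1) p.2.2 = true
  · simp [h, Finset.mul_sum, mul_assoc]
  · simp [h]

theorem act_assocHom (X Y Z : Fib D) (v : (tens X (tens Y Z)).T → k) (p : (tens (tens X Y) Z).T) :
    act (assocHom X Y Z) v p =
      F D.ψ (X.c p.1.1) (Y.c p.1.2.1) (Z.c p.2.1) p.2.2 p.1.2.2 false *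
        v (p.1.1, (p.1.2.1, p.2.1, false), p.2.2) +
      F D.ψ (X.c p.1.1) (Y.c p.1.2.1) (Z.c p.2.1) p.2.2 p.1.2.2 true *
        v (p.1.1, (p.1.2.1, p.2.1, true), p.2.2) := by
  simp only [act, assocHom, entry_mk']
  change ∑ q : X.T × (Y.T × Z.T × Bool) × Bool, _ = _
  simp [Fintype.sum_prod_type, ite_and, add_comm]

theorem act_assocInv (X Y Z : Fib D) (v : (tens (tens X Y) Z).T → k) (p : (tens X (tens Y Z)).T) :
    act (assocInv X Y Z) v p =
      Finv D.ψ (X.c p.1) (Y.c p.2.1.1) (Z.c p.2.1.2.1) p.2.2 p.2.1.2.2 false *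
        v ((p.1, p.2.1.1, false), p.2.1.2.1, p.2.2) +
      Finv D.ψ (X.c p.1) (Y.c p.2.1.1) (Z.c p.2.1.2.1) p.2.2 p.2.1.2.2 true *
        v ((p.1, p.2.1.1, true), p.2.1.2.1, p.2.2) := by
  simp only [act, assocInv, entry_mk']
  change ∑ q : (X.T × Y.T × Bool) × Z.T × Bool, _ = _
  simp [Fintype.sum_prod_type, ite_and, add_comm]

theorem act_leftUnitorHom (X : Fib D) (v : X.T → k) (p : (tens one X).T) :
    act (leftUnitorHom X) v p = if X.c p.2.1 = some p.2.2 then v p.2.1 else 0 := by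
  simp only [act, leftUnitorHom, entry_mk', ite_and]
  simp

theorem act_rightUnitorHom (X : Fib D) (v : X.T → k) (p : (tens X one).T) :
    act (rightUnitorHom X) v p = if X.c p.1 = some p.2.2 then v p.1 else 0 := by
  simp only [act, rightUnitorHom, entry_mk', ite_and]
  simp

theorem act_leftUnitorInv (X : Fib D) (v : (tens one X).T → k) (x : X.T) :
    act (leftUnitorInv X) v x = (if X.c x = some false then v (PUnit.unit, x, false) else 0) +
      if X.c x = some true then v (PUnit.unit, x, true) else 0 := by
  simp only [act, leftUnitorInv, entry_mk']
  change ∑ q : PUnit × X.T × Bool, _ = _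
  simp [Fintype.sum_prod_type, ite_and, Finset.sum_add_distrib, add_comm]

theorem act_rightUnitorInv (X : Fib D) (v : (tens X one).T → k) (x : X.T) :
    act (rightUnitorInv X) v x = (if X.c x = some false then v (x, PUnit.unit, false) else 0) +
      if X.c x = some true then v (x, PUnit.unit, true) else 0 := by
  simp only [act, rightUnitorInv, entry_mk']
  change ∑ q : X.T × PUnit × Bool, _ = _
  simp [Fintype.sum_prod_type, ite_and, Finset.sum_add_distrib, add_comm]

/-! ### Functoriality and naturality -/

theorem tensMap_id (X Y : Fib D) : tensMap (𝟙 X) (𝟙 Y) = 𝟙 (tens X Y) := by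
  refine act_ext fun v ⟨x, y, m⟩ => ?_
  rw [act_tensMap, act_id, act_id, act_id]
  dsimp only
  rw [isSome_col]
  have h : ∀ a b m, N a b m = true → a.isSome = true ∧ b.isSome = true := by decide
  by_cases h1 : N (X.c x) (Y.c y) m = true
  · rw [if_pos h1, if_pos h1, if_pos (h _ _ _ h1).1, if_pos (h _ _ _ h1).2]
  · rw [if_neg h1, if_neg h1]

theorem act_comm {X X' Y Y' : Fib D} (f : X ⟶ X') (g : Y ⟶ Y') (v : X'.T → Y'.T → k)
    (x : X.T) (y : Y.T) :
    act f (fun x' => act g (fun y' => v x' y') y) x =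
      act g (fun y' => act f (fun x' => v x' y') x) y := by
  simp only [act, Finset.mul_sum]
  rw [Finset.sum_comm]
  simp only [mul_left_comm]

theorem act_colour' {X Y : Fib D} (f : X ⟶ Y) (φ : Option Bool → k) (v : Y.T → k) (x : X.T) :
    act f (fun y => φ (Y.c y) * v y) x = φ (X.c x) * act f v x := by
  rw [act_colour f (fun c y => φ c * v y), act_mul_fun]

theorem act_colour_ite {X Y : Fib D} (f : X ⟶ Y) (p : Option Bool → Prop) [DecidablePred p]
    (v : Y.T → k) (x : X.T) :
    act f (fun y => if p (Y.c y) then v y else 0) x = if p (X.c x) then act f v x else 0 := by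
  rw [act_colour f (fun c y => if p c then v y else 0), act_ite_fun]

/-- The fusion condition at the middle objects depends on colours alone, so it can be moved to the
source, where it no longer interferes with the interchange of the two independent sums. -/
theorem tensMap_comp {X₁ Y₁ Z₁ X₂ Y₂ Z₂ : Fib D} (f₁ : X₁ ⟶ Y₁) (f₂ : X₂ ⟶ Y₂) (g₁ : Y₁ ⟶ Z₁)
    (g₂ : Y₂ ⟶ Z₂) : tensMap f₁ f₂ ≫ tensMap g₁ g₂ = tensMap (f₁ ≫ g₁) (f₂ ≫ g₂) := by
  refine act_ext fun v ⟨x, y, m⟩ => ?_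
  simp only [act_comp, act_tensMap]
  -- `act_colour` is applied to one factor at a time: first the colour of x' is replaced by that of
  -- x, and after an exchange of the two actions the colour of y' by that of y.
  rw [act_colour f₁ (fun c x' => act f₂ (fun y' => if N c (Y₂.c y') m = true then
    act g₁ (fun x'' => act g₂ (fun y'' => v (x'', y'', m)) y') x' else 0) y)]
  rw [act_comm, act_colour f₂ (fun c y' => act f₁ (fun x' => if N (X₁.c x) c m = true then
    act g₁ (fun x'' => act g₂ (fun y'' => v (x'', y'', m)) y') x' else 0) x)]
  split_ifs
  · rw [act_comm]
    refine congrArg (fun v => act f₁ v x) (funext fun x' => ?_)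
    rw [act_comm]
  · rfl

theorem F_eq_zero (ψ : k) {a b c : Option Bool} {l m n : Bool}
    (h : ¬ (N (col a b m) c l = true ∧ N a (col b c n) l = true)) : F ψ a b c l m n = 0 :=
  if_neg h

theorem F_eq_zero_left (ψ : k) {a b c : Option Bool} {l m n : Bool}
    (h : ¬ (N (col a b m) c l = true ∧ N a b m = true)) : F ψ a b c l m n = 0 := by
  refine F_eq_zero ψ fun e => h ⟨e.1, by_contra fun h' => ?_⟩
  rw [col, if_neg h'] at e
  exact absurd e.1 (by simp [N])

/-- An entry of the associator already vanishes when its target tree is not allowed, so it absorbs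
the two conditions that come from `act_tensMap` for the nested tensor product. `F_eq_zero_left`
plays this role for the source tree. -/
theorem F_mul_ite (ψ : k) (a b c : Option Bool) (l m n : Bool) (x : k) :
    (F ψ a b c l m n * if N a (col b c n) l = true then if N b c n = true then x else 0 else 0) =
      F ψ a b c l m n * x := by
  by_cases h : N a (col b c n) l = true
  · by_cases h' : N b c n = true
    · rw [if_pos h, if_pos h']
    · exfalso
      rw [col, if_neg h'] at h
      revert h
      cases a with
      | none => simp [N]
      | some a => cases a <;> simp [N]
  · rw [if_neg h, F_eq_zero ψ fun e => h e.2, zero_mul, zero_mul]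

/-- This is `act_colour` in three variables. The coefficients of the associator depend on the
colours only, hence commute with f, g and h; this is the content of its naturality. -/
theorem act_act_act_colour {X X' Y Y' Z Z' : Fib D} (f : X ⟶ X') (g : Y ⟶ Y') (h : Z ⟶ Z')
    (φ : Option Bool → Option Bool → Option Bool → k) (v : X'.T → Y'.T → Z'.T → k) (x : X.T)
    (y : Y.T) (z : Z.T) :
    act f (fun x' => act g (fun y' => act h (fun z' =>
      φ (X'.c x') (Y'.c y') (Z'.c z') * v x' y' z') z) y) x =
    φ (X.c x) (Y.c y) (Z.c z) * act f (fun x' => act g (fun y' => act h (v x' y') z) y) x := by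
  rw [act_colour f (fun c x' => act g (fun y' => act h (fun z' =>
      φ c (Y'.c y') (Z'.c z') * v x' y' z') z) y), ← act_mul_fun]
  refine congrArg (fun v => act f v x) (funext fun x' => ?_)
  rw [act_colour g (fun c y' => act h (fun z' => φ _ c (Z'.c z') * v x' y' z') z), ← act_mul_fun]
  refine congrArg (fun v => act g v y) (funext fun y' => ?_)
  rw [act_colour' h (φ _ _)]

theorem assoc_naturality {X X' Y Y' Z Z' : Fib D} (f : X ⟶ X') (g : Y ⟶ Y') (h : Z ⟶ Z') :
    tensMap (tensMap f g) h ≫ assocHom X' Y' Z' =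
      assocHom X Y Z ≫ tensMap f (tensMap g h) := by
  refine act_ext fun v ⟨⟨x, y, m⟩, z, l⟩ => ?_
  simp only [act_comp, act_tensMap, act_assocHom, act_ite_fun, F_mul_ite]
  simp only [act_add_fun]
  rw [act_act_act_colour f g h (fun a b c => F D.ψ a b c l m false),
    act_act_act_colour f g h (fun a b c => F D.ψ a b c l m true), ← ite_and]
  split_ifs with e
  · rfl
  · rw [F_eq_zero_left _ e, F_eq_zero_left _ e, zero_mul, zero_mul, add_zero]

/-- The matrix `G` is its own inverse: the diagonal entries of its square are ψ² + ψ = 1, and the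
others cancel. -/
theorem assoc_hom_inv (X Y Z : Fib D) : assocHom X Y Z ≫ assocInv X Y Z = 𝟙 _ := by
  refine act_ext fun v ⟨⟨x, y, m⟩, z, l⟩ => ?_
  simp only [act_comp, act_assocHom, act_assocInv, act_id, isSome_col]
  have hψ := D.ψ_sq
  -- The value at m is expressed by the values at both Booleans, so that these can be made into free
  -- scalars before the case distinction on m.
  have hv : v ((x, y, m), z, l) = cond m (v ((x, y, true), z, l)) (v ((x, y, false), z, l)) := by
    cases m <;> rfl
  rw [hv]
  generalize v ((x, y, true), z, l) = v₁, v ((x, y, false), z, l) = v₂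
  generalize X.c x = a, Y.c y = b, Z.c z = c
  rcases a with _ | a <;> [skip; cases a] <;> (rcases b with _ | b <;> [skip; cases b]) <;>
    (rcases c with _ | c <;> [skip; cases c]) <;> cases l <;> cases m <;>
    simp [F, Finv, N, col, G]
  · linear_combination v₂ * hψ
  · linear_combination v₁ * hψ

theorem assoc_inv_hom (X Y Z : Fib D) : assocInv X Y Z ≫ assocHom X Y Z = 𝟙 _ := by
  refine act_ext fun v ⟨x, ⟨y, z, m⟩, l⟩ => ?_
  simp only [act_comp, act_assocHom, act_assocInv, act_id, isSome_col]
  have hψ := D.ψ_sq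
  have hv : v (x, (y, z, m), l) = cond m (v (x, (y, z, true), l)) (v (x, (y, z, false), l)) := by
    cases m <;> rfl
  rw [hv]
  generalize v (x, (y, z, true), l) = v₁, v (x, (y, z, false), l) = v₂
  generalize X.c x = a, Y.c y = b, Z.c z = c
  rcases a with _ | a <;> [skip; cases a] <;> (rcases b with _ | b <;> [skip; cases b]) <;>
    (rcases c with _ | c <;> [skip; cases c]) <;> cases l <;> cases m <;>
    simp [F, Finv, N, col, G]
  · linear_combination v₂ * hψ
  · linear_combination v₁ * hψ

/-! ### Monoidal structure and coherence -/

instance : MonoidalCategoryStruct (Fib D) where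
  tensorObj := tens
  tensorHom := tensMap
  whiskerLeft X _ _ g := tensMap (𝟙 X) g
  whiskerRight f Y := tensMap f (𝟙 Y)
  tensorUnit := one
  associator X Y Z := ⟨assocHom X Y Z, assocInv X Y Z, assoc_hom_inv X Y Z, assoc_inv_hom X Y Z⟩
  leftUnitor X := ⟨leftUnitorHom X, leftUnitorInv X, by
    refine act_ext fun v ⟨i, x, m⟩ => ?_
    simp only [act_comp, act_leftUnitorHom, act_leftUnitorInv, act_id, isSome_col, N_one']
    cases m <;> split_ifs <;> simp_all, by
    refine act_ext fun v x => ?_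
    simp only [act_comp, act_leftUnitorHom, act_leftUnitorInv, act_id]
    rcases X.c x with _ | m <;> [skip; cases m] <;> simp⟩
  rightUnitor X := ⟨rightUnitorHom X, rightUnitorInv X, by
    refine act_ext fun v ⟨x, i, m⟩ => ?_
    simp only [act_comp, act_rightUnitorHom, act_rightUnitorInv, act_id, isSome_col, N_one]
    cases m <;> split_ifs <;> simp_all, by
    refine act_ext fun v x => ?_
    simp only [act_comp, act_rightUnitorHom, act_rightUnitorInv, act_id]
    rcases X.c x with _ | m <;> [skip; cases m] <;> simp⟩

/-- The four values of v are the coordinates over the trees of shape w(x(yz)) with fixed total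
colour l. When one of the objects has colour 𝟙, both sides involve the same block of the associator;
a relation for ψ is needed only for four copies of ν. -/
theorem pentagon (W X Y Z : Fib D) :
    tensMap (assocHom W X Y) (𝟙 Z) ≫ assocHom W (tens X Y) Z ≫ tensMap (𝟙 W) (assocHom X Y Z) =
      assocHom (tens W X) Y Z ≫ assocHom W X (tens Y Z) := by
  refine act_ext fun v ⟨⟨⟨w, x, m⟩, y, n⟩, z, l⟩ => ?_
  simp only [act_comp, act_tensMap, act_assocHom, act_id]
  generalize v (w, (x, (y, z, false), false), l) = v₁, v (w, (x, (y, z, true), false), l) = v₂,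
    v (w, (x, (y, z, false), true), l) = v₃, v (w, (x, (y, z, true), true), l) = v₄
  generalize W.c w = a, X.c x = b, Y.c y = c, Z.c z = d
  have hψ := D.ψ_sq
  rcases a with _ | a <;> [skip; cases a] <;> (rcases b with _ | b <;> [skip; cases b]) <;>
    (rcases c with _ | c <;> [skip; cases c]) <;> (rcases d with _ | d <;> [skip; cases d]) <;>
    cases l <;> cases m <;> cases n <;> simp [F, N, col, G]
  · linear_combination v₃ * hψ
  · linear_combination v₄ * hψ
  · linear_combination v₄ * hψ
  · ring
  · linear_combination (D.ψ * v₃ - D.ψ * v₄) * hψ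

/-- With 𝟙 in the middle the block `G` never occurs: all entries of the associator are 0 or 1. -/
theorem triangle (X Y : Fib D) :
    assocHom X one Y ≫ tensMap (𝟙 X) (leftUnitorHom Y) = tensMap (rightUnitorHom X) (𝟙 Y) := by
  refine act_ext fun v ⟨⟨x, i, m⟩, y, l⟩ => ?_
  simp only [act_comp, act_tensMap, act_assocHom, act_leftUnitorHom, act_rightUnitorHom, act_id]
  generalize X.c x = a, Y.c y = b
  rcases a with _ | a <;> [skip; cases a] <;> (rcases b with _ | b <;> [skip; cases b]) <;>
    cases l <;> cases m <;> simp [F, N, col]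

theorem leftUnitor_naturality {X Y : Fib D} (f : X ⟶ Y) :
    tensMap (𝟙 one) f ≫ leftUnitorHom Y = leftUnitorHom X ≫ f := by
  refine act_ext fun v ⟨i, x, m⟩ => ?_
  simp only [act_comp, act_tensMap, act_leftUnitorHom, act_id, N_one', Option.isSome_some, if_true]
  rw [act_colour_ite f (fun c => c = some m)]
  split_ifs <;> rfl

theorem rightUnitor_naturality {X Y : Fib D} (f : X ⟶ Y) :
    tensMap f (𝟙 one) ≫ rightUnitorHom Y = rightUnitorHom X ≫ f := by
  refine act_ext fun v ⟨x, i, m⟩ => ?_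
  simp only [act_comp, act_tensMap, act_rightUnitorHom, act_id, N_one, Option.isSome_some, if_true]
  rw [act_colour_ite f (fun c => c = some m)]
  split_ifs <;> rfl

instance : MonoidalCategory (Fib D) :=
  MonoidalCategory.ofTensorHom
    (id_tensorHom_id := tensMap_id)
    (id_tensorHom := fun _ _ _ _ => rfl)
    (tensorHom_id := fun _ _ => rfl)
    (tensorHom_comp_tensorHom := tensMap_comp)
    (associator_naturality := assoc_naturality)
    (leftUnitor_naturality := leftUnitor_naturality)
    (rightUnitor_naturality := rightUnitor_naturality)
    (pentagon := pentagon)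
    (triangle := triangle)

instance : MonoidalPreadditive (Fib D) where
  whiskerLeft_zero {X Y Z} := by
    refine act_ext fun v p => ?_
    change act (tensMap (𝟙 X) (0 : Y ⟶ Z)) v p = _
    simp [act_tensMap, act_zero_hom, act_zero_fun]
  zero_whiskerRight {X Y Z} := by
    refine act_ext fun v p => ?_
    change act (tensMap (0 : Y ⟶ Z) (𝟙 X)) v p = _
    simp [act_tensMap, act_zero_hom]
  whiskerLeft_add {X Y Z} f g := by
    refine act_ext fun v p => ?_
    rw [act_add]
    change act (tensMap (𝟙 X) (f + g)) v p = act (tensMap (𝟙 X) f) v p + act (tensMap (𝟙 X) g) v p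
    simp only [act_tensMap, act_add, act_add_fun]
    split_ifs <;> simp
  add_whiskerRight {X Y Z} f g := by
    refine act_ext fun v p => ?_
    rw [act_add]
    change act (tensMap (f + g) (𝟙 X)) v p = act (tensMap f (𝟙 X)) v p + act (tensMap g (𝟙 X)) v p
    simp only [act_tensMap, act_add]
    split_ifs <;> simp

instance : MonoidalLinear k (Fib D) where
  whiskerLeft_smul X Y Z r f := by
    refine act_ext fun v p => ?_
    rw [act_smul]
    change act (tensMap (𝟙 X) (r • f)) v p = r * act (tensMap (𝟙 X) f) v p
    simp only [act_tensMap, act_smul, act_mul_fun]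
    split_ifs <;> simp
  smul_whiskerRight r Y Z f X := by
    refine act_ext fun v p => ?_
    rw [act_smul]
    change act (tensMap (r • f) (𝟙 X)) v p = r * act (tensMap f (𝟙 X)) v p
    simp only [act_tensMap, act_smul]
    split_ifs <;> simp

/-! ### Braiding -/

/-- The eigenvalues of the braiding. -/
def R (r : k) (a b : Option Bool) (m : Bool) : k :=
  if N a b m = true then
    if a = some true ∧ b = some true then cond m r (r ^ 2) else 1
  else 0

theorem N_comm (a b : Option Bool) (m : Bool) : N a b m = N b a m := by
  revert a b m; decide

theorem col_comm (a b : Option Bool) (m : Bool) : col a b m = col b a m := by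
  rw [col, col, N_comm]

/-- The multiple of the interchange of the factors with the given coefficients. -/
def swap (φ : Option Bool → Option Bool → Bool → k) (X Y : Fib D) : tens X Y ⟶ tens Y X :=
  mk' (fun p q => if p.1 = q.2.1 ∧ p.2.1 = q.1 ∧ p.2.2 = q.2.2 ∧
    N (X.c p.1) (Y.c p.2.1) p.2.2 = true then φ (X.c p.1) (Y.c p.2.1) p.2.2 else 0)
    fun ⟨x, y, m⟩ ⟨y', x', m'⟩ h => by
      dsimp only at h
      split_ifs at h with e
      · obtain ⟨rfl, rfl, rfl, e⟩ := e
        exact ⟨col_comm _ _ _, by rw [isSome_col, e]⟩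
      · exact absurd rfl h

theorem act_swap (φ : Option Bool → Option Bool → Bool → k) (X Y : Fib D) (v : (tens Y X).T → k)
    (p : (tens X Y).T) :
    act (swap φ X Y) v p = if N (X.c p.1) (Y.c p.2.1) p.2.2 = true then
      φ (X.c p.1) (Y.c p.2.1) p.2.2 * v (p.2.1, p.1, p.2.2) else 0 := by
  simp only [act, swap, entry_mk']
  change ∑ q : Y.T × X.T × Bool, _ = _
  obtain ⟨x, y, m⟩ := p
  cases m <;> simp [Fintype.sum_prod_type, ite_and]

/-- As for the associator, the coefficients depend on the colours only, so no condition on φ is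
required. -/
theorem swap_naturality {X X' Y Y' : Fib D} (φ : Option Bool → Option Bool → Bool → k)
    (f : X ⟶ X') (g : Y ⟶ Y') :
    tensMap f g ≫ swap φ X' Y' = swap φ X Y ≫ tensMap g f := by
  refine act_ext fun v ⟨x, y, m⟩ => ?_
  simp only [act_comp, act_tensMap, act_swap]
  rw [act_colour f (fun c x' => act g (fun y' => if N c (Y'.c y') m = true then
    φ c (Y'.c y') m * v (y', x', m) else 0) y), act_comm,
    act_colour g (fun c y' => act f (fun x' => if N (X.c x) c m = true then
    φ (X.c x) c m * v (y', x', m) else 0) x)]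
  simp only [act_ite_fun, act_mul_fun]
  rw [N_comm (Y.c y)]
  split_ifs <;> rfl

theorem swap_comp (φ χ : Option Bool → Option Bool → Bool → k)
    (h : ∀ a b m, N a b m = true → φ a b m * χ b a m = 1) (X Y : Fib D) :
    swap φ X Y ≫ swap χ Y X = 𝟙 (tens X Y) := by
  refine act_ext fun v ⟨x, y, m⟩ => ?_
  simp only [act_comp, act_swap, act_id, isSome_col]
  rw [N_comm (Y.c y)]
  split_ifs with e
  · rw [← mul_assoc, h _ _ _ e, one_mul]
  · rfl

theorem r_ne_zero (D : FibParams k) : D.r ≠ 0 := by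
  intro h
  have := D.r_sq
  rw [h] at this
  simp at this

theorem R_ne_zero (D : FibParams k) (a b : Option Bool) (m : Bool) (h : N a b m = true) :
    R D.r a b m ≠ 0 := by
  have := r_ne_zero D
  rw [R, if_pos h]
  split_ifs
  · cases m <;> simpa
  · exact one_ne_zero

theorem R_comm (r : k) (a b : Option Bool) (m : Bool) : R r a b m = R r b a m := by
  unfold R
  simp only [N_comm b a, and_comm]

/-- Together with `r_pow_four` and the equation for r² itself, these are the relations that the
entries of the hexagon impose on r. They hold since r² + ψr + 1 = 0 and ψ² + ψ = 1 make r⁵ equal to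
-1. -/
theorem r_pow_three (D : FibParams k) : D.r ^ 3 = D.ψ - D.ψ * D.r := by
  linear_combination (D.r - D.ψ) * D.r_sq + D.r * D.ψ_sq

theorem r_pow_four (D : FibParams k) : D.r ^ 4 = D.r + D.ψ := by
  linear_combination D.r * r_pow_three D - D.ψ * D.r_sq + D.r * D.ψ_sq

/-- The nontrivial content lies in three copies of ν. For total colour ν it is the matrix identity G
· diag(1, r) · G = diag(r², r) · G · diag(r², r), whose entries amount to the formulas for r², r³
and r⁴. -/
theorem hexagon_forward (X Y Z : Fib D) :
    assocHom X Y Z ≫ swap (R D.r) X (tens Y Z) ≫ assocHom Y Z X =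
      tensMap (swap (R D.r) X Y) (𝟙 Z) ≫ assocHom Y X Z ≫ tensMap (𝟙 Y) (swap (R D.r) X Z) := by
  refine act_ext fun v ⟨⟨x, y, m⟩, z, l⟩ => ?_
  simp only [act_comp, act_tensMap, act_assocHom, act_swap, act_id]
  generalize v (y, (z, x, false), l) = v₁, v (y, (z, x, true), l) = v₂
  generalize X.c x = a, Y.c y = b, Z.c z = c
  have hr := D.r_sq
  rcases a with _ | a <;> [skip; cases a] <;> (rcases b with _ | b <;> [skip; cases b]) <;>
    (rcases c with _ | c <;> [skip; cases c]) <;> cases l <;> cases m <;> simp [F, N, col, G, R]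
  -- For total colour 𝟙 the hexagon only says that the eigenvalue on 𝟙 is the square of the
  -- eigenvalue r on ν.
  · ring
  · linear_combination (-D.ψ * v₁) * r_pow_four D - v₂ * r_pow_three D
  · linear_combination (-D.ψ * v₁) * r_pow_three D + D.ψ * v₂ * hr

/-- Because `G` is its own inverse, the inverse associators have the same coefficients as the
associators, and the equations to be checked are those of `hexagon_forward`. -/
theorem hexagon_reverse (X Y Z : Fib D) :
    assocInv X Y Z ≫ swap (R D.r) (tens X Y) Z ≫ assocInv Z X Y =
      tensMap (𝟙 X) (swap (R D.r) Y Z) ≫ assocInv X Z Y ≫ tensMap (swap (R D.r) X Z) (𝟙 Y) := by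
  refine act_ext fun v ⟨x, ⟨y, z, m⟩, l⟩ => ?_
  simp only [act_comp, act_tensMap, act_assocInv, act_swap, act_id]
  generalize v ((z, x, false), y, l) = v₁, v ((z, x, true), y, l) = v₂
  generalize X.c x = a, Y.c y = b, Z.c z = c
  have hr := D.r_sq
  rcases a with _ | a <;> [skip; cases a] <;> (rcases b with _ | b <;> [skip; cases b]) <;>
    (rcases c with _ | c <;> [skip; cases c]) <;> cases l <;> cases m <;> simp [Finv, N, col, G, R]
  · ring
  · linear_combination (-D.ψ * v₁) * r_pow_four D - v₂ * r_pow_three D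
  · linear_combination (-D.ψ * v₁) * r_pow_three D + D.ψ * v₂ * hr

instance : BraidedCategory (Fib D) where
  braiding X Y := ⟨swap (R D.r) X Y, swap (fun a b m => (R D.r a b m)⁻¹) Y X,
    swap_comp _ _ (fun a b m h => by
      rw [R_comm D.r b a, mul_inv_cancel₀ (R_ne_zero D a b m h)]) X Y,
    swap_comp _ _ (fun a b m h => by
      rw [R_comm D.r b a, inv_mul_cancel₀ (R_ne_zero D a b m h)]) Y X⟩
  braiding_naturality_right X _ _ f := swap_naturality (R D.r) (𝟙 X) f
  braiding_naturality_left f Z := swap_naturality (R D.r) f (𝟙 Z)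
  hexagon_forward := hexagon_forward
  hexagon_reverse := hexagon_reverse

/-! ### Duality -/

/-- The dimension of a simple object. -/
def dim (ψ : k) (a : Option Bool) : k := if a = some true then 1 + ψ else 1

/-- The coevaluation of the self-dual object `X`. -/
def coev (X : Fib D) : one ⟶ tens X X :=
  mk' (fun _ p => if p.1 = p.2.1 ∧ p.2.2 = false ∧ (X.c p.1).isSome = true then 1 else 0)
    fun _ ⟨x, y, m⟩ h => by
      dsimp only at h
      split_ifs at h with e
      · obtain ⟨rfl, rfl, e⟩ := e
        obtain ⟨a, ha⟩ := Option.isSome_iff_exists.1 e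
        cases a <;> simp [ha, col, N]
      · exact absurd rfl h

/-- The evaluation of the self-dual object `X`. -/
def ev (X : Fib D) : tens X X ⟶ one :=
  mk' (fun p _ => if p.1 = p.2.1 ∧ p.2.2 = false ∧ (X.c p.1).isSome = true then
    dim D.ψ (X.c p.1) else 0) fun ⟨x, y, m⟩ _ h => by
      dsimp only at h
      split_ifs at h with e
      · obtain ⟨rfl, rfl, e⟩ := e
        obtain ⟨a, ha⟩ := Option.isSome_iff_exists.1 e
        cases a <;> simp [ha, col, N]
      · exact absurd rfl h

theorem act_coev (X : Fib D) (v : (tens X X).T → k) (i : (one : Fib D).T) :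
    act (coev X) v i = ∑ x, if (X.c x).isSome = true then v (x, x, false) else 0 := by
  simp only [act, coev, entry_mk']
  change ∑ q : X.T × X.T × Bool, _ = _
  simp [Fintype.sum_prod_type, ite_and]

theorem act_ev (X : Fib D) (v : (one : Fib D).T → k) (p : (tens X X).T) :
    act (ev X) v p = if p.1 = p.2.1 ∧ p.2.2 = false ∧ (X.c p.1).isSome = true then
      dim D.ψ (X.c p.1) * v PUnit.unit else 0 := by
  simp only [act, ev, entry_mk']
  change ∑ q : PUnit, _ = _
  simp

/-- On ν the zigzag is multiplication by the entry ψ of `G` at the trivial channels times the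
coefficient 1 + ψ of the evaluation, and ψ(1 + ψ) = 1. Thus the coevaluation can have coefficients 1
if the evaluation carries the whole dimension. -/
theorem coev_ev (X : Fib D) :
    tensMap (𝟙 X) (coev X) ≫ assocInv X X X ≫ tensMap (ev X) (𝟙 X) =
      rightUnitorHom X ≫ leftUnitorInv X := by
  refine act_ext fun v ⟨x, i, m⟩ => ?_
  simp only [act_comp, act_tensMap, act_assocInv, act_coev, act_ev, act_id, act_rightUnitorHom,
    act_leftUnitorInv]
  have hψ := D.ψ_sq
  -- The coevaluation is a sum over all y, but the evaluation pairs an element only with itself.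
  rw [Finset.sum_eq_single x]
  · have hv : v (PUnit.unit, x, m) = cond m (v (PUnit.unit, x, true)) (v (PUnit.unit, x, false)) := by
      cases m <;> rfl
    rw [hv]
    generalize v (PUnit.unit, x, true) = v₁, v (PUnit.unit, x, false) = v₂
    generalize X.c x = a
    rcases a with _ | a <;> [skip; cases a] <;> cases m <;> simp [Finv, N, col, G, dim]
    linear_combination v₁ * hψ
  · intro y _ hy
    simp [hy.symm]
  · simp

theorem ev_coev (X : Fib D) :
    tensMap (coev X) (𝟙 X) ≫ assocHom X X X ≫ tensMap (𝟙 X) (ev X) =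
      leftUnitorHom X ≫ rightUnitorInv X := by
  refine act_ext fun v ⟨i, x, m⟩ => ?_
  simp only [act_comp, act_tensMap, act_assocHom, act_coev, act_ev, act_id, act_leftUnitorHom,
    act_rightUnitorInv]
  have hψ := D.ψ_sq
  rw [Finset.sum_eq_single x]
  · have hv : v (x, PUnit.unit, m) = cond m (v (x, PUnit.unit, true)) (v (x, PUnit.unit, false)) := by
      cases m <;> rfl
    rw [hv]
    generalize v (x, PUnit.unit, true) = v₁, v (x, PUnit.unit, false) = v₂
    generalize X.c x = a
    rcases a with _ | a <;> [skip; cases a] <;> cases m <;> simp [F, N, col, G, dim]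
    linear_combination v₁ * hψ
  · intro y _ hy
    simp [hy]
  · simp

/-- Every object is its own dual. -/
@[reducible] def pairing (X : Fib D) : ExactPairing X X where
  coevaluation' := coev X
  evaluation' := ev X
  coevaluation_evaluation' := coev_ev X
  evaluation_coevaluation' := ev_coev X

/-- Both duals are the object itself with the same pairing, so that X, `rDual X`, `lDual X` and
`rDual (rDual X)` agree by definition. The identifications below rely on this. -/
instance : RigidCategory (Fib D) where
  rightDual X := { rightDual := X, exact := pairing X }
  leftDual X := { leftDual := X, exact := pairing X }

/-! ### Transposes and the pivotal structure -/

/-- The transpose of a matrix. -/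
def tr {X Y : Fib D} (f : X ⟶ Y) : Y ⟶ X :=
  mk' (fun y x => entry f x y) fun y x h => by
    have h1 := not_imp_comm.1 (entry_eq_zero f) h
    exact ⟨h1.1.symm, h1.1 ▸ h1.2⟩

/-- Both sides pair x with y by `entry f x y` times the dimension of a colour, once that of x and
once that of y. The entry vanishes unless these colours agree. -/
theorem tr_ev {X Y : Fib D} (f : X ⟶ Y) :
    tensMap (𝟙 X) (tr f) ≫ ev X = tensMap f (𝟙 Y) ≫ ev Y := by
  refine act_ext fun v ⟨x, y, m⟩ => ?_
  simp only [act_comp, act_tensMap, act_ev, act_id]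
  have h1 : act (tr f) (fun x' => if x = x' ∧ m = false ∧ (X.c x).isSome = true then
      dim D.ψ (X.c x) * v PUnit.unit else 0) y = if m = false ∧ (X.c x).isSome = true then
      entry f x y * (dim D.ψ (X.c x) * v PUnit.unit) else 0 := by
    simp [act, ite_and, tr]
  have h2 : act f (fun y' => if (Y.c y).isSome = true then
      if y' = y ∧ m = false ∧ (Y.c y').isSome = true then
      dim D.ψ (Y.c y') * v PUnit.unit else 0 else 0) x =
      if m = false ∧ (Y.c y).isSome = true then
      entry f x y * (dim D.ψ (Y.c y) * v PUnit.unit) else 0 := by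
    simp only [act]
    rw [Finset.sum_eq_single y (by intro z _ hz; simp [hz]) (by simp)]
    by_cases h : (Y.c y).isSome = true <;> simp [h]
  rw [h1, h2]
  by_cases h : X.c x = Y.c y ∧ (X.c x).isSome = true
  · have h3 : (Y.c y).isSome = true := h.1 ▸ h.2
    simp [h.1, h3]
  · simp [entry_eq_zero f h]

/-- A transpose is determined by its equation with the evaluations, so transposes can be computed by
guessing them and without the coevaluations. -/
theorem mate_eq {C : Type*} [Category C] [MonoidalCategory C] {X Y X' Y' : C}
    (p : ExactPairing X Y) (p' : ExactPairing X' Y') {f : Y ⟶ Y'} {g : X' ⟶ X}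
    (h : Y ◁ g ≫ ε_ X Y = f ▷ X' ≫ ε_ X' Y') : mate p p' f = g :=
  hom_ext_ev ((mate_ev p p' f).trans h.symm)

/-- Rebracketed so that in `Fib D` the right side becomes `evTens` by definition. -/
theorem tensor_evaluation_eq {C : Type*} [Category C] [MonoidalCategory C] {X Y X' Y' : C}
    [ExactPairing X Y] [ExactPairing X' Y'] : ε_ (X ⊗ X') (Y' ⊗ Y) =
    (α_ Y' Y (X ⊗ X')).hom ≫ Y' ◁ ((α_ Y X X').inv ≫ ε_ X Y ▷ X' ≫ (λ_ X').hom) ≫ ε_ X' Y' := by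
  rw [ExactPairing.tensor_evaluation]
  monoidal

theorem mate_eq_tr {X Y : Fib D} (f : X ⟶ Y) : mate (pairing X) (pairing Y) f = tr f :=
  mate_eq (pairing X) (pairing Y) (tr_ev f)

/-- The evaluation of the tensor product of two dual pairs. -/
def evTens (X Y : Fib D) : tens (tens X Y) (tens Y X) ⟶ one :=
  assocHom X Y (tens Y X) ≫ tensMap (𝟙 X) (assocInv Y Y X ≫ tensMap (ev Y) (𝟙 X) ≫
    leftUnitorHom X) ≫ ev X

/-- The coefficients of `evTens`. -/
def kap (ψ : k) (a b : Option Bool) (m : Bool) : k :=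
  if a = some true ∧ b = some true then 1 + ψ else dim ψ (some m)

/-- The ratio between the coefficients of `ev` and those of `evTens`. -/
def theta (ψ : k) (a b : Option Bool) (m : Bool) : k :=
  if a = some true ∧ b = some true ∧ m = false then ψ else 1

/-- The nested evaluation pairs the summand m of X ⊗ Y only with the same summand of Y ⊗ X. For two
copies of ν it does so with the coefficient 1 + ψ for both values of m, whereas the evaluation of X
⊗ Y has the dimension of m as its coefficient; `theta` corrects the difference at m = 𝟙. -/
theorem act_evTens (X Y : Fib D) (v : (one : Fib D).T → k) (p : (tens (tens X Y) (tens Y X)).T) :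
    act (evTens X Y) v p =
    if p.1.1 = p.2.1.2.1 ∧ p.1.2.1 = p.2.1.1 ∧ p.1.2.2 = p.2.1.2.2 ∧ p.2.2 = false ∧
      N (X.c p.1.1) (Y.c p.1.2.1) p.1.2.2 = true then
      kap D.ψ (X.c p.1.1) (Y.c p.1.2.1) p.1.2.2 * v PUnit.unit else 0 := by
  obtain ⟨⟨x, y, m⟩, ⟨y', x', m'⟩, l⟩ := p
  simp only [evTens, act_comp, act_tensMap, act_ev, act_id, act_assocHom, act_assocInv,
    act_leftUnitorHom]
  have hψ := D.ψ_sq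
  by_cases hx : x = x'
  · by_cases hy : y = y'
    · subst hx hy
      generalize v PUnit.unit = t
      generalize X.c x = a, Y.c y = b
      rcases a with _ | a <;> [skip; cases a] <;> (rcases b with _ | b <;> [skip; cases b]) <;>
        cases l <;> cases m <;> cases m' <;> simp [F, Finv, N, col, G, dim, kap]
      · linear_combination (1 + D.ψ) * t * hψ
      · linear_combination (1 + D.ψ) * t * hψ
    · simp [hy]
  · simp [hx]

/-- The only case that needs a relation is ν ⊗ ν with summand 𝟙, where ψ(1 + ψ) = 1. -/
theorem theta_mul_kap (D : FibParams k) {a b : Option Bool} {m : Bool} :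
    theta D.ψ a b m * kap D.ψ a b m = dim D.ψ (some m) := by
  have hψ := D.ψ_sq
  rcases a with _ | a <;> [skip; cases a] <;> (rcases b with _ | b <;> [skip; cases b]) <;>
    cases m <;> simp [theta, kap, dim]
  linear_combination hψ

theorem kap_comm (ψ : k) (a b : Option Bool) (m : Bool) : kap ψ a b m = kap ψ b a m := by
  simp only [kap, and_comm]

theorem N_self (m : Bool) : N (some m) (some m) false = true := by
  revert m; decide

theorem swap_evTens (X Y : Fib D) :
    tensMap (𝟙 (tens X Y)) (swap (theta D.ψ) X Y) ≫ evTens X Y = ev (tens X Y) := by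
  refine act_ext fun v ⟨⟨x, y, m⟩, ⟨x', y', m'⟩, l⟩ => ?_
  simp only [act_comp, act_tensMap, act_swap, act_id, act_evTens, act_ev, isSome_col]
  by_cases h : x = x' ∧ y = y' ∧ m = m' ∧ l = false ∧ N (X.c x) (Y.c y) m = true
  · obtain ⟨rfl, rfl, rfl, rfl, h⟩ := h
    rw [col_eq_some h, ← theta_mul_kap D (a := X.c x) (b := Y.c y)]
    simp [h, N_self, mul_assoc]
  · have h' : ¬ ((x, y, m) = (x', y', m') ∧ l = false ∧ N (X.c x) (Y.c y) m = true) := fun e => h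
      (by simp only [Prod.mk.injEq] at e; tauto)
    rw [if_neg h', if_neg h]
    simp

/-- This is the equation of `swap_evTens` with the interchange in the other argument. It holds with
the same coefficients because `kap` and the fusion rules are symmetric in the two colours. -/
theorem swap_evTens' (X Y : Fib D) :
    tensMap (swap (theta D.ψ) X Y) (𝟙 (tens X Y)) ≫ evTens Y X = ev (tens X Y) := by
  refine act_ext fun v ⟨⟨x, y, m⟩, ⟨x', y', m'⟩, l⟩ => ?_
  simp only [act_comp, act_tensMap, act_swap, act_id, act_evTens, act_ev, isSome_col]
  by_cases h : x = x' ∧ y = y' ∧ m = m' ∧ l = false ∧ N (X.c x) (Y.c y) m = true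
  · obtain ⟨rfl, rfl, rfl, rfl, h⟩ := h
    rw [col_eq_some h, ← theta_mul_kap D (a := X.c x) (b := Y.c y), N_comm (Y.c y),
      kap_comm _ (Y.c y)]
    simp [h, N_self, mul_assoc]
  · have h' : ¬ ((x, y, m) = (x', y', m') ∧ l = false ∧ N (X.c x) (Y.c y) m = true) := fun e => h
      (by simp only [Prod.mk.injEq] at e; tauto)
    have h'' : ¬ (y = y' ∧ x = x' ∧ m = m' ∧ l = false ∧ N (Y.c y) (X.c x) m = true) := fun e => h
      (by rw [N_comm (Y.c y)] at e; tauto)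
    rw [if_neg h', if_neg h'']
    simp

/-- The canonical morphism from the dual of X ⊗ Y to the product of the duals is not the plain
interchange of factors, since the two evaluations differ by `theta`. -/
theorem mate_tensor (X Y : Fib D) :
    mate (@ExactPairing.tensor _ _ _ _ _ _ _ (pairing Y) (pairing X)) (pairing (X ⊗ Y))
      (𝟙 (X ⊗ Y)) = swap (theta D.ψ) X Y := by
  refine mate_eq (@ExactPairing.tensor _ _ _ _ _ _ _ (pairing Y) (pairing X)) (pairing (X ⊗ Y)) ?_
  rw [@tensor_evaluation_eq _ _ _ _ _ _ _ (pairing Y) (pairing X), id_whiskerRight,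
    Category.id_comp]
  exact swap_evTens X Y

/-- The first transposition yields `swap (theta D.ψ) X Y` and introduces the factor `theta`; the
second one, by `swap_evTens'`, compensates both the interchange and the factor. This is why
identities form a monoidal transformation to the double dual. -/
theorem rrTensor_eq (X Y : Fib D) : rrTensor X Y = 𝟙 (X ⊗ Y) := by
  refine (congrArg (mate (pairing (X ⊗ Y))
    (@ExactPairing.tensor _ _ _ _ _ _ _ (pairing X) (pairing Y))) (mate_tensor X Y)).trans ?_
  refine mate_eq (pairing (X ⊗ Y)) (@ExactPairing.tensor _ _ _ _ _ _ _ (pairing X) (pairing Y)) ?_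
  rw [@tensor_evaluation_eq _ _ _ _ _ _ _ (pairing X) (pairing Y), whiskerLeft_id,
    Category.id_comp]
  exact (swap_evTens' X Y).symm

/-- The chosen evaluation of the unit object is the unitor, so its pairing has the same evaluation
as the canonical one and both transposes are identities. -/
theorem rrUnit_eq : rrUnit = 𝟙 (𝟙_ (Fib D)) := by
  have h : ev one = (ρ_ (𝟙_ (Fib D))).hom := by
    refine act_ext fun v ⟨x, y, m⟩ => ?_
    refine (act_ev _ _ _).trans (Eq.trans ?_ (act_rightUnitorHom _ _ _).symm)
    cases m <;> simp [dim]
  have h1 : mate exactPairingUnit (pairing (𝟙_ (Fib D))) (𝟙 (𝟙_ (Fib D))) = 𝟙 (𝟙_ (Fib D)) := by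
    refine mate_eq exactPairingUnit (pairing (𝟙_ (Fib D))) ?_
    rw [id_whiskerRight, whiskerLeft_id, Category.id_comp, Category.id_comp]
    exact h.symm
  refine (congrArg (mate (pairing (𝟙_ (Fib D))) exactPairingUnit) h1).trans ?_
  refine mate_eq (pairing (𝟙_ (Fib D))) exactPairingUnit ?_
  rw [id_whiskerRight, whiskerLeft_id, Category.id_comp, Category.id_comp]
  exact h

variable (D) in
/-- The pivotal structure of the Fibonacci category. -/
def pivotal : PivotalStructure (Fib D) where
  iso X := Iso.refl X
  naturality {X Y} f := by
    have h : rrMap f = f := by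
      refine (congrArg (mate (pairing Y) (pairing X)) (mate_eq_tr f)).trans ?_
      exact mate_eq_tr (tr f)
    rw [h]
    exact (Category.comp_id f).trans (Category.id_comp f).symm
  tensor X Y := by
    rw [rrTensor_eq]
    change 𝟙 (X ⊗ Y) = (𝟙 X ⊗ₘ 𝟙 Y) ≫ 𝟙 (X ⊗ Y)
    rw [id_tensorHom_id, Category.comp_id]
  unit := rrUnit_eq.symm

/-- The pivotal isomorphism is an identity, and so is the transpose that identifies X with the right
dual of its left dual. Quantum dimensions can therefore be computed as `coev` followed by `ev`. -/
theorem cap_pivotal (X : Fib D) : (pivotal D).cap (lPairing X) = ev X := by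
  have h : mate (rPairing X) (lPairing X) (𝟙 X) = 𝟙 X := mate_eq_tr (𝟙 X) |>.trans (by
    refine hom_ext fun x y => ?_
    change entry (𝟙 X) y x = entry (𝟙 X) x y
    rw [entry_id, entry_id]
    by_cases e : x = y
    · subst e; rfl
    · simp [e, Ne.symm e])
  have h2 : (pivotal D).cap (lPairing X) = X ◁ 𝟙 X ≫ mate (rPairing X) (lPairing X) (𝟙 X) ▷ X ≫ ev X :=
    rfl
  rw [h2, h]
  change X ◁ 𝟙 X ≫ 𝟙 X ▷ X ≫ ev X = ev X
  rw [whiskerLeft_id, id_whiskerRight, Category.id_comp, Category.id_comp]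

open Limits

/-! ### Abelian structure from pairs of vector spaces -/

/-- The block of a morphism at the elements of colour `i`. -/
def block {X Y : Fib D} (f : X ⟶ Y) (i : Bool) :
    Matrix {y : Y.T // Y.c y = some i} {x : X.T // X.c x = some i} k :=
  Matrix.of fun y x => entry f x.1 y.1

theorem block_id (X : Fib D) (i : Bool) : block (𝟙 X) i = 1 := by
  ext ⟨y, hy⟩ ⟨x, hx⟩
  change entry (𝟙 X) x y = _
  rw [entry_id, Matrix.one_apply]
  by_cases h : x = y
  · subst h; simp [hx]
  · simp [h, Ne.symm h]

/-- The order is reversed because blocks have rows indexed by the target, as matrices acting on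
column vectors do. Only middle elements of colour i contribute, since morphisms preserve colours. -/
theorem block_comp {X Y Z : Fib D} (f : X ⟶ Y) (g : Y ⟶ Z) (i : Bool) :
    block (f ≫ g) i = block g i * block f i := by
  ext ⟨z, hz⟩ ⟨x, hx⟩
  rw [Matrix.mul_apply]
  change entry (f ≫ g) x z = ∑ y : {y : Y.T // Y.c y = some i}, entry g y.1 z * entry f x y.1
  rw [entry_comp, ← Finset.sum_subtype (Finset.univ.filter fun y => Y.c y = some i) (by simp)
    (fun y => entry g y z * entry f x y), Finset.sum_filter]
  refine Finset.sum_congr rfl fun y _ => ?_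
  split_ifs with h
  · exact mul_comm _ _
  · rw [entry_eq_zero f fun e => h (e.1 ▸ hx), zero_mul]

variable (D) in
/-- The functor that maps an object to the vector spaces spanned by its elements of either
colour. -/
noncomputable def toVect : Fib D ⥤ Discrete Bool ⥤ FGModuleCat.{u} k where
  obj X := Discrete.functor fun i => FGModuleCat.of k ({x : X.T // X.c x = some i} → k)
  map f := Discrete.natTrans fun i => FGModuleCat.ofHom (Matrix.toLin' (block f i.as))
  map_id X := by
    ext i : 2
    apply FGModuleCat.hom_ext
    change Matrix.toLin' (block (𝟙 X) i.as) = LinearMap.id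
    rw [block_id, Matrix.toLin'_one]
  map_comp f g := by
    ext i : 2
    apply FGModuleCat.hom_ext
    change Matrix.toLin' (block (f ≫ g) i.as) =
      (Matrix.toLin' (block g i.as)).comp (Matrix.toLin' (block f i.as))
    rw [block_comp, Matrix.toLin'_mul]

theorem toVect_map_app {X Y : Fib D} (f : X ⟶ Y) (i : Bool) :
    (((toVect D).map f).app ⟨i⟩).hom.hom = Matrix.toLin' (block f i) := rfl

instance : (toVect D).Faithful where
  map_injective {X Y} f g h := by
    refine hom_ext fun x y => ?_
    by_cases e : X.c x = Y.c y ∧ (X.c x).isSome = true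
    · obtain ⟨i, hi⟩ := Option.isSome_iff_exists.1 e.2
      have h1 : Matrix.toLin' (block f i) = Matrix.toLin' (block g i) := by
        rw [← toVect_map_app, h, toVect_map_app]
      have h2 := Matrix.toLin'.injective h1
      exact congrFun (congrFun h2 ⟨y, e.1 ▸ hi⟩) ⟨x, hi⟩
    · rw [entry_eq_zero f e, entry_eq_zero g e]

instance : (toVect D).Full where
  map_surjective {X Y} τ := by
    let M : ∀ i, Matrix {y : Y.T // Y.c y = some i} {x : X.T // X.c x = some i} k :=
      fun i => LinearMap.toMatrix' (τ.app ⟨i⟩).hom.hom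
    -- The sum over i glues the two blocks: at most one term is present, namely the one for the
    -- common colour of x and y.
    let f : X ⟶ Y := mk' (fun x y => ∑ i, if h : X.c x = some i ∧ Y.c y = some i then
      M i ⟨y, h.2⟩ ⟨x, h.1⟩ else 0) fun x y h => ?_
    · refine ⟨f, ?_⟩
      ext ⟨i⟩ : 2
      apply FGModuleCat.hom_ext
      rw [toVect_map_app]
      have h1 : block f i = M i := by
        ext ⟨y, hy⟩ ⟨x, hx⟩
        refine (?_ : (∑ j : Bool, if h : X.c x = some j ∧ Y.c y = some j then
          M j ⟨y, h.2⟩ ⟨x, h.1⟩ else 0) = M i ⟨y, hy⟩ ⟨x, hx⟩)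
        rw [Finset.sum_eq_single i]
        · rw [dif_pos ⟨hx, hy⟩]
        · exact fun j _ hj => dif_neg fun e => hj (Option.some.inj (e.1.symm.trans hx))
        · simp
      rw [h1]
      exact Matrix.toLin'_toMatrix' _
    · obtain ⟨i, _, hi⟩ := Finset.exists_ne_zero_of_sum_ne_zero h
      split_ifs at hi with e
      · exact ⟨e.1.trans e.2.symm, by rw [e.1]; rfl⟩
      · exact absurd rfl hi
instance : (toVect D).EssSurj where
  mem_essImage F := by
    -- One element for each vector of a basis, coloured by the index i of the space; there are no
    -- dead elements.
    let X : Fib D := ⟨ULift.{u} (Σ i : Bool, Fin (Module.finrank k (F.obj ⟨i⟩))),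
      fun x => some x.down.1⟩
    have e : ∀ i : Bool, {x : X.T // X.c x = some i} ≃ Fin (Module.finrank k (F.obj ⟨i⟩)) := by
      refine fun i =>
        { toFun := fun x => Fin.cast (by rw [Option.some.inj x.2]) x.1.down.2
          invFun := fun j => ⟨⟨⟨i, j⟩⟩, rfl⟩
          left_inv := ?_
          right_inv := fun j => rfl }
      rintro ⟨⟨⟨j, a⟩⟩, h⟩
      obtain rfl := Option.some.inj h
      rfl
    have l : ∀ i : Bool, ({x : X.T // X.c x = some i} → k) ≃ₗ[k] F.obj ⟨i⟩ := fun i =>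
      LinearEquiv.ofFinrankEq _ _ (by
        rw [Module.finrank_fintype_fun_eq_card, Fintype.card_congr (e i), Fintype.card_fin])
    exact ⟨X, ⟨Discrete.natIso fun i => (l i.as).toFGModuleCatIso⟩⟩

instance : (toVect D).IsEquivalence where

instance : HasFiniteProducts (Fib D) where
  out _ := Adjunction.hasLimitsOfShape_of_equivalence (toVect D)

variable (D) in
/-- The proof that the Fibonacci category is abelian. -/
@[reducible] noncomputable def abelianAux : Abelian (Fib D) := abelianOfEquivalence (toVect D)

/-- The additive structure is stated explicitly, so that it is visibly the one to which the linear
and monoidal instances refer. Only normality, kernels and cokernels are taken from the equivalence.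
-/
noncomputable instance : Abelian (Fib D) where
  toPreadditive := inferInstance
  toIsNormalMonoCategory := (abelianAux D).toIsNormalMonoCategory
  toIsNormalEpiCategory := (abelianAux D).toIsNormalEpiCategory
  has_kernels := (abelianAux D).has_kernels
  has_cokernels := (abelianAux D).has_cokernels

/-! ### Simple objects, semisimplicity and the fusion rule -/

variable (D) in
/-- The object with one element, of colour `a`. -/
@[reducible] def S (a : Bool) : Fib D where
  T := PUnit
  c _ := some a

/-- The inclusion of an element. -/
def incl {X : Fib D} (x : X.T) {a : Bool} (h : X.c x = some a) : S D a ⟶ X :=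
  mk' (fun _ y => if x = y then 1 else 0) fun _ y e => by
    have e' : x = y := by_contra fun h' => e (if_neg h')
    exact ⟨by rw [← e', h], rfl⟩

/-- The projection to an element. -/
def proj {X : Fib D} (x : X.T) {a : Bool} (h : X.c x = some a) : X ⟶ S D a :=
  mk' (fun y _ => if x = y then 1 else 0) fun y _ e => by
    have e' : x = y := by_contra fun h' => e (if_neg h')
    exact ⟨by rw [← e', h], by rw [← e', h]; rfl⟩

theorem entry_incl {X : Fib D} (x y : X.T) {a : Bool} (h : X.c x = some a) (i : PUnit) :
    entry (incl x h) i y = if x = y then 1 else 0 := rfl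

theorem entry_proj {X : Fib D} (x y : X.T) {a : Bool} (h : X.c x = some a) (i : PUnit) :
    entry (proj x h) y i = if x = y then 1 else 0 := rfl

theorem incl_proj_self {X : Fib D} (x : X.T) {a : Bool} (h : X.c x = some a) :
    incl x h ≫ proj x h = 𝟙 _ := by
  refine hom_ext fun i j => ?_
  rw [entry_comp, entry_id]
  simp [entry_incl, entry_proj]

theorem incl_proj_of_ne {X : Fib D} {x y : X.T} (e : x ≠ y) {a b : Bool} (h : X.c x = some a)
    (h' : X.c y = some b) : incl x h ≫ proj y h' = 0 := by
  refine hom_ext fun i j => ?_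
  rw [entry_comp, entry_zero]
  simp [entry_incl, entry_proj, e]

theorem entry_proj_comp_incl {X : Fib D} (x y z : X.T) {a : Bool} (h : X.c x = some a) :
    entry (proj x h ≫ incl x h) y z = if x = y then if y = z then 1 else 0 else 0 := by
  rw [entry_comp]
  change ∑ i : PUnit, _ = _
  simp only [entry_incl, entry_proj, Finset.sum_const, Finset.card_univ, Fintype.card_punit]
  by_cases e : x = y <;> simp [e]

theorem id_S_ne_zero (a : Bool) : 𝟙 (S D a) ≠ 0 := fun h => by
  have h1 : entry (𝟙 (S D a)) PUnit.unit PUnit.unit = 0 := by rw [h]; rfl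
  rw [entry_id] at h1
  simp at h1

/-- A nonzero morphism to `S D a` has a nonzero entry at some element y, which then has colour a.
The rescaled inclusion of y is a section, and a split epimorphism that is mono is an isomorphism. -/
instance simple_S (a : Bool) : Simple (S D a) where
  mono_isIso_iff_nonzero {Y} f _ := by
    refine ⟨fun _ h => id_S_ne_zero (D := D) a ?_, fun h => ?_⟩
    · exact (IsIso.inv_hom_id f).symm.trans ((congrArg (inv f ≫ ·) h).trans comp_zero)
    · obtain ⟨y, hy⟩ : ∃ y, entry f y PUnit.unit ≠ 0 := by
        by_contra! h'
        exact h (hom_ext fun y _ => h' y)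
      have hc := not_imp_comm.1 (entry_eq_zero f) hy
      have hs : ((entry f y PUnit.unit)⁻¹ • incl y hc.1) ≫ f = 𝟙 (S D a) := by
        refine hom_ext fun i j => ?_
        rw [entry_comp, entry_id]
        simp [entry_incl, hy]
      have : IsSplitEpi f := ⟨⟨_, hs⟩⟩
      exact isIso_of_mono_of_isSplitEpi f

theorem exists_alive {X : Fib D} (h : 𝟙 X ≠ 0) : ∃ x a, X.c x = some a := by
  by_contra! h'
  refine h (hom_ext fun x y => ?_)
  refine entry_eq_zero _ fun e => ?_
  obtain ⟨a, ha⟩ := Option.isSome_iff_exists.1 e.2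
  exact h' x a ha

/-- A simple object has an element with a colour, and the inclusion of this element is a nonzero
morphism between simple objects. -/
theorem iso_S_of_simple (X : Fib D) [Simple X] : ∃ a, Nonempty (X ≅ S D a) := by
  obtain ⟨x, a, hx⟩ := exists_alive (id_nonzero X)
  have h : incl x hx ≠ 0 := fun h => id_S_ne_zero (D := D) a (by
    rw [← incl_proj_self x hx, h, zero_comp])
  have := isIso_of_hom_simple h
  exact ⟨a, ⟨(asIso (incl x hx)).symm⟩⟩

attribute [local instance] Abelian.hasFiniteBiproducts Abelian.hasBinaryBiproducts

theorem semisimple (X : Fib D) :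
    ∃ (n : ℕ) (T : Fin n → Fib D), (∀ i, Simple (T i)) ∧ Nonempty (X ≅ ⨁ T) := by
  -- Only elements with a colour give summands. Recording the colour as a Boolean next to the
  -- element makes it available without a choice; it is determined by the element, whence `hinj`.
  let A := {p : X.T × Bool // X.c p.1 = some p.2}
  let e : A ≃ Fin (Fintype.card A) := Fintype.equivFin A
  let x : Fin (Fintype.card A) → X.T := fun i => (e.symm i).1.1
  let c : Fin (Fintype.card A) → Bool := fun i => (e.symm i).1.2
  have hx : ∀ i, X.c (x i) = some (c i) := fun i => (e.symm i).2
  have hinj : ∀ i j, x i = x j → i = j := fun i j h => e.symm.injective <| by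
    refine Subtype.ext (Prod.ext h (Option.some.inj ?_))
    exact (hx i).symm.trans ((congrArg X.c h).trans (hx j))
  refine ⟨_, fun i => S D (c i), fun i => inferInstance, ⟨⟨biproduct.lift fun i => proj (x i) (hx i),
    biproduct.desc fun i => incl (x i) (hx i), ?_, ?_⟩⟩⟩
  · rw [biproduct.lift_desc]
    refine hom_ext fun y z => ?_
    rw [entry_sum, entry_id]
    simp only [entry_proj_comp_incl]
    -- At a dead element both the identity and every summand vanish; at any other exactly one
    -- summand contributes.
    cases hy : X.c y with
    | none =>
      rw [Finset.sum_eq_zero fun i _ => if_neg fun h => ?_]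
      · simp
      · rw [← h, hx] at hy
        exact Option.some_ne_none _ hy
    | some a =>
      have h0 : x (e ⟨(y, a), hy⟩) = y := by simp [x]
      rw [Finset.sum_eq_single (e ⟨(y, a), hy⟩) (fun i _ hi => if_neg fun h =>
        hi (hinj _ _ (h.trans h0.symm))) (by simp), if_pos h0]
      simp
  · refine biproduct.hom_ext' _ _ fun i => biproduct.hom_ext _ _ fun j => ?_
    rw [Category.comp_id]
    simp only [Category.assoc, biproduct.ι_desc_assoc, biproduct.lift_π]
    by_cases h : i = j
    · subst h
      rw [incl_proj_self, biproduct.ι_π_self]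
    · rw [incl_proj_of_ne fun h' => h (hinj i j h'), biproduct.ι_π_ne _ h]

instance : IsFusionCategory k (Fib D) where
  finite_hom X Y := inferInstance
  simple_unit := simple_S false
  semisimple := semisimple
  finite_simple := ⟨2, fun i => S D (i == 1), fun X _ => by
    obtain ⟨a, h⟩ := iso_S_of_simple X
    cases a
    · exact ⟨0, h⟩
    · exact ⟨1, h⟩⟩

/-- The underlying set of ν ⊗ ν has two elements, one for each Boolean, and the fusion rules allow
both. The object of colour `some false` with one element is the unit object by definition. -/
theorem fusion_rule : Nonempty (S D true ⊗ S D true ≅ 𝟙_ (Fib D) ⊞ S D true) := by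
  let X : Fib D := tens (S D true) (S D true)
  let p : ∀ a, X ⟶ S D a := fun a => proj (X := X) (PUnit.unit, PUnit.unit, a) rfl
  let q : ∀ a, S D a ⟶ X := fun a => incl (X := X) (PUnit.unit, PUnit.unit, a) rfl
  have hp : ∀ a b, a ≠ b → q a ≫ p b = 0 := fun a b h => incl_proj_of_ne
    (fun e => h (congrArg (fun t : PUnit × PUnit × Bool => t.2.2) e)) _ _
  have hq : ∀ a, q a ≫ p a = 𝟙 _ := fun a => incl_proj_self _ _
  let e : X ≅ S D false ⊞ S D true := ⟨biprod.lift (p false) (p true),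
    biprod.desc (q false) (q true), by
    rw [biprod.lift_desc]
    refine hom_ext fun ⟨_, _, a⟩ ⟨_, _, b⟩ => ?_
    refine (congrArg₂ (· + ·) (entry_proj_comp_incl (X := X) _ _ _ _)
      (entry_proj_comp_incl (X := X) _ _ _ _)).trans ?_
    rw [entry_id]
    cases a <;> cases b <;> simp [X, col, N], by
    refine biprod.hom_ext' _ _ (biprod.hom_ext _ _ ?_ ?_) (biprod.hom_ext _ _ ?_ ?_) <;>
      simp only [biprod.inl_desc_assoc, biprod.inr_desc_assoc, Category.assoc, Category.comp_id,
        biprod.lift_fst, biprod.lift_snd, biprod.inl_fst, biprod.inl_snd, biprod.inr_fst,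
        biprod.inr_snd, hq, hp _ _ Bool.false_ne_true, hp _ _ Bool.false_ne_true.symm]⟩
  exact ⟨e⟩

theorem dim_S_true : coev (S D true) ≫ ev (S D true) = (1 + D.ψ) • 𝟙 (𝟙_ (Fib D)) := by
  refine act_ext fun v i => ?_
  rw [act_comp, act_coev, act_smul]
  refine Eq.trans ?_ (congrArg _ (act_id (one : Fib D) v i).symm)
  change ∑ x : PUnit, _ = _
  simp [act_ev, dim]

theorem isFibonacci : IsFibonacci k (pivotal D) (S D true) (1 + D.ψ) where
  simple := simple_S true
  not_iso := ⟨fun e => id_S_ne_zero (D := D) true (by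
    -- Morphisms preserve colours, so there is no nonzero morphism from ν to 𝟙.
    have h : e.hom = 0 := hom_ext fun x y => entry_eq_zero e.hom fun h => by
      simpa using Option.some.inj h.1
    rw [← e.hom_inv_id, h, zero_comp])⟩
  iso_of_simple X _ := by
    obtain ⟨a, h⟩ := iso_S_of_simple X
    cases a
    · exact Or.inl h
    · exact Or.inr h
  fusion := fusion_rule
  dim := by
    rw [cap_pivotal]
    exact dim_S_true

end Fib
end FibonacciCategory

/-! ### Dimension counts and the obstruction -/

section TubeDimensions
open Limits TensorProduct

universe v

attribute [local instance] Abelian.hasBinaryBiproducts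

/-- V ⊠ W is the image of an operator on V ⊗ W, hence a subspace of it. -/
theorem TubeAlg.BTensor.finrank_le (k A V W : Type u) [Field k] [Ring A] [Algebra k A]
    [WeakBialgebra k A] [AddCommGroup V] [Module k V] [Module A V] [IsScalarTower k A V]
    [FiniteDimensional k V] [AddCommGroup W] [Module k W] [Module A W] [IsScalarTower k A W]
    [FiniteDimensional k W] :
    Module.finrank k (BTensor k A V W) ≤ Module.finrank k V * Module.finrank k W := by
  rw [← Module.finrank_tensorProduct]
  exact LinearMap.finrank_le_finrank_of_injective (BTensor.incl_injective k A V W)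

/-- The underlying linear equivalence of an isomorphism of representations. -/
def TubeAlg.FDRep.linearEquivOfIso {k A : Type u} [Field k] [Ring A] [Algebra k A]
    {V W : FDRep k A} (e : V ≅ W) : V.carrier ≃ₗ[A] W.carrier :=
  LinearEquiv.ofLinearMap e.hom.lin e.inv.lin (congrArg FDRep.Hom.lin e.inv_hom_id)
    (congrArg FDRep.Hom.lin e.hom_inv_id)

theorem TubeAlg.FDRep.finrank_eq_of_iso {k A : Type u} [Field k] [Ring A] [Algebra k A]
    {V W : FDRep k A} (e : V ≅ W) : Module.finrank k V.carrier = Module.finrank k W.carrier :=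
  ((linearEquivOfIso e).restrictScalars k).finrank_eq

variable (k : Type v) {C : Type u} [Field k] [Category.{v} C] [Abelian C]
  [Linear k C] [MonoidalCategory C] [MonoidalPreadditive C] [MonoidalLinear k C]
  [RigidCategory C] [IsFusionCategory k C] (I : Irr C)

theorem finrank_pi_irr_hom (A : C) : Module.finrank k (∀ x : I.ι, I.obj x ⟶ A) =
    ∑ x, Module.finrank k (I.obj x ⟶ A) := by
  have := IsFusionCategory.finite_hom (k := k) (C := C)
  exact Module.finrank_pi_fintype k

/-- A biproduct decomposition splits the spaces of morphisms into the object. -/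
noncomputable def homEquivOfIsoBiprod {A P Q : C} (e : A ≅ P ⊞ Q) (x : C) :
    (x ⟶ A) ≃ₗ[k] (x ⟶ P) × (x ⟶ Q) :=
  LinearEquiv.ofLinearMap
    ((Linear.rightComp k x (e.hom ≫ biprod.fst)).prod (Linear.rightComp k x (e.hom ≫ biprod.snd)))
    ((Linear.rightComp k x (biprod.inl ≫ e.inv)).coprod
      (Linear.rightComp k x (biprod.inr ≫ e.inv)))
    (LinearMap.ext fun f => Prod.ext (by simp) (by simp))
    (LinearMap.ext fun f => by
      change (f ≫ e.hom ≫ biprod.fst) ≫ biprod.inl ≫ e.inv +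
        (f ≫ e.hom ≫ biprod.snd) ≫ biprod.inr ≫ e.inv = f
      have h : e.hom ≫ (biprod.fst ≫ biprod.inl + biprod.snd ≫ biprod.inr) ≫ e.inv = 𝟙 A := by
        rw [biprod.total, Category.id_comp, e.hom_inv_id]
      refine Eq.trans ?_ ((congrArg (f ≫ ·) h).trans (Category.comp_id f))
      simp only [Preadditive.comp_add, Preadditive.add_comp, Category.assoc])

/-- The dimension of J is additive on direct sums of underlying objects. No half-braiding on the
summands is involved, so this also applies to decompositions that do not lift to the Drinfeld
center, as may happen for z ⊗ z. -/
theorem finrank_pi_irr_hom_of_iso_biprod {A P Q : C} (e : A ≅ P ⊞ Q) :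
    Module.finrank k (∀ x : I.ι, I.obj x ⟶ A) = Module.finrank k (∀ x : I.ι, I.obj x ⟶ P) +
      Module.finrank k (∀ x : I.ι, I.obj x ⟶ Q) := by
  have := IsFusionCategory.finite_hom (k := k) (C := C)
  rw [finrank_pi_irr_hom, finrank_pi_irr_hom, finrank_pi_irr_hom, ← Finset.sum_add_distrib]
  refine Finset.sum_congr rfl fun x _ => ?_
  rw [(homEquivOfIsoBiprod k e _).finrank_eq, Module.finrank_prod]

variable [IsAlgClosed k]

/-- A simple object is isomorphic to exactly one representative. -/
theorem finrank_pi_irr_hom_simple (S : C) [Simple S] :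
    Module.finrank k (∀ x : I.ι, I.obj x ⟶ S) = 1 := by
  have := IsFusionCategory.finite_hom (k := k) (C := C)
  obtain ⟨i, ⟨e⟩⟩ := I.exists_iso S inferInstance
  rw [finrank_pi_irr_hom, Finset.sum_eq_single i]
  · exact (finrank_hom_simple_simple_eq_one_iff k _ _).2 ⟨e.symm⟩
  · exact fun j _ hj => finrank_hom_simple_simple_eq_zero_of_not_iso k fun f =>
      hj (I.eq_of_iso _ _ ⟨f ≪≫ e⟩)
  · simp

variable (a : PivotalStructure C)

variable {I} in
-- Only the invertibility of the tensor structure at (Z, Z) is used; the unit and the coherence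
-- conditions of a monoidal functor do not enter.
theorem TubeAlg.J_isEmpty_monoidal [WeakBialgebra k (Tube k I)] {Z : Center C}
    (h : Module.finrank k ((J k a I).obj Z).carrier * Module.finrank k ((J k a I).obj Z).carrier <
      Module.finrank k ((J k a I).obj (Z ⊗ Z)).carrier) : IsEmpty (J k a I).Monoidal :=
  ⟨fun _ => (FDRep.finrank_eq_of_iso (Functor.Monoidal.μIso (J k a I) Z Z)).not_lt
    ((BTensor.finrank_le k _ _ _).trans_lt h)⟩

variable {a} [BraidedCategory C] {ν : C} {φ : k}

theorem TubeAlg.IsFibonacci.finrank_J (h : IsFibonacci k a ν φ) :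
    Module.finrank k ((J k a I).obj (centerObj ν)).carrier = 1 :=
  have := h.simple
  finrank_pi_irr_hom_simple k I ν

/-- The underlying object of the tensor product in the center is ν ⊗ ν by definition, so the fusion
rule applies and each of the two simple summands contributes 1. -/
theorem TubeAlg.IsFibonacci.finrank_J_tensor (h : IsFibonacci k a ν φ) :
    Module.finrank k ((J k a I).obj (centerObj ν ⊗ centerObj ν)).carrier = 2 := by
  have := h.simple
  have : Simple (𝟙_ C) := IsFusionCategory.simple_unit k
  obtain ⟨e⟩ := h.fusion
  refine (finrank_pi_irr_hom_of_iso_biprod k I e).trans ?_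
  rw [finrank_pi_irr_hom_simple, finrank_pi_irr_hom_simple]

end TubeDimensions

/-! ### The proposition -/

theorem propositionB8 (k : Type u) [Field k] [IsAlgClosed k] [CharZero k]
    (φ : k) (hφ : φ ^ 2 = φ + 1) :
    (∀ (A : Type u) [Ring A] [Algebra k A] [WeakBialgebra k A] (V W : Type u)
      [AddCommGroup V] [Module k V] [Module A V] [IsScalarTower k A V] [FiniteDimensional k V]
      [AddCommGroup W] [Module k W] [Module A W] [IsScalarTower k A W] [FiniteDimensional k W],
      Module.finrank k (BTensor k A V W) ≤ Module.finrank k V * Module.finrank k W) ∧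
    ∃ (C : Type (u + 1)) (_ : Category.{u} C) (_ : Abelian C) (_ : Linear k C)
      (_ : MonoidalCategory C) (_ : MonoidalPreadditive C) (_ : MonoidalLinear k C)
      (_ : RigidCategory C) (_ : BraidedCategory C) (_ : IsFusionCategory k C)
      (a : PivotalStructure C) (ν : C),
      IsFibonacci k a ν φ ∧
      ∀ I : Irr C,
        Module.finrank k ((J k a I).obj (centerObj ν)).carrier = 1 ∧
        Module.finrank k ((J k a I).obj (centerObj ν ⊗ centerObj ν)).carrier = 2 ∧
        ∀ _ : WeakBialgebra k (Tube k I), IsEmpty (J k a I).Monoidal := by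
  refine ⟨fun A _ _ _ V W => BTensor.finrank_le k A V W, ?_⟩
  -- A square root of the discriminant of r² + ψr + 1 with ψ = φ - 1. The quadratic formula then
  -- gives r; either choice of the root serves.
  obtain ⟨s, hs⟩ := IsAlgClosed.exists_pow_nat_eq ((φ - 1) ^ 2 - 4) (n := 2) (by norm_num)
  let D : FibParams k := ⟨φ - 1, (s - (φ - 1)) / 2, by linear_combination hφ, by
    field_simp
    linear_combination hs⟩
  have h : IsFibonacci k (Fib.pivotal D) (Fib.S D true) φ := by
    have h := Fib.isFibonacci (D := D)
    rwa [show 1 + D.ψ = φ from add_sub_cancel 1 φ] at h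
  refine ⟨Fib D, inferInstance, inferInstance, inferInstance, inferInstance, inferInstance,
    inferInstance, inferInstance, inferInstance, inferInstance, Fib.pivotal D, Fib.S D true, h,
    fun I => ?_⟩
  have h1 : Module.finrank k ((J k (Fib.pivotal D) I).obj (centerObj (Fib.S D true))).carrier = 1 :=
    h.finrank_J k I
  have h2 : Module.finrank k ((J k (Fib.pivotal D) I).obj
      (centerObj (Fib.S D true) ⊗ centerObj (Fib.S D true))).carrier = 2 :=
    h.finrank_J_tensor k I
  -- The numerical obstruction is 1 · 1 < 2.
  exact ⟨h1, h2, fun _ => J_isEmpty_monoidal k _ (by rw [h1, h2]; norm_num)⟩
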